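/- **Setting.** In prediction from experts (PFE) with $n\ge 2$ actions and $T$ iterations, an oblivious adversary draws a random loss table $(\ell_t(i))_{t\le T,\,i\le n}\in[0,1]^{T\times n}$ before the game. In iteration $t$ the algorithm plays an action $i_t\in\{1,\dots,n\}$ that depends on the complete loss vectors $\ell_1,\dots,\ell_{t-1}$ and on its own randomness, which is independent of the losses. Put $$\mathrm{Regret}=\sum_{t=1}^T \ell_t(i_t)-\min_{i}\sum_{t=1}^T \ell_t(i).$$ For $S\in\{1,\dots,T\}$ an $S$-budget algorithm is one with $\#\{t<T: i_{t+1}\ne i_t\}\le S$ for every loss table and every realization of its randomness. Let $R(T,n,S)$ be the infimum over $S$-budget algorithms of the supremum over oblivious adversaries of $\mathbb E[\mathrm{Regret}]$. For $c>0$, say that $(n,T,S)$ is in the $c$-high-switching regime if $n\ge2$, $1\le S\le T$ and $S\ge c\sqrt{T\log n}$. An algorithm is run efficiently by a program if the program, on a real RAM with a source of independent uniform $[0,1]$ random numbers (unit-cost addition and subtraction of natural numbers, which serve as counters and addresses; unit-cost $+,-,\times,/,\sqrt{\cdot},\exp,\log$ and comparisons of reals), plays it with at most $k(n+T)^k$ steps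 in the whole game, with $k$ as below. **Theorem (high-switching regime).** 1. *Optimal rate.* There is a universal $a>0$ such that for every $c>0$ there is $C>0$ such that, for all $(n,T,S)$ in the $c$-high-switching regime with $T\ge 2$, $$a\min\bigl(T,\sqrt{T\log n}\bigr)\le R(T,n,S)\le \min\bigl(T,\;C\sqrt{T\log n}\,\log T\bigr).$$ 2. *Upper bound in expectation.* For every $c>0$ there are $C,k$ and a single program, taking $n,T,S$ as input, that for all $(n,T,S)$ in the $c$-high-switching regime with $T\ge2$ efficiently runs an $S$-budget algorithm with $\mathbb E[\mathrm{Regret}]\le C\sqrt{T\log n}\,\log T$ against every oblivious adversary. 3. *Upper bound with high probability.* For every $c>0$ there are $C,k$ and a single program, taking $n,T,S,\delta$ as input, that for all $(n,T,S)$ in the $c$-high-switching regime and all $\delta\in(0,\tfrac12)$ efficiently runs an $S$-budget algorithm (which may depend on $\delta$) satisfying, against every oblivious adversary, $\mathrm{Regret}\le C\sqrt{T\log n}\,\log\tfrac1\delta$ with probability at least $1-\delta$. 4. *Lower bound in expectation.* There is a universal $a>0$ such that for every $c>0$ and all $(n,T,S)$ in the $c$-high-switching regime there is an oblivious adversary that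 forces every $S$-budget algorithm to incur $\mathbb E[\mathrm{Regret}]\ge a\min\bigl(T,\sqrt{T\log n}\bigr)$. 5. *Lower bound with high probability.* For every $\delta_1\in(0,\tfrac12)$ there is $a>0$ such that for every $c>0$, all $(n,T,S)$ in the $c$-high-switching regime and all $\delta\in(0,\tfrac12)$ (with $\delta\le\delta_1$ in case $n=2$) there is an oblivious adversary that forces every $S$-budget algorithm to incur $\mathrm{Regret}\ge a\min\bigl(T,\sqrt{T\log\tfrac n\delta}\bigr)$ with probability at least $\delta$. -/

import Mathlib

open MeasureTheory

/-! ## Prediction from experts against an oblivious adversary -/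

/-- A table of losses `ℓ_t(i) ∈ [0,1]`, for `T` iterations and `n` actions. A (randomized) oblivious
adversary is a probability measure on such tables: all losses are drawn before the game, and
independently of the player's internal randomness. -/
abbrev LossTable (n T : ℕ) : Type := Fin T → Fin n → unitInterval

/-- A randomized full-information algorithm for prediction from experts. The action of iteration `t`
is a function of the complete loss vectors of the earlier iterations and of the internal randomness
(the seed), whose law does not depend on the losses. -/
structure PFEAlgorithm (n T : ℕ) where
  Seed : Type
  [seedSpace : MeasurableSpace Seed]
  seedLaw : Measure Seed
  [isProbability : IsProbabilityMeasure seedLaw]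
  action : (t : Fin T) → (Fin t → Fin n → unitInterval) → Seed → Fin n
  measurable_action : ∀ t : Fin T,
    Measurable (fun p : (Fin t → Fin n → unitInterval) × Seed => action t p.1 p.2)

attribute [instance] PFEAlgorithm.seedSpace PFEAlgorithm.isProbability

/-- The sequence of actions played on the losses `ℓ` with the seed `ω`. -/
def PFEAlgorithm.play {n T : ℕ} (A : PFEAlgorithm n T) (ℓ : LossTable n T) (ω : A.Seed)
    (t : Fin T) : Fin n :=
  A.action t (fun s => ℓ ⟨s, s.isLt.trans t.isLt⟩) ω

/-- The number of switches: iterations followed by an iteration with a different action. -/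
def switches {n T : ℕ} (i : Fin T → Fin n) : ℕ :=
  (Finset.univ.filter
    (fun t : Fin T => ∃ h : (t : ℕ) + 1 < T, i ⟨(t : ℕ) + 1, h⟩ ≠ i t)).card

/-- `A` is an `S`-budget algorithm: it never makes more than `S` switches (a hard cap). -/
def PFEAlgorithm.HasBudget {n T : ℕ} (A : PFEAlgorithm n T) (S : ℕ) : Prop :=
  ∀ (ℓ : LossTable n T) (ω : A.Seed), switches (A.play ℓ ω) ≤ S

/-- Cumulative loss minus the cumulative loss of the best action in hindsight. -/
noncomputable def regret {n T : ℕ} (ℓ : LossTable n T) (i : Fin T → Fin n) : ℝ :=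
  (∑ t, (ℓ t (i t) : ℝ)) - ⨅ j : Fin n, ∑ t, (ℓ t j : ℝ)

/-- The joint law of the losses and of the seed. -/
noncomputable def PFEAlgorithm.gameLaw {n T : ℕ} (A : PFEAlgorithm n T)
    (adv : ProbabilityMeasure (LossTable n T)) : Measure (LossTable n T × A.Seed) :=
  (adv : Measure (LossTable n T)).prod A.seedLaw

noncomputable def PFEAlgorithm.expectedRegret {n T : ℕ} (A : PFEAlgorithm n T)
    (adv : ProbabilityMeasure (LossTable n T)) : ℝ :=
  ∫ p, regret p.1 (A.play p.1 p.2) ∂(A.gameLaw adv)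

noncomputable def PFEAlgorithm.probRegretLE {n T : ℕ} (A : PFEAlgorithm n T)
    (adv : ProbabilityMeasure (LossTable n T)) (r : ℝ) : ℝ :=
  (A.gameLaw adv).real {p | regret p.1 (A.play p.1 p.2) ≤ r}

noncomputable def PFEAlgorithm.probRegretGE {n T : ℕ} (A : PFEAlgorithm n T)
    (adv : ProbabilityMeasure (LossTable n T)) (r : ℝ) : ℝ :=
  (A.gameLaw adv).real {p | r ≤ regret p.1 (A.play p.1 p.2)}

/-- The optimal (minimax) expected regret of `S`-switching-budget prediction from experts. -/
noncomputable def minimaxRegret (n T S : ℕ) : ℝ :=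
  ⨅ A : {A : PFEAlgorithm n T // A.HasBudget S},
    ⨆ adv : ProbabilityMeasure (LossTable n T), A.1.expectedRegret adv

/-! ## Efficient algorithms: a randomized real RAM with a step count

The machine has finitely many named arrays of natural numbers and of real numbers. Natural numbers
(which serve as counters and addresses) can be added, subtracted and compared; real numbers admit
arithmetic, `√`, `exp`, `log` and comparisons; there is no conversion from reals to naturals. A coin
is a fresh uniform random number in `[0,1]`. Every node of an expression and every command costs
one step. -/

namespace RealRAM

/-- The memory, together with two counters that programs cannot read: the number of coins used and
the number of steps made so far. `nat k i` is the `i`-th cell of the `k`-th array of naturals. -/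
structure Store where
  nat : ℕ → ℕ → ℕ
  real : ℕ → ℕ → ℝ
  coinsUsed : ℕ
  steps : ℕ

inductive NatExp where
  | lit (m : ℕ)
  | cell (k : ℕ) (i : NatExp)
  | add (a b : NatExp)
  | sub (a b : NatExp)

inductive RealExp where
  | lit (q : ℚ)
  | cell (k : ℕ) (i : NatExp)
  | ofNat (a : NatExp)
  | add (a b : RealExp)
  | sub (a b : RealExp)
  | mul (a b : RealExp)
  | div (a b : RealExp)
  | sqrt (a : RealExp)
  | exp (a : RealExp)
  | log (a : RealExp)

/-- `loop a c` evaluates `a` once and then performs `c` that many times. -/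
inductive Cmd where
  | skip
  | setNat (k : ℕ) (i a : NatExp)
  | setReal (k : ℕ) (i : NatExp) (a : RealExp)
  | toss (k : ℕ) (i : NatExp)
  | seq (c d : Cmd)
  | ifNatLE (a b : NatExp) (c d : Cmd)
  | ifRealLE (a b : RealExp) (c d : Cmd)
  | loop (a : NatExp) (c : Cmd)

def NatExp.eval (σ : Store) : NatExp → ℕ
  | lit m => m
  | cell k i => σ.nat k (i.eval σ)
  | add a b => a.eval σ + b.eval σ
  | sub a b => a.eval σ - b.eval σ

def NatExp.cost : NatExp → ℕ
  | lit _ => 1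
  | cell _ i => i.cost + 1
  | add a b => a.cost + b.cost + 1
  | sub a b => a.cost + b.cost + 1

noncomputable def RealExp.eval (σ : Store) : RealExp → ℝ
  | lit q => q
  | cell k i => σ.real k (i.eval σ)
  | ofNat a => a.eval σ
  | add a b => a.eval σ + b.eval σ
  | sub a b => a.eval σ - b.eval σ
  | mul a b => a.eval σ * b.eval σ
  | div a b => a.eval σ / b.eval σ
  | sqrt a => Real.sqrt (a.eval σ)
  | exp a => Real.exp (a.eval σ)
  | log a => Real.log (a.eval σ)

def RealExp.cost : RealExp → ℕ
  | lit _ => 1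
  | cell _ i => i.cost + 1
  | ofNat a => a.cost + 1
  | add a b => a.cost + b.cost + 1
  | sub a b => a.cost + b.cost + 1
  | mul a b => a.cost + b.cost + 1
  | div a b => a.cost + b.cost + 1
  | sqrt a => a.cost + 1
  | exp a => a.cost + 1
  | log a => a.cost + 1

def Store.writeNat (σ : Store) (k i v : ℕ) : Store :=
  { σ with nat := Function.update σ.nat k (Function.update (σ.nat k) i v) }

noncomputable def Store.writeReal (σ : Store) (k i : ℕ) (v : ℝ) : Store :=
  { σ with real := Function.update σ.real k (Function.update (σ.real k) i v) }

def Store.tick (σ : Store) (m : ℕ) : Store :=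
  { σ with steps := σ.steps + m }

open Classical in
/-- The effect of a command, where `coins` is the stream of random numbers. -/
noncomputable def Cmd.run (coins : ℕ → unitInterval) : Cmd → Store → Store
  | skip, σ => σ.tick 1
  | setNat k i a, σ => (σ.writeNat k (i.eval σ) (a.eval σ)).tick (i.cost + a.cost + 1)
  | setReal k i a, σ => (σ.writeReal k (i.eval σ) (a.eval σ)).tick (i.cost + a.cost + 1)
  | toss k i, σ =>
      { (σ.writeReal k (i.eval σ) (coins σ.coinsUsed)).tick (i.cost + 1) with
        coinsUsed := σ.coinsUsed + 1 }
  | seq c d, σ => d.run coins (c.run coins σ)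
  | ifNatLE a b c d, σ =>
      if a.eval σ ≤ b.eval σ then c.run coins (σ.tick (a.cost + b.cost + 1))
      else d.run coins (σ.tick (a.cost + b.cost + 1))
  | ifRealLE a b c d, σ =>
      if a.eval σ ≤ b.eval σ then c.run coins (σ.tick (a.cost + b.cost + 1))
      else d.run coins (σ.tick (a.cost + b.cost + 1))
  | loop a c, σ => (fun τ => (c.run coins τ).tick 1)^[a.eval σ] (σ.tick (a.cost + 1))

/-- An online program: `init` is run before the first iteration, `step` after each iteration, once
the losses of that iteration have been observed. It does not depend on the sizes of the game. -/
structure Program where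
  init : Cmd
  step : Cmd

/-- The initial memory: `n`, `T`, `S` in the cells 0, 1, 2 of array 0 of naturals, a real parameter
`θ` in cell 0 of array 0 of reals, and zeros everywhere else. -/
noncomputable def inputStore (n T S : ℕ) (θ : ℝ) : Store where
  nat := fun k i => if k = 0 then (if i = 0 then n else if i = 1 then T else if i = 2 then S else 0)
    else 0
  real := fun k i => if k = 0 ∧ i = 0 then θ else 0
  coinsUsed := 0
  steps := 0

/-- Observing the losses of iteration `t`: they are written to array 1 of reals, in `n` steps. -/
noncomputable def Store.observe {n T : ℕ} (ℓ : LossTable n T) (t : ℕ) (σ : Store) : Store :=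
  { σ with
    real := Function.update σ.real 1
      (fun i => if h : t < T ∧ i < n then (ℓ ⟨t, h.1⟩ ⟨i, h.2⟩ : ℝ) else σ.real 1 i)
    steps := σ.steps + n }

/-- The memory just before the action of iteration `t` (counted from 0). -/
noncomputable def Program.exec {n T : ℕ} (P : Program) (S : ℕ) (θ : ℝ) (ℓ : LossTable n T)
    (coins : ℕ → unitInterval) : ℕ → Store
  | 0 => P.init.run coins (inputStore n T S θ)
  | t + 1 => P.step.run coins ((P.exec S θ ℓ coins t).observe ℓ t)

/-- The action is read off cell 0 of array 1 of naturals. -/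
noncomputable def Program.output {n T : ℕ} (P : Program) (S : ℕ) (θ : ℝ) (ℓ : LossTable n T)
    (coins : ℕ → unitInterval) (t : ℕ) : ℕ :=
  (P.exec S θ ℓ coins t).nat 1 0

/-- The law of a sequence of independent uniform random numbers in `[0,1]`. -/
noncomputable def coinLaw : Measure (ℕ → unitInterval) :=
  Measure.infinitePi (fun _ : ℕ => (volume : Measure unitInterval))

/-- With the inputs `n`, `T`, `S`, `θ`, the program `P` plays the algorithm `A`, the seed of `A`
providing the coins, and makes at most `N` steps in the whole game, whatever the losses and coins. -/
def Program.Implements {n T : ℕ} (P : Program) (S : ℕ) (θ : ℝ) (A : PFEAlgorithm n T) (N : ℕ) :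
    Prop :=
  (∃ φ : A.Seed → (ℕ → unitInterval), MeasurePreserving φ A.seedLaw coinLaw ∧
    ∀ (ℓ : LossTable n T) (ω : A.Seed) (t : Fin T),
      (A.play ℓ ω t : ℕ) = P.output S θ ℓ (φ ω) t) ∧
  ∀ (ℓ : LossTable n T) (coins : ℕ → unitInterval), (P.exec S θ ℓ coins T).steps ≤ N

end RealRAM

/-- At least two actions, a switching budget `S ∈ {1, …, T}`, and `S ≥ c √(T log n)`. -/
def HighSwitching (c : ℝ) (n T S : ℕ) : Prop :=
  2 ≤ n ∧ 1 ≤ S ∧ S ≤ T ∧ c * √((T : ℝ) * Real.log n) ≤ S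

/-! Upper bounds. Play follow-the-perturbed-leader with perturbations `scale * log (1 + n * u)`, `u`
uniform, which are bounded by `spread`. Raising one perturbation by 1 is an affine change of `u`,
and an action that leads with its perturbation raised by 1 leads by a margin of 1 without the raise,
so it survives another round of losses in `[0,1]`. Summed over the actions, this shows that the
leader changes in a given round with probability at most `2 / scale` (`measure_change_le`). A "be
the leader" telescoping bounds the regret of one run by `spread` plus the number of leader changes
(`score_leader_add_le`). Thus both regret and switching are controlled by the changes, but so far
only in expectation.

To get a high-probability bound under a hard cap, the perturbations are redrawn whenever `T / r`
rounds have passed or the changes reach a threshold. Each epoch then costs at most `spread +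
threshold + 1` regret and `threshold + 1` switches surely (`exists_inEpoch`, `loss_le`), and only
the number of epochs is random. An epoch is either long or, with probability at most `1/8` by
Markov, ended early. The exponential weight `8 ^ ((T - s) * r / T)` of the starting time therefore
shrinks by a factor 4 in expectation per epoch (`sum_weight_epochEnd_le`). Fresh coins make the
epochs independent of the past because the losses are fixed in advance, so more than about `3 * r`
epochs occur with probability at most `exp (-r)` (`measure_epochStart_lt_le`). Taking `r = log
(1/δ)` or `r = log T` gives the two upper bounds. A real-RAM program is shown to simulate this
algorithm step by step in polynomial time (`fplProgram_exec`, `Program.exists_steps_le`).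

Lower bounds. They hold without any budget. In every active round an outcome is drawn uniformly and
each expert sees a relabeling of it. For a fixed seed the action of a round depends only on earlier
outcomes, so the outcomes as seen by the algorithm are a bijective image of the uniform ones
(`bijective_of_predictable`, `exists_perm`): the cumulative loss of the algorithm has exactly the
law of that of a fixed expert. It remains to make the best expert good, or the algorithm unlucky.

With `k` blocks of fair signs and experts for all `2 ^ k` sign patterns, the best expert collects
the absolute block sums, which a fourth-moment bound keeps of order `√B` on average. This gives the
expectation bound, and by Chebyshev the probability bound for large `n`. For small `δ`, two opposite
experts suffice: all blocks are unfavourable to the algorithm with probability at least `(3/32) ^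
k`. When `n` and `1/δ` are bounded, only order `√T` is needed, but with probability up to one half.
Two experts give any `δ₁ < 1/2` by anticoncentration of the binomial law. Three experts whose gains
sum to zero give the full `1/2` (`freq_lt_add_expect_noGain_le`): that no expert gains `g` confines
two differences at once and so is much rarer than the fixed expert being within `g / 2` of zero, an
event that supplies slack below one half. -/

/-! ## Cost and input preservation for simple programs -/

namespace RealRAM

/-- The expression reading the number of actions. -/
abbrev sizeExp : NatExp := .cell 0 (.lit 0)

/-- Commands that leave the input cells alone and whose loops all run over the actions. -/
def Cmd.Tame : Cmd → Prop
  | skip => True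
  | setNat k _ _ => k ≠ 0
  | setReal k _ _ => k ≠ 0
  | toss k _ => k ≠ 0
  | seq c d => c.Tame ∧ d.Tame
  | ifNatLE _ _ c d => c.Tame ∧ d.Tame
  | ifRealLE _ _ c d => c.Tame ∧ d.Tame
  | loop a c => a = sizeExp ∧ c.Tame

/-- The cost of a command when all its loops are performed once. -/
def Cmd.baseCost : Cmd → ℕ
  | skip => 1
  | setNat _ i a => i.cost + a.cost + 1
  | setReal _ i a => i.cost + a.cost + 1
  | toss _ i => i.cost + 1
  | seq c d => c.baseCost + d.baseCost
  | ifNatLE a b c d => a.cost + b.cost + 1 + (c.baseCost + d.baseCost)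
  | ifRealLE a b c d => a.cost + b.cost + 1 + (c.baseCost + d.baseCost)
  | loop a c => a.cost + 1 + (c.baseCost + 1)

/-- The nesting depth of the loops. -/
def Cmd.depth : Cmd → ℕ
  | seq c d => max c.depth d.depth
  | ifNatLE _ _ c d => max c.depth d.depth
  | ifRealLE _ _ c d => max c.depth d.depth
  | loop _ c => c.depth + 1
  | _ => 0

@[simp] lemma Store.tick_nat (σ : Store) (m : ℕ) : (σ.tick m).nat = σ.nat := rfl
@[simp] lemma Store.tick_real (σ : Store) (m : ℕ) : (σ.tick m).real = σ.real := rfl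
@[simp] lemma Store.tick_coinsUsed (σ : Store) (m : ℕ) : (σ.tick m).coinsUsed = σ.coinsUsed := rfl
@[simp] lemma Store.tick_steps (σ : Store) (m : ℕ) : (σ.tick m).steps = σ.steps + m := rfl

/-- The cell holding `n` is never overwritten, so every loop bound stays `n` during the run and each
level of nesting costs one factor `n`. The assumption `1 ≤ n` lets shallower commands be padded to
the maximal depth. -/
lemma Cmd.Tame.run_spec (coins : ℕ → unitInterval) {c : Cmd} (hc : c.Tame) (σ : Store)
    (hn : 1 ≤ σ.nat 0 0) :
    (c.run coins σ).nat 0 = σ.nat 0 ∧ (c.run coins σ).real 0 = σ.real 0 ∧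
      (c.run coins σ).steps ≤ σ.steps + c.baseCost * σ.nat 0 0 ^ c.depth := by
  induction c generalizing σ with
  | skip => simp [Cmd.run, Cmd.baseCost, Cmd.depth]
  | setNat k i a =>
    have hk : (0 : ℕ) ≠ k := fun h => hc h.symm
    simp [Cmd.run, Cmd.baseCost, Cmd.depth, Store.writeNat, hk]
  | setReal k i a =>
    have hk : (0 : ℕ) ≠ k := fun h => hc h.symm
    simp [Cmd.run, Cmd.baseCost, Cmd.depth, Store.writeReal, hk]
  | toss k i =>
    have hk : (0 : ℕ) ≠ k := fun h => hc h.symm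
    simp [Cmd.run, Cmd.baseCost, Cmd.depth, Store.writeReal, hk]
  | seq c d ihc ihd =>
    obtain ⟨h1, h2, h3⟩ := ihc hc.1 σ hn
    obtain ⟨h4, h5, h6⟩ := ihd hc.2 (c.run coins σ) (by rwa [h1])
    refine ⟨h4.trans h1, h5.trans h2, h6.trans ?_⟩
    rw [h1]
    simp only [Cmd.baseCost, Cmd.depth, add_mul]
    have e1 := Nat.pow_le_pow_right hn (le_max_left c.depth d.depth)
    have e2 := Nat.pow_le_pow_right hn (le_max_right c.depth d.depth)
    have := Nat.mul_le_mul_left c.baseCost e1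
    have := Nat.mul_le_mul_left d.baseCost e2
    omega
  | ifNatLE a b c d ihc ihd =>
    have e1 := Nat.mul_le_mul_left c.baseCost
      (Nat.pow_le_pow_right hn (le_max_left c.depth d.depth))
    have e2 := Nat.mul_le_mul_left d.baseCost
      (Nat.pow_le_pow_right hn (le_max_right c.depth d.depth))
    have e3 := Nat.le_mul_of_pos_right (a.cost + b.cost + 1)
      (pow_pos hn (max c.depth d.depth))
    simp only [Cmd.run, Cmd.baseCost, Cmd.depth, add_mul _ (_ + _)]
    rw [add_mul c.baseCost]
    split_ifs
    · obtain ⟨h1, h2, h3⟩ := ihc hc.1 (σ.tick (a.cost + b.cost + 1)) hn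
      refine ⟨h1, h2, h3.trans ?_⟩
      simp only [Store.tick_nat, Store.tick_steps]
      omega
    · obtain ⟨h1, h2, h3⟩ := ihd hc.2 (σ.tick (a.cost + b.cost + 1)) hn
      refine ⟨h1, h2, h3.trans ?_⟩
      simp only [Store.tick_nat, Store.tick_steps]
      omega
  | ifRealLE a b c d ihc ihd =>
    have e1 := Nat.mul_le_mul_left c.baseCost
      (Nat.pow_le_pow_right hn (le_max_left c.depth d.depth))
    have e2 := Nat.mul_le_mul_left d.baseCost
      (Nat.pow_le_pow_right hn (le_max_right c.depth d.depth))
    have e3 := Nat.le_mul_of_pos_right (a.cost + b.cost + 1)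
      (pow_pos hn (max c.depth d.depth))
    simp only [Cmd.run, Cmd.baseCost, Cmd.depth, add_mul _ (_ + _)]
    rw [add_mul c.baseCost]
    split_ifs
    · obtain ⟨h1, h2, h3⟩ := ihc hc.1 (σ.tick (a.cost + b.cost + 1)) hn
      refine ⟨h1, h2, h3.trans ?_⟩
      simp only [Store.tick_nat, Store.tick_steps]
      omega
    · obtain ⟨h1, h2, h3⟩ := ihd hc.2 (σ.tick (a.cost + b.cost + 1)) hn
      refine ⟨h1, h2, h3.trans ?_⟩
      simp only [Store.tick_nat, Store.tick_steps]
      omega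
  | loop a c ih =>
    obtain ⟨rfl, hc⟩ := hc
    have key : ∀ m : ℕ, ∀ τ : Store, τ.nat 0 = σ.nat 0 → τ.real 0 = σ.real 0 →
        let τ' := (fun τ => (c.run coins τ).tick 1)^[m] τ
        τ'.nat 0 = σ.nat 0 ∧ τ'.real 0 = σ.real 0 ∧
          τ'.steps ≤ τ.steps + m * (c.baseCost * σ.nat 0 0 ^ c.depth + 1) := by
      intro m
      induction m with
      | zero => intro τ h1 h2; simp [h1, h2]
      | succ m ihm =>
        intro τ h1 h2
        obtain ⟨h3, h4, h5⟩ := ih hc τ (by rwa [h1])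
        have := ihm ((c.run coins τ).tick 1) (h3.trans h1) (h4.trans h2)
        simp only [Function.iterate_succ, Function.comp]
        refine ⟨this.1, this.2.1, this.2.2.trans ?_⟩
        rw [h1] at h5
        simp only [Store.tick_steps, add_mul m 1]
        omega
    obtain ⟨h1, h2, h3⟩ := key (sizeExp.eval σ) (σ.tick (sizeExp.cost + 1)) rfl rfl
    refine ⟨h1, h2, h3.trans ?_⟩
    simp only [NatExp.eval, NatExp.cost, Store.tick_steps, Cmd.baseCost, Cmd.depth]
    have e1 : 0 < σ.nat 0 0 ^ c.depth := Nat.pow_pos hn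
    have e3 : σ.nat 0 0 ^ (c.depth + 1) = σ.nat 0 0 ^ c.depth * σ.nat 0 0 := pow_succ _ _
    rw [e3]
    nlinarith [Nat.mul_le_mul_left (σ.nat 0 0) e1]

lemma Program.exec_spec (P : Program) (hi : P.init.Tame) (hs : P.step.Tame) {n T : ℕ} (hn : 1 ≤ n)
    (S : ℕ) (θ : ℝ) (ℓ : LossTable n T) (coins : ℕ → unitInterval) (t : ℕ) :
    (P.exec S θ ℓ coins t).nat 0 = (inputStore n T S θ).nat 0 ∧
    (P.exec S θ ℓ coins t).real 0 = (inputStore n T S θ).real 0 ∧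
    (P.exec S θ ℓ coins t).steps ≤
      P.init.baseCost * n ^ P.init.depth + t * (n + P.step.baseCost * n ^ P.step.depth) := by
  have h0 : (inputStore n T S θ).nat 0 0 = n := by simp [inputStore]
  induction t with
  | zero =>
    obtain ⟨h1, h2, h3⟩ := hi.run_spec coins (inputStore n T S θ) (by rwa [h0])
    refine ⟨h1, h2, h3.trans ?_⟩
    rw [h0]
    simp [inputStore]
  | succ t ih =>
    obtain ⟨h1, h2, h3⟩ := ih
    have e0 : ((P.exec S θ ℓ coins t).observe ℓ t).nat 0 0 = n := by
      simp only [Store.observe, h1, h0]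
    obtain ⟨h4, h5, h6⟩ := hs.run_spec coins ((P.exec S θ ℓ coins t).observe ℓ t) (by rwa [e0])
    refine ⟨h4.trans h1, h5.trans ?_, h6.trans ?_⟩
    · simpa [Store.observe] using h2
    · rw [e0]
      simp only [Store.observe, add_mul t 1]
      omega

/-- A program with tame commands runs in polynomial time. -/
lemma Program.exists_steps_le (P : Program) (hi : P.init.Tame) (hs : P.step.Tame) :
    ∃ k : ℕ, ∀ n T S : ℕ, 1 ≤ n → ∀ (θ : ℝ) (ℓ : LossTable n T) (coins : ℕ → unitInterval),
      (P.exec S θ ℓ coins T).steps ≤ k * (n + T) ^ k := by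
  -- One number serves as both factor and exponent: it dominates the coefficient `a + 1 + b` and the
  -- exponents `d`, `2` and `e + 1`.
  refine ⟨P.init.baseCost + 1 + P.step.baseCost + P.init.depth + P.step.depth + 2, ?_⟩
  intro n T S hn θ ℓ coins
  refine (P.exec_spec hi hs hn S θ ℓ coins T).2.2.trans ?_
  set a := P.init.baseCost
  set b := P.step.baseCost
  set d := P.init.depth
  set e := P.step.depth
  set k := a + 1 + b + d + e + 2 with hk
  have hN : 0 < n + T := by omega
  have e1 : n ^ d ≤ (n + T) ^ k :=
    (Nat.pow_le_pow_left (by omega) d).trans (Nat.pow_le_pow_right hN (by omega))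
  have e2 : T * n ≤ (n + T) ^ k := by
    calc T * n ≤ (n + T) * (n + T) := Nat.mul_le_mul (by omega) (by omega)
      _ = (n + T) ^ 2 := by ring
      _ ≤ _ := Nat.pow_le_pow_right hN (by omega)
  have e3 : T * n ^ e ≤ (n + T) ^ k := by
    calc T * n ^ e ≤ (n + T) * (n + T) ^ e :=
          Nat.mul_le_mul (by omega) (Nat.pow_le_pow_left (by omega) e)
      _ = (n + T) ^ (e + 1) := by ring
      _ ≤ _ := Nat.pow_le_pow_right hN (by omega)
  calc a * n ^ d + T * (n + b * n ^ e) = a * n ^ d + T * n + b * (T * n ^ e) := by ring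
    _ ≤ a * (n + T) ^ k + (n + T) ^ k + b * (n + T) ^ k := by gcongr
    _ = (a + 1 + b) * (n + T) ^ k := by ring
    _ ≤ k * (n + T) ^ k := Nat.mul_le_mul_right _ (by omega)

end RealRAM

/-! ## Follow the perturbed leader with restarts -/

/-- The first minimizer of `D` on `{0, …, k - 1}`. -/
noncomputable def leader (D : ℕ → ℝ) : ℕ → ℕ
  | 0 => 0
  | k + 1 => open Classical in if D (leader D k) ≤ D k then leader D k else k

lemma leader_le (D : ℕ → ℝ) (k : ℕ) : leader D k ≤ k - 1 := by
  induction k with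
  | zero => simp [leader]
  | succ k ih => rw [leader]; split_ifs <;> omega

lemma leader_lt (D : ℕ → ℝ) {n : ℕ} (hn : 0 < n) : leader D n < n := by
  have := leader_le D n; omega

lemma leader_spec (D : ℕ → ℝ) (k : ℕ) :
    (∀ j < k, D (leader D k) ≤ D j) ∧ ∀ j < leader D k, D (leader D k) < D j := by
  induction k with
  | zero => simp [leader]
  | succ k ih =>
    have := leader_le D k
    rw [leader]
    split_ifs with h
    · refine ⟨fun j hj => ?_, ih.2⟩
      rcases Nat.lt_succ_iff_lt_or_eq.1 hj with h' | rfl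
      · exact ih.1 j h'
      · exact h
    · push Not at h
      refine ⟨fun j hj => ?_, fun j hj => h.trans_le (ih.1 j hj)⟩
      rcases Nat.lt_succ_iff_lt_or_eq.1 hj with h' | rfl
      · exact (h.trans_le (ih.1 j h')).le
      · exact le_rfl

/-- Ties go to the smallest index, hence the strict inequalities below `i`. This form is convenient
for showing that a leader persists when scores move. -/
lemma leader_eq_iff (D : ℕ → ℝ) {n i : ℕ} (hi : i < n) :
    leader D n = i ↔ (∀ j < n, D i ≤ D j) ∧ ∀ j < i, D i < D j := by
  constructor
  · rintro rfl; exact leader_spec D n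
  · rintro ⟨h1, h2⟩
    obtain ⟨h3, h4⟩ := leader_spec D n
    have hl := leader_lt D (show 0 < n by omega)
    rcases lt_trichotomy (leader D n) i with h | h | h
    · exact absurd (h2 _ h) (not_lt.2 (h3 i hi))
    · exact h
    · exact absurd (h4 _ h) (not_lt.2 (h1 _ hl))

lemma leader_congr {D D' : ℕ → ℝ} {n : ℕ} (h : ∀ i < n, D i = D' i) : leader D n = leader D' n := by
  have : ∀ k ≤ n, leader D k = leader D' k := by
    intro k hk
    induction k with
    | zero => rfl
    | succ k ih =>
      have := leader_le D k
      simp only [leader, ← ih (by omega), ← h k (by omega)]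
      rw [h (leader D k) (by omega)]
  exact this n le_rfl

/-- The parameters of the algorithm: the perturbations of an epoch are `scale * log (1 + n * u)`
with `u` uniform; an epoch ends after `horizon / rate` rounds or `threshold` changes of leader. -/
structure FPLParams where
  n : ℕ
  budget : ℕ
  horizon : ℕ
  scale : ℝ
  rate : ℝ
  threshold : ℝ

structure FPLState where
  score : ℕ → ℝ
  elapsed : ℕ
  changes : ℕ
  lead : ℕ
  out : ℕ
  used : ℕ
  coins : ℕ

namespace FPLParams
variable (p : FPLParams)

/-- The perturbed scores at the beginning of an epoch that uses the coins from number `c` on. -/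
noncomputable def perturbation (ω : ℕ → unitInterval) (c i : ℕ) : ℝ :=
  p.scale * Real.log (1 + p.n * ω (c + i))

noncomputable def redraw (ω : ℕ → unitInterval) (s : FPLState) : FPLState :=
  { s with
    score := p.perturbation ω s.coins
    elapsed := 0
    changes := 0
    lead := leader (p.perturbation ω s.coins) p.n
    coins := s.coins + p.n }

noncomputable def advance (x : ℕ → ℝ) (s : FPLState) : FPLState :=
  { s with
    score := fun i => s.score i + x i
    elapsed := s.elapsed + 1
    changes := s.changes + if leader (fun i => s.score i + x i) p.n = s.lead then 0 else 1
    lead := leader (fun i => s.score i + x i) p.n }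

/-- The condition that ends an epoch. -/
def Expired (elapsed changes : ℕ) : Prop :=
  (p.horizon : ℝ) ≤ elapsed * p.rate ∨ p.threshold ≤ changes

open Classical in
noncomputable def restart (ω : ℕ → unitInterval) (s : FPLState) : FPLState :=
  if p.Expired s.elapsed s.changes then p.redraw ω s else s

def commit (s : FPLState) : FPLState :=
  if s.lead ≠ s.out ∧ s.used + 1 ≤ p.budget then { s with out := s.lead, used := s.used + 1 } else s

noncomputable def step (ω : ℕ → unitInterval) (x : ℕ → ℝ) (s : FPLState) : FPLState :=
  p.commit (p.restart ω (p.advance x s))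

noncomputable def initial (ω : ℕ → unitInterval) : FPLState :=
  let s := p.redraw ω ⟨0, 0, 0, 0, 0, 0, 0⟩
  { s with out := s.lead }

/-- The state before iteration `t` when the losses are `x`. -/
noncomputable def state (ω : ℕ → unitInterval) (x : ℕ → ℕ → ℝ) : ℕ → FPLState
  | 0 => p.initial ω
  | t + 1 => p.step ω (x t) (state ω x t)

lemma state_congr (ω : ℕ → unitInterval) {x y : ℕ → ℕ → ℝ} {t : ℕ} (h : ∀ r < t, x r = y r) :
    p.state ω x t = p.state ω y t := by
  induction t with
  | zero => rfl
  | succ t ih => rw [state, state, ih fun r hr => h r (by omega), h t (by omega)]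

end FPLParams

namespace RealRAM

/-! ## The program -/

/-- Perform a command for all actions; the current action is in cell 0 of array 3 of naturals. -/
def forActions (c : Cmd) : Cmd :=
  .seq (.setNat 3 (.lit 0) (.lit 0))
    (.loop sizeExp (.seq c (.setNat 3 (.lit 0) (.add (.cell 3 (.lit 0)) (.lit 1)))))

/-- The proof rule for loops over the actions. Besides the body, the loop only writes its index cell
and advances the clock, so the invariant has to be insensitive to these (`hinv`). -/
lemma forActions_run (coins : ℕ → unitInterval) {c : Cmd} {n : ℕ} (I : ℕ → Store → Prop)
    (hinv : ∀ i τ v m m', I i τ → I i (((τ.writeNat 3 0 v).tick m).tick m'))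
    (σ : Store) (hσ : σ.nat 0 0 = n) (hstart : I 0 σ)
    (hstep : ∀ i < n, ∀ τ : Store, I i τ → τ.nat 3 0 = i →
      I (i + 1) (c.run coins τ) ∧ (c.run coins τ).nat 3 0 = i) :
    I n ((forActions c).run coins σ) := by
  have key : ∀ m ≤ n, ∀ τ : Store, I 0 τ → τ.nat 3 0 = 0 →
      let τ' := (fun τ => ((Cmd.seq c (.setNat 3 (.lit 0)
        (.add (.cell 3 (.lit 0)) (.lit 1)))).run coins τ).tick 1)^[m] τ
      I m τ' ∧ τ'.nat 3 0 = m := by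
    intro m hm τ h1 h2
    induction m with
    | zero => exact ⟨h1, h2⟩
    | succ m ih =>
      obtain ⟨h3, h4⟩ := ih (by omega)
      simp only [Function.iterate_succ', Function.comp]
      generalize (fun τ => ((Cmd.seq c (.setNat 3 (.lit 0)
        (.add (.cell 3 (.lit 0)) (.lit 1)))).run coins τ).tick 1)^[m] τ = ρ at h3 h4 ⊢
      obtain ⟨h5, h6⟩ := hstep m (by omega) ρ h3 h4
      refine ⟨hinv (m + 1) _ _ _ _ h5, ?_⟩
      simp [Cmd.run, NatExp.eval, Store.writeNat, h6]
  have e : sizeExp.eval ((σ.writeNat 3 0 0).tick 3) = n := by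
    simp [NatExp.eval, Store.writeNat, hσ]
  have := (key n le_rfl (((σ.writeNat 3 0 0).tick 3).tick (sizeExp.cost + 1))
    (hinv 0 _ _ _ _ hstart) (by simp [Store.writeNat])).1
  simpa only [forActions, Cmd.run, NatExp.eval, NatExp.cost, Store.tick_nat, hσ, Store.writeNat,
    Function.update_of_ne (show (0 : ℕ) ≠ 3 by norm_num)] using this

abbrev scoreExp (i : NatExp) : RealExp := .cell 2 i
abbrev actionExp : NatExp := .cell 3 (.lit 0)
abbrev elapsedExp : NatExp := .cell 2 (.lit 0)
abbrev changesExp : NatExp := .cell 2 (.lit 1)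
abbrev leadExp : NatExp := .cell 2 (.lit 2)
abbrev usedExp : NatExp := .cell 2 (.lit 3)
abbrev bestExp : NatExp := .cell 2 (.lit 4)
abbrev outExp : NatExp := .cell 1 (.lit 0)

/-- Compute the leader. -/
def leaderCmd : Cmd :=
  .seq (.setNat 2 (.lit 4) (.lit 0))
    (forActions (.ifRealLE (scoreExp bestExp) (scoreExp actionExp) .skip
      (.setNat 2 (.lit 4) actionExp)))

def perturbCmd (scale : RealExp) : Cmd :=
  forActions (.seq (.toss 2 actionExp) (.setReal 2 actionExp
    (.mul scale (.log (.add (.lit 1) (.mul (.ofNat sizeExp) (scoreExp actionExp)))))))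

def redrawCmd (scale : RealExp) : Cmd :=
  .seq (perturbCmd scale) (.seq (.setNat 2 (.lit 0) (.lit 0)) (.seq (.setNat 2 (.lit 1) (.lit 0))
    (.seq leaderCmd (.setNat 2 (.lit 2) bestExp))))

def addLossesCmd : Cmd :=
  forActions (.setReal 2 actionExp (.add (scoreExp actionExp) (.cell 1 actionExp)))

/-- Record the leader, and whether it has changed. -/
def recordCmd : Cmd :=
  let change : Cmd := .setNat 2 (.lit 1) (.add changesExp (.lit 1))
  .seq (.ifNatLE bestExp leadExp (.ifNatLE leadExp bestExp .skip change) change)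
    (.setNat 2 (.lit 2) bestExp)

def advanceCmd : Cmd :=
  .seq addLossesCmd (.seq (.setNat 2 (.lit 0) (.add elapsedExp (.lit 1)))
    (.seq leaderCmd recordCmd))

def restartCmd (scale rate threshold : RealExp) : Cmd :=
  .ifRealLE (.ofNat (.cell 0 (.lit 1))) (.mul (.ofNat elapsedExp) rate) (redrawCmd scale)
    (.ifRealLE threshold (.ofNat changesExp) (redrawCmd scale) .skip)

def commitCmd : Cmd :=
  let move : Cmd := .ifNatLE (.add usedExp (.lit 1)) (.cell 0 (.lit 2))
    (.seq (.setNat 1 (.lit 0) leadExp) (.setNat 2 (.lit 3) (.add usedExp (.lit 1)))) .skip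
  .ifNatLE leadExp outExp (.ifNatLE outExp leadExp .skip move) move

/-- Follow the perturbed leader with restarts. -/
def fplProgram (scale rate threshold : RealExp) : Program where
  init := .seq (redrawCmd scale) (.setNat 1 (.lit 0) leadExp)
  step := .seq advanceCmd (.seq (restartCmd scale rate threshold) commitCmd)

lemma fplProgram_tame (scale rate threshold : RealExp) :
    (fplProgram scale rate threshold).init.Tame ∧ (fplProgram scale rate threshold).step.Tame := by
  simp [fplProgram, Cmd.Tame, redrawCmd, perturbCmd, leaderCmd, forActions, advanceCmd,
    addLossesCmd, recordCmd, restartCmd, commitCmd]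

/-- The expression is a function of the inputs only, with the value `v` on the inputs `(a, b)`. -/
def RealExp.ConstOn (e : RealExp) (a : ℕ → ℕ) (b : ℕ → ℝ) (v : ℝ) : Prop :=
  ∀ σ : Store, σ.nat 0 = a → σ.real 0 = b → e.eval σ = v

/-- The store `σ` represents the state `s`, up to the index cells. -/
structure Represents (n : ℕ) (a : ℕ → ℕ) (b : ℕ → ℝ) (σ : Store) (s : FPLState) : Prop where
  input_nat : σ.nat 0 = a
  input_real : σ.real 0 = b
  score : ∀ i < n, σ.real 2 i = s.score i
  elapsed : σ.nat 2 0 = s.elapsed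
  changes : σ.nat 2 1 = s.changes
  lead : σ.nat 2 2 = s.lead
  used : σ.nat 2 3 = s.used
  out : σ.nat 1 0 = s.out
  coins : σ.coinsUsed = s.coins

lemma leaderCmd_run (coins : ℕ → unitInterval) {n : ℕ} {a : ℕ → ℕ} (ha : a 0 = n) {b : ℕ → ℝ}
    {σ : Store} {s : FPLState} (h : Represents n a b σ s) :
    Represents n a b (leaderCmd.run coins σ) s ∧
      (leaderCmd.run coins σ).nat 2 4 = leader s.score n := by
  refine forActions_run coins
    (fun i τ => Represents n a b τ s ∧ τ.nat 2 4 = leader s.score i) ?_ _ ?_ ?_ ?_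
  · rintro i τ v m m' ⟨⟨h1, h2, h3, h4, h5, h6, h7, h8, h9⟩, h10⟩
    refine ⟨⟨?_, h2, h3, ?_, ?_, ?_, ?_, ?_, h9⟩, ?_⟩ <;> simpa [Store.writeNat]
  · simp [Cmd.run, Store.writeNat, h.input_nat, ha]
  · obtain ⟨h1, h2, h3, h4, h5, h6, h7, h8, h9⟩ := h
    refine ⟨⟨?_, h2, h3, ?_, ?_, ?_, ?_, ?_, h9⟩, ?_⟩ <;>
      simp_all [Cmd.run, Store.writeNat, NatExp.eval, leader]
  · rintro i hi τ ⟨h, h10⟩ h11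
    have hl := leader_le s.score i
    have e1 : τ.real 2 i = s.score i := h.score i hi
    have e2 : τ.real 2 (leader s.score i) = s.score (leader s.score i) := h.score _ (by omega)
    obtain ⟨h1, h2, h3, h4, h5, h6, h7, h8, h9⟩ := h
    simp only [Cmd.run, RealExp.eval, NatExp.eval, h10, h11, e1, e2, leader]
    split_ifs with hc
    · exact ⟨⟨⟨h1, h2, h3, h4, h5, h6, h7, h8, h9⟩, h10⟩, h11⟩
    · refine ⟨⟨⟨?_, h2, h3, ?_, ?_, ?_, ?_, ?_, h9⟩, ?_⟩, ?_⟩ <;>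
        simpa [Store.writeNat]

lemma addLossesCmd_run (coins : ℕ → unitInterval) {n : ℕ} {a : ℕ → ℕ} (ha : a 0 = n) {b : ℕ → ℝ}
    {σ : Store} {s : FPLState} {x : ℕ → ℝ} (h : Represents n a b σ s)
    (hx : ∀ i < n, σ.real 1 i = x i) :
    Represents n a b (addLossesCmd.run coins σ) { s with score := fun i => s.score i + x i } := by
  have := forActions_run coins (c := .setReal 2 actionExp (.add (scoreExp actionExp) (.cell 1 actionExp)))
    (n := n)
    (fun i τ => Represents n a b τ
      { s with score := fun j => if j < i then s.score j + x j else s.score j } ∧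
      ∀ i < n, τ.real 1 i = x i) ?_ σ (by rw [h.input_nat, ha]) ?_ ?_
  · obtain ⟨⟨h1, h2, h3, h4, h5, h6, h7, h8, h9⟩, -⟩ := this
    refine ⟨h1, h2, fun i hi => ?_, h4, h5, h6, h7, h8, h9⟩
    exact (h3 i hi).trans (by simp [hi])
  · rintro i τ v m m' ⟨⟨h1, h2, h3, h4, h5, h6, h7, h8, h9⟩, h10⟩
    refine ⟨⟨?_, h2, h3, ?_, ?_, ?_, ?_, ?_, h9⟩, h10⟩ <;> simpa [Store.writeNat]
  · exact ⟨by simpa using h, hx⟩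
  · rintro i hi τ ⟨⟨h1, h2, h3, h4, h5, h6, h7, h8, h9⟩, h10⟩ h11
    refine ⟨⟨⟨h1, ?_, fun j hj => ?_, h4, h5, h6, h7, h8, h9⟩, ?_⟩, h11⟩
    · simpa [Cmd.run, Store.writeReal]
    · have := h3 j hj
      rcases lt_trichotomy j i with hji | rfl | hji
      · simp_all [Cmd.run, Store.writeReal, NatExp.eval, hji.ne, hji.trans (Nat.lt_succ_self i)]
      · simp_all [Cmd.run, Store.writeReal, NatExp.eval, RealExp.eval]
      · simp_all [Cmd.run, Store.writeReal, NatExp.eval, hji.ne', hji.not_gt,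
          show ¬ j < i + 1 by omega]
    · simpa [Cmd.run, Store.writeReal]

lemma perturbCmd_run (coins : ℕ → unitInterval) (p : FPLParams) {a : ℕ → ℕ} (ha : a 0 = p.n)
    {b : ℕ → ℝ} {scale : RealExp} (hscale : scale.ConstOn a b p.scale)
    {σ : Store} {s : FPLState} (h : Represents p.n a b σ s) :
    Represents p.n a b ((perturbCmd scale).run coins σ)
      { s with score := p.perturbation coins s.coins, coins := s.coins + p.n } := by
  have := forActions_run coins (c := .seq (.toss 2 actionExp) (.setReal 2 actionExp
    (.mul scale (.log (.add (.lit 1) (.mul (.ofNat sizeExp) (scoreExp actionExp))))))) (n := p.n)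
    (fun i τ => Represents p.n a b τ
      { s with
        score := fun j => if j < i then p.perturbation coins s.coins j else s.score j
        coins := s.coins + i }) ?_ σ (by rw [h.input_nat, ha]) ?_ ?_
  · obtain ⟨h1, h2, h3, h4, h5, h6, h7, h8, h9⟩ := this
    refine ⟨h1, h2, fun i hi => ?_, h4, h5, h6, h7, h8, h9⟩
    exact (h3 i hi).trans (by simp [hi])
  · rintro i τ v m m' ⟨h1, h2, h3, h4, h5, h6, h7, h8, h9⟩
    refine ⟨?_, h2, h3, ?_, ?_, ?_, ?_, ?_, h9⟩ <;> simpa [Store.writeNat]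
  · simpa using h
  · rintro i hi τ ⟨h1, h2, h3, h4, h5, h6, h7, h8, h9⟩ h11
    have hs : ∀ ρ : Store, ρ.nat 0 = a → ρ.real 0 = b → scale.eval ρ = p.scale := hscale
    refine ⟨⟨h1, ?_, fun j hj => ?_, h4, h5, h6, h7, h8, ?_⟩, h11⟩
    · simpa [Cmd.run, Store.writeReal]
    · have := h3 j hj
      rcases lt_trichotomy j i with hji | rfl | hji
      · simp_all [Cmd.run, Store.writeReal, NatExp.eval, hji.ne, hji.trans (Nat.lt_succ_self i)]
      · simp only [Cmd.run, RealExp.eval]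
        rw [hs _ (by simpa [Store.writeReal]) (by simpa [Store.writeReal])]
        simp_all [Store.writeReal, NatExp.eval, FPLParams.perturbation]
      · simp_all [Cmd.run, Store.writeReal, NatExp.eval, hji.ne', hji.not_gt,
          show ¬ j < i + 1 by omega]
    · simp [Cmd.run, Store.writeReal, h9, add_assoc]

/-- What a command may change besides the cells that represent the state. -/
lemma Represents.setBest {n : ℕ} {a : ℕ → ℕ} {b : ℕ → ℝ} {σ : Store} {s : FPLState}
    (h : Represents n a b σ s) (k v : ℕ) (hk : k = 0 ∨ k = 1 ∨ k = 2) (m : ℕ) :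
    Represents n a b ((σ.writeNat 2 k v).tick m)
      { s with
        elapsed := if k = 0 then v else s.elapsed
        changes := if k = 1 then v else s.changes
        lead := if k = 2 then v else s.lead } := by
  obtain ⟨h1, h2, h3, h4, h5, h6, h7, h8, h9⟩ := h
  rcases hk with rfl | rfl | rfl <;>
  refine ⟨?_, h2, h3, ?_, ?_, ?_, ?_, ?_, h9⟩ <;> simp_all [Store.writeNat]

lemma redrawCmd_run (coins : ℕ → unitInterval) (p : FPLParams) {a : ℕ → ℕ} (ha : a 0 = p.n)
    {b : ℕ → ℝ} {scale : RealExp} (hscale : scale.ConstOn a b p.scale)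
    {σ : Store} {s : FPLState} (h : Represents p.n a b σ s) :
    Represents p.n a b ((redrawCmd scale).run coins σ) (p.redraw coins s) := by
  have h1 := perturbCmd_run coins p ha hscale h
  have h2 := (h1.setBest 0 0 (by simp) 3).setBest 1 0 (by simp) 3
  obtain ⟨h3, h4⟩ := leaderCmd_run coins ha h2
  have h5 := h3.setBest 2 (leader (p.perturbation coins s.coins) p.n) (by simp) 4
  simpa [redrawCmd, Cmd.run, NatExp.eval, NatExp.cost, h4, FPLParams.redraw] using h5

lemma advanceCmd_run (coins : ℕ → unitInterval) (p : FPLParams) {a : ℕ → ℕ} (ha : a 0 = p.n)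
    {b : ℕ → ℝ} {σ : Store} {s : FPLState} {x : ℕ → ℝ} (h : Represents p.n a b σ s)
    (hx : ∀ i < p.n, σ.real 1 i = x i) :
    Represents p.n a b (advanceCmd.run coins σ) (p.advance x s) := by
  have h1 := addLossesCmd_run coins ha h hx
  have h2 := h1.setBest 0 ((addLossesCmd.run coins σ).nat 2 0 + 1) (by simp)
    (1 + (1 + 1 + 1 + 1) + 1)
  obtain ⟨h3, h4⟩ := leaderCmd_run coins ha h2
  simp only [h1.elapsed, if_true, if_neg (show (0 : ℕ) ≠ 1 by norm_num),
    if_neg (show (0 : ℕ) ≠ 2 by norm_num)] at h3 h4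
  have key : ∀ ρ : Store, Represents p.n a b ρ
      { s with score := fun i => s.score i + x i, elapsed := s.elapsed + 1 } →
      ρ.nat 2 4 = leader (fun i => s.score i + x i) p.n →
      Represents p.n a b (recordCmd.run coins ρ) (p.advance x s) := by
    rintro ρ ⟨h1, h2, h3, h5, h6, h7, h8, h9, h10⟩ h4
    have e : leader (fun i => s.score i + x i) p.n = s.lead ↔
      leader (fun i => s.score i + x i) p.n ≤ s.lead ∧
        s.lead ≤ leader (fun i => s.score i + x i) p.n := by omega
    dsimp only at h3 h5 h6 h7 h8 h9 h10
    simp only [FPLParams.advance, recordCmd, Cmd.run, NatExp.eval, h4, h7, h6, Store.tick_nat, e]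
    split_ifs with c1 c2 c3 <;> first | tauto | skip
    all_goals refine ⟨?_, h2, h3, ?_, ?_, ?_, ?_, ?_, h10⟩ <;> simp_all [Store.writeNat]
  have e : advanceCmd.run coins σ = recordCmd.run coins (leaderCmd.run coins
    (((addLossesCmd.run coins σ).writeNat 2 0 ((addLossesCmd.run coins σ).nat 2 0 + 1)).tick
      (1 + (1 + 1 + 1 + 1) + 1))) := by
    simp only [advanceCmd, Cmd.run, NatExp.eval, NatExp.cost]
  rw [e, h1.elapsed]
  exact key _ h3 h4

lemma restartCmd_run (coins : ℕ → unitInterval) (p : FPLParams) {a : ℕ → ℕ} (ha : a 0 = p.n)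
    (ha' : a 1 = p.horizon)
    {b : ℕ → ℝ} {scale rate threshold : RealExp} (hscale : scale.ConstOn a b p.scale)
    (hrate : rate.ConstOn a b p.rate) (hthr : threshold.ConstOn a b p.threshold)
    {σ : Store} {s : FPLState} (h : Represents p.n a b σ s) :
    Represents p.n a b ((restartCmd scale rate threshold).run coins σ) (p.restart coins s) := by
  have tick : ∀ {σ : Store} {s : FPLState} (m : ℕ), Represents p.n a b σ s →
      Represents p.n a b (σ.tick m) s :=
    fun m ⟨h1, h2, h3, h4, h5, h6, h7, h8, h9⟩ => ⟨h1, h2, h3, h4, h5, h6, h7, h8, h9⟩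
  have e1 : rate.eval σ = p.rate := hrate σ h.input_nat h.input_real
  have e2 : ∀ m, threshold.eval (σ.tick m) = p.threshold :=
    fun m => hthr _ h.input_nat h.input_real
  simp only [restartCmd, Cmd.run, RealExp.eval, NatExp.eval, e1, e2, Store.tick_nat, h.elapsed,
    h.changes, h.input_nat, ha']
  rw [FPLParams.restart, FPLParams.Expired]
  split_ifs with c1 c2 c3 c3 c4
  · exact redrawCmd_run coins p ha hscale (tick _ h)
  · tauto
  · exact redrawCmd_run coins p ha hscale (tick _ (tick _ h))
  · tauto
  · tauto
  · exact tick _ (tick _ (tick _ h))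

lemma commitCmd_run (coins : ℕ → unitInterval) (p : FPLParams) {a : ℕ → ℕ}
    (ha : a 2 = p.budget) {b : ℕ → ℝ} {σ : Store} {s : FPLState} (h : Represents p.n a b σ s) :
    Represents p.n a b (commitCmd.run coins σ) (p.commit s) := by
  have h' := h
  obtain ⟨h1, h2, h3, h4, h5, h6, h7, h8, h9⟩ := h'
  have e : (s.lead ≠ s.out) ↔ ¬ (s.lead ≤ s.out ∧ s.out ≤ s.lead) := by omega
  simp only [commitCmd, Cmd.run, NatExp.eval, Store.tick_nat, h6, h7, h8, h1, ha, FPLParams.commit,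
    e]
  split_ifs with c1 c2 c3 c3 c4 c4 <;> first | tauto | skip
  all_goals refine ⟨?_, h2, h3, ?_, ?_, ?_, ?_, ?_, h9⟩ <;> simp_all [Store.writeNat]

/-- The losses of a table as real numbers, extended by zero. -/
def lossFun {n m : ℕ} (ℓ : Fin m → Fin n → unitInterval) (t i : ℕ) : ℝ :=
  if h : t < m ∧ i < n then (ℓ ⟨t, h.1⟩ ⟨i, h.2⟩ : ℝ) else 0

/-- The simulation: each command realizes the corresponding operation on `FPLState`. The parameter
expressions may be re-evaluated at any time because they only read input cells, which the simulation
keeps fixed. -/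
lemma fplProgram_exec (p : FPLParams) {S : ℕ} (hS : p.budget = S) {θ : ℝ}
    {scale rate threshold : RealExp}
    (hscale : scale.ConstOn ((inputStore p.n p.horizon S θ).nat 0)
      ((inputStore p.n p.horizon S θ).real 0) p.scale)
    (hrate : rate.ConstOn ((inputStore p.n p.horizon S θ).nat 0)
      ((inputStore p.n p.horizon S θ).real 0) p.rate)
    (hthr : threshold.ConstOn ((inputStore p.n p.horizon S θ).nat 0)
      ((inputStore p.n p.horizon S θ).real 0) p.threshold)
    (ℓ : LossTable p.n p.horizon) (coins : ℕ → unitInterval) (t : ℕ) (ht : t ≤ p.horizon) :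
    Represents p.n ((inputStore p.n p.horizon S θ).nat 0) ((inputStore p.n p.horizon S θ).real 0)
      ((fplProgram scale rate threshold).exec S θ ℓ coins t) (p.state coins (lossFun ℓ) t) := by
  have h0 : (inputStore p.n p.horizon S θ).nat 0 0 = p.n := by simp [inputStore]
  have h1 : (inputStore p.n p.horizon S θ).nat 0 1 = p.horizon := by simp [inputStore]
  have h2 : (inputStore p.n p.horizon S θ).nat 0 2 = p.budget := by simp [inputStore, hS]
  induction t with
  | zero =>
    have h : Represents p.n ((inputStore p.n p.horizon S θ).nat 0)
        ((inputStore p.n p.horizon S θ).real 0) (inputStore p.n p.horizon S θ)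
        ⟨0, 0, 0, 0, 0, 0, 0⟩ := by
      refine ⟨rfl, rfl, ?_, ?_, ?_, ?_, ?_, ?_, ?_⟩ <;> simp [inputStore]
    obtain ⟨h1, h2, h3, h4, h5, h6, h7, h8, h9⟩ := redrawCmd_run coins p h0 hscale h
    rw [FPLParams.state, FPLParams.initial, Program.exec, fplProgram, Cmd.run]
    refine ⟨?_, h2, h3, ?_, ?_, ?_, ?_, ?_, h9⟩ <;>
      simp_all [Cmd.run, Store.writeNat, NatExp.eval]
  | succ t ih =>
    obtain ⟨g1, g2, g3, g4, g5, g6, g7, g8, g9⟩ := ih (by omega)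
    have g : Represents p.n ((inputStore p.n p.horizon S θ).nat 0)
        ((inputStore p.n p.horizon S θ).real 0)
        (((fplProgram scale rate threshold).exec S θ ℓ coins t).observe ℓ t)
        (p.state coins (lossFun ℓ) t) := by
      refine ⟨g1, ?_, ?_, g4, g5, g6, g7, g8, g9⟩
      · simpa [Store.observe]
      · simpa [Store.observe]
    have hx : ∀ i < p.n, (((fplProgram scale rate threshold).exec S θ ℓ coins t).observe ℓ t).real
        1 i = lossFun ℓ t i := by
      intro i hi
      have : t < p.horizon ∧ i < p.n := ⟨ht, hi⟩
      simp [Store.observe, lossFun, this]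
    exact commitCmd_run coins p h2 (restartCmd_run coins p h0 h1 hscale hrate hthr
      (advanceCmd_run coins p h0 g hx))

end RealRAM

/-! ## Deterministic analysis of the restarted perturbed leader -/

/-- The number of `r < t` with `f (r + 1) ≠ f r`. -/
def changeCount (f : ℕ → ℕ) (t : ℕ) : ℕ := ∑ r ∈ Finset.range t, if f (r + 1) = f r then 0 else 1

lemma changeCount_succ (f : ℕ → ℕ) (t : ℕ) :
    changeCount f (t + 1) = changeCount f t + if f (t + 1) = f t then 0 else 1 :=
  Finset.sum_range_succ _ _

lemma changeCount_mono (f : ℕ → ℕ) : Monotone (changeCount f) :=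
  monotone_nat_of_le_succ fun t => by rw [changeCount_succ]; omega

namespace FPLParams
variable (p : FPLParams) (ω : ℕ → unitInterval) (x : ℕ → ℕ → ℝ)

lemma restart_used (s : FPLState) : (p.restart ω s).used = s.used := by
  rw [restart]; split_ifs <;> rfl

lemma restart_out (s : FPLState) : (p.restart ω s).out = s.out := by
  rw [restart]; split_ifs <;> rfl

/-- `commit` moves the output only together with the counter and only below the cap, so the budget
is respected surely and not just with high probability. -/
lemma changeCount_out (t : ℕ) :
    changeCount (fun t => (p.state ω x t).out) t = (p.state ω x t).used ∧
      (p.state ω x t).used ≤ p.budget := by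
  induction t with
  | zero => simp [changeCount, state, initial, redraw]
  | succ t ih =>
    rw [changeCount_succ, ih.1]
    simp only [state, step, commit]
    split_ifs with h1 h2 h2
    · simp only [restart_out, restart_used] at h1 h2
      exact absurd h2 h1.1
    · simp only [restart_out, restart_used] at h1 ⊢
      exact ⟨rfl, h1.2⟩
    · simp only [restart_out, restart_used] at h1 ⊢
      exact ⟨rfl, ih.2⟩
    · exact absurd (p.restart_out ω _) h2

lemma state_lead_succ (t : ℕ) : (p.state ω x (t + 1)).lead =
    (p.restart ω (p.advance (x t) (p.state ω x t))).lead := by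
  simp only [state, step, commit]; split_ifs <;> rfl

/-- As long as the budget is not exhausted, the action played is the perturbed leader. -/
lemma out_eq_lead {t : ℕ}
    (h : changeCount (fun t => (p.state ω x t).lead) t ≤ p.budget) :
    (p.state ω x t).out = (p.state ω x t).lead ∧
      (p.state ω x t).used = changeCount (fun t => (p.state ω x t).lead) t := by
  induction t with
  | zero => simp [changeCount, state, initial, redraw]
  | succ t ih =>
    obtain ⟨h1, h2⟩ := ih ((changeCount_mono _ (Nat.le_succ t)).trans h)
    rw [changeCount_succ, state_lead_succ] at h ⊢
    rw [← h2] at h ⊢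
    simp only [state, step, commit, restart_used, restart_out]
    have e1 : (p.advance (x t) (p.state ω x t)).out = (p.state ω x t).lead := h1
    have e2 : (p.advance (x t) (p.state ω x t)).used = (p.state ω x t).used := rfl
    rw [e1, e2]
    by_cases c : (p.restart ω (p.advance (x t) (p.state ω x t))).lead = (p.state ω x t).lead
    · simp [c, restart_used, restart_out, e1, e2]
    · rw [if_neg c] at h
      simp [c, h]

/-- The perturbed scores at time `t` in an epoch that starts at time `s` with the coins from
number `c` on. -/
noncomputable def epochScore (s c t i : ℕ) : ℝ :=
  p.perturbation ω c i + ∑ r ∈ Finset.Ico s t, x r i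

noncomputable def epochLead (s c t : ℕ) : ℕ := leader (p.epochScore ω x s c t) p.n

noncomputable def epochChanges (s c t : ℕ) : ℕ :=
  ∑ r ∈ Finset.Ico s t, if p.epochLead ω x s c (r + 1) = p.epochLead ω x s c r then 0 else 1

/-- The time at which the epoch ends. -/
noncomputable def epochEnd (s c : ℕ) : ℕ :=
  sInf {t | s < t ∧ p.Expired (t - s) (p.epochChanges ω x s c t)}

/-- The starting time of the `j`-th epoch. -/
noncomputable def epochStart : ℕ → ℕ
  | 0 => 0
  | j + 1 => p.epochEnd ω x (epochStart j) (j * p.n)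

variable {p}

/-- A positive rate makes every epoch finite, so the infimum defining `epochEnd` is attained and not
the default value 0. -/
lemma exists_expired (hr : 0 < p.rate) (s : ℕ) (f : ℕ → ℕ) :
    ∃ t, s < t ∧ p.Expired (t - s) (f t) := by
  obtain ⟨m, hm⟩ := exists_nat_ge ((p.horizon : ℝ) / p.rate)
  refine ⟨s + (m + 1), by omega, Or.inl ?_⟩
  rw [div_le_iff₀ hr] at hm
  rw [Nat.add_sub_cancel_left]
  push_cast
  linarith

lemma epochEnd_spec (hr : 0 < p.rate) (s c : ℕ) :
    s < p.epochEnd ω x s c ∧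
      p.Expired (p.epochEnd ω x s c - s) (p.epochChanges ω x s c (p.epochEnd ω x s c)) :=
  Nat.sInf_mem (s := {t | s < t ∧ p.Expired (t - s) (p.epochChanges ω x s c t)})
    (exists_expired hr s _)

lemma not_expired_of_lt_epochEnd {s c t : ℕ} (hs : s < t) (ht : t < p.epochEnd ω x s c) :
    ¬ p.Expired (t - s) (p.epochChanges ω x s c t) := fun h => Nat.notMem_of_lt_sInf ht ⟨hs, h⟩

lemma epochEnd_eq {s c t : ℕ} (hs : s < t) (h : p.Expired (t - s) (p.epochChanges ω x s c t))
    (hlt : ∀ r, s < r → r < t → ¬ p.Expired (r - s) (p.epochChanges ω x s c r)) :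
    p.epochEnd ω x s c = t := by
  have hmem : t ∈ {t | s < t ∧ p.Expired (t - s) (p.epochChanges ω x s c t)} := ⟨hs, h⟩
  refine le_antisymm (Nat.sInf_le hmem) (not_lt.1 fun hc => ?_)
  obtain ⟨h1, h2⟩ := Nat.sInf_mem ⟨t, hmem⟩
  exact hlt _ h1 hc h2

lemma epochStart_lt_succ (hr : 0 < p.rate) (j : ℕ) :
    p.epochStart ω x j < p.epochStart ω x (j + 1) := (epochEnd_spec ω x hr _ _).1

lemma epochStart_strictMono (hr : 0 < p.rate) : StrictMono (p.epochStart ω x) :=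
  strictMono_nat_of_lt_succ (epochStart_lt_succ ω x hr)

/-- The state of the algorithm at time `t` in terms of the current epoch, which is the `j`-th. -/
structure InEpoch (p : FPLParams) (ω : ℕ → unitInterval) (x : ℕ → ℕ → ℝ) (t j : ℕ)
    (s : FPLState) : Prop where
  start_le : p.epochStart ω x j ≤ t
  not_expired : ∀ r, p.epochStart ω x j < r → r ≤ t →
    ¬ p.Expired (r - p.epochStart ω x j) (p.epochChanges ω x (p.epochStart ω x j) (j * p.n) r)
  score : s.score = p.epochScore ω x (p.epochStart ω x j) (j * p.n) t
  elapsed : s.elapsed = t - p.epochStart ω x j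
  changes : s.changes = p.epochChanges ω x (p.epochStart ω x j) (j * p.n) t
  lead : s.lead = leader s.score p.n
  coins : s.coins = (j + 1) * p.n

lemma inEpoch_redraw {t j : ℕ} (s : FPLState) (ht : p.epochStart ω x j = t)
    (hc : s.coins = j * p.n) : InEpoch p ω x t j (p.redraw ω s) := by
  refine ⟨ht.le, fun r h1 h2 => by omega, ?_, ?_, ?_, rfl, ?_⟩
  · funext i; simp [redraw, epochScore, ht, hc]
  · simp [redraw, ht]
  · simp [redraw, ht, epochChanges]
  · simp [redraw, hc]; ring

lemma inEpoch_advance {t j : ℕ} {s : FPLState} (h : InEpoch p ω x t j s) :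
    (p.advance (x t) s).score = p.epochScore ω x (p.epochStart ω x j) (j * p.n) (t + 1) ∧
    (p.advance (x t) s).elapsed = t + 1 - p.epochStart ω x j ∧
    (p.advance (x t) s).changes =
      p.epochChanges ω x (p.epochStart ω x j) (j * p.n) (t + 1) := by
  have hs : (p.advance (x t) s).score =
      p.epochScore ω x (p.epochStart ω x j) (j * p.n) (t + 1) := by
    funext i
    simp only [advance, h.score, epochScore, Finset.sum_Ico_succ_top h.start_le]
    ring
  refine ⟨hs, ?_, ?_⟩
  · have := h.start_le
    simp only [advance, h.elapsed]; omega
  · have hc : (p.advance (x t) s).changes =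
      s.changes + if leader (p.advance (x t) s).score p.n = s.lead then 0 else 1 := rfl
    rw [hc, hs, h.lead, h.score, h.changes, epochChanges, epochChanges,
      Finset.sum_Ico_succ_top h.start_le]
    rfl

/-- Adding the losses `x` to the scores, when the leader suffers its loss. -/
lemma score_leader_add_le {n : ℕ} (hn : 0 < n) (D y : ℕ → ℝ) (hy : ∀ i < n, 0 ≤ y i ∧ y i ≤ 1) :
    y (leader D n) + D (leader D n) ≤ D (leader (fun i => D i + y i) n) +
      y (leader (fun i => D i + y i) n) +
      ((if leader (fun i => D i + y i) n = leader D n then 0 else 1 : ℕ) : ℝ) := by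
  split_ifs with h
  · rw [h]; push_cast; linarith
  · have h1 := (leader_spec D n).1 _ (leader_lt (fun i => D i + y i) hn)
    have h2 := (hy _ (leader_lt D hn)).2
    have h3 := (hy _ (leader_lt (fun i => D i + y i) hn)).1
    push_cast; linarith

variable (p) in
/-- The largest perturbation. -/
noncomputable def spread : ℝ := p.scale * Real.log (1 + p.n)

lemma perturbation_mem (hs : 0 ≤ p.scale) (c i : ℕ) :
    0 ≤ p.perturbation ω c i ∧ p.perturbation ω c i ≤ p.spread := by
  have h1 : (0 : ℝ) ≤ ω (c + i) := (ω (c + i)).2.1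
  have h2 : (ω (c + i) : ℝ) ≤ 1 := (ω (c + i)).2.2
  have h3 : (0 : ℝ) ≤ p.n := Nat.cast_nonneg _
  constructor
  · exact mul_nonneg hs (Real.log_nonneg (by nlinarith))
  · refine mul_le_mul_of_nonneg_left (Real.log_le_log (by nlinarith) (by nlinarith)) hs

/-- The invariant of the algorithm: it is in some epoch `j`, and its loss and its number of changes
are bounded in terms of `j`. -/
lemma exists_inEpoch (hn : 0 < p.n) (hs : 0 ≤ p.scale)
    (ht : 0 < p.threshold) (hx : ∀ r, ∀ i < p.n, 0 ≤ x r i ∧ x r i ≤ 1) (t : ℕ) :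
    ∃ j, InEpoch p ω x t j (p.state ω x t) ∧ ((p.state ω x t).changes : ℝ) < p.threshold ∧
      (changeCount (fun t => (p.state ω x t).lead) t : ℝ) ≤
        (p.state ω x t).changes + j * (p.threshold + 1) ∧
      ∀ i < p.n, ∑ r ∈ Finset.range t, x r (p.state ω x r).lead + (p.state ω x t).score i -
          (p.state ω x t).score (p.state ω x t).lead ≤
        ∑ r ∈ Finset.range t, x r i + (p.state ω x t).changes + (j + 1) * p.spread +
          j * (p.threshold + 1) := by
  have commit_eq : ∀ {t j} {s : FPLState}, InEpoch p ω x t j s → InEpoch p ω x t j (p.commit s) := by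
    intro t j s h
    rw [commit]
    split_ifs
    · exact ⟨h.1, h.2, h.3, h.4, h.5, h.6, h.7⟩
    · exact h
  induction t with
  | zero =>
    obtain ⟨h1, h2, h3, h4, h5, h6, h7⟩ := inEpoch_redraw (p := p) (j := 0) ω x
      ⟨0, 0, 0, 0, 0, 0, 0⟩ rfl (by simp)
    refine ⟨0, ⟨h1, h2, h3, h4, h5, h6, h7⟩, ?_, ?_, fun i hi => ?_⟩
    · simpa [state, initial, redraw] using ht
    · simp [changeCount]
    · have e1 := (perturbation_mem ω hs 0 i).2
      have e2 := (perturbation_mem ω hs 0 (leader (p.perturbation ω 0) p.n)).1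
      simp only [state, initial, redraw, Finset.range_zero, Finset.sum_empty, Nat.cast_zero]
      linarith
  | succ t ih =>
    obtain ⟨j, hj, hch, hcount, hloss⟩ := ih
    obtain ⟨a1, a2, a3⟩ := inEpoch_advance ω x hj
    set s := p.state ω x t with hs_def
    set l' := leader (fun i => s.score i + x t i) p.n with hl'
    have hw : (((p.advance (x t) s).changes : ℕ) : ℝ) = s.changes +
        ((if l' = s.lead then 0 else 1 : ℕ) : ℝ) := by
      simp only [advance]; push_cast; rfl
    have hle1 : ((if l' = s.lead then 0 else 1 : ℕ) : ℝ) ≤ 1 := by split_ifs <;> simp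
    have hkey := score_leader_add_le hn s.score (x t) (hx t)
    rw [← hl', ← hj.lead] at hkey
    -- If the epoch closes, its counter was below the threshold before this round. The round and the
    -- redraw together produce a single transition of the leader, whence the charge `threshold + 1`
    -- per closed epoch. The fresh scores lie in `[0, spread]`, which adds one `spread`.
    by_cases hexpired : p.Expired (p.advance (x t) s).elapsed (p.advance (x t) s).changes
    · have hst : p.state ω x (t + 1) = p.commit (p.redraw ω (p.advance (x t) s)) := by
        rw [state, step, ← hs_def, restart, if_pos hexpired]
      have hend : p.epochStart ω x (j + 1) = t + 1 := by
        refine epochEnd_eq ω x (by have := hj.start_le; omega) ?_ fun r h1 h2 =>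
          hj.not_expired r h1 (by omega)
        rwa [a2, a3] at hexpired
      have hin := inEpoch_redraw (p := p) ω x (p.advance (x t) s) hend
        (by simp [advance, hj.coins])
      have e1 : (p.state ω x (t + 1)).score =
          p.perturbation ω (p.advance (x t) s).coins := by
        rw [hst, commit]; split_ifs <;> rfl
      have e2 : (p.state ω x (t + 1)).changes = 0 := by
        rw [hst, commit]; split_ifs <;> rfl
      refine ⟨j + 1, hst ▸ commit_eq hin, by rw [e2]; simpa using ht, ?_, fun i hi => ?_⟩
      · rw [changeCount_succ, e2]
        have : (((if (p.state ω x (t + 1)).lead = (p.state ω x t).lead then 0 else 1 : ℕ)) : ℝ) ≤ 1 := by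
          split_ifs <;> simp
        push_cast at this ⊢
        linarith
      · rw [Finset.sum_range_succ, Finset.sum_range_succ, e1, e2]
        have e3 := (perturbation_mem ω hs (p.advance (x t) s).coins i).2
        have e4 := (perturbation_mem ω hs (p.advance (x t) s).coins (p.state ω x (t + 1)).lead).1
        have e5 := hloss i hi
        have e6 := (leader_spec (fun i => s.score i + x t i) p.n).1 i hi
        rw [← hl'] at e6
        rw [← hs_def]
        push_cast at hkey hle1 ⊢
        linarith
    · have hst : p.state ω x (t + 1) = p.commit (p.advance (x t) s) := by
        rw [state, step, ← hs_def, restart, if_neg hexpired]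
      have hin : InEpoch p ω x (t + 1) j (p.advance (x t) s) := by
        refine ⟨by have := hj.start_le; omega, fun r h1 h2 => ?_, a1, a2, a3, rfl, hj.coins⟩
        rcases Nat.lt_succ_iff_lt_or_eq.1 (Nat.lt_succ_of_le h2) with h | rfl
        · exact hj.not_expired r h1 (by omega)
        · rwa [a2, a3] at hexpired
      have e1 : (p.state ω x (t + 1)).score = fun i => s.score i + x t i := by
        rw [hst, commit]; split_ifs <;> rfl
      have e2 : (p.state ω x (t + 1)).changes = (p.advance (x t) s).changes := by
        rw [hst, commit]; split_ifs <;> rfl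
      have e3 : (p.state ω x (t + 1)).lead = l' := by
        rw [hst, commit]; split_ifs <;> rfl
      refine ⟨j, hst ▸ commit_eq hin, ?_, ?_, fun i hi => ?_⟩
      · rw [e2]; exact not_le.1 fun h => hexpired (Or.inr h)
      · rw [changeCount_succ, e2, hw, Nat.cast_add]
        simp only [e3, ← hs_def]
        linarith
      · rw [Finset.sum_range_succ, Finset.sum_range_succ, e1, e2, hw, e3, ← hs_def]
        have e5 := hloss i hi
        dsimp only
        linarith

/-- If there are at most `J` epochs, then the algorithm never exhausts its budget, and its regret
is small. -/
lemma loss_le (hn : 0 < p.n) (hs : 0 ≤ p.scale) (hr : 0 < p.rate)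
    (ht : 0 < p.threshold) (hx : ∀ r, ∀ i < p.n, 0 ≤ x r i ∧ x r i ≤ 1) {J : ℕ}
    (hJ : p.horizon ≤ p.epochStart ω x J)
    (hbudget : (J + 1) * (p.threshold + 1) ≤ p.budget) {i : ℕ} (hi : i < p.n) :
    ∑ r ∈ Finset.range p.horizon, x r (p.state ω x r).out ≤
      ∑ r ∈ Finset.range p.horizon, x r i + (J + 1) * (p.spread + p.threshold + 1) := by
  have hB : 0 ≤ p.spread := (perturbation_mem ω hs 0 0).1.trans (perturbation_mem ω hs 0 0).2
  obtain ⟨j, hj, hch, hcount, hloss⟩ := exists_inEpoch ω x hn hs ht hx p.horizon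
  have hjJ : j ≤ J := by
    by_contra! h
    have h1 := (epochStart_strictMono ω x hr) (show J < J + 1 by omega)
    have h2 := (epochStart_strictMono ω x hr).monotone (show J + 1 ≤ j by omega)
    have := hj.start_le
    omega
  have hjJ' : (j : ℝ) ≤ J := by exact_mod_cast hjJ
  -- In the current epoch the counter is below the threshold, and each of the at most `J` closed
  -- ones accounts for `threshold + 1`; the budget covers this, so the action played is always the
  -- leader.
  have h1 : changeCount (fun t => (p.state ω x t).lead) p.horizon ≤ p.budget := by
    have : (changeCount (fun t => (p.state ω x t).lead) p.horizon : ℝ) ≤ p.budget := by nlinarith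
    exact_mod_cast this
  have h2 : ∑ r ∈ Finset.range p.horizon, x r (p.state ω x r).out =
      ∑ r ∈ Finset.range p.horizon, x r (p.state ω x r).lead := by
    refine Finset.sum_congr rfl fun r hr => ?_
    rw [(p.out_eq_lead ω x ((changeCount_mono _ (Finset.mem_range.1 hr).le).trans h1)).1]
  rw [h2]
  have h3 := hloss i hi
  have h4 := (leader_spec (p.state ω x p.horizon).score p.n).1 i hi
  rw [← hj.lead] at h4
  nlinarith

end FPLParams

/-! ## Independent coins -/

namespace RealRAM

instance : IsProbabilityMeasure coinLaw := by unfold coinLaw; infer_instance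

/-- Tossing one of the coins again does not change the law of the coins. -/
lemma measurePreserving_update (k : ℕ) :
    MeasurePreserving (fun q : (ℕ → unitInterval) × unitInterval => Function.update q.1 k q.2)
      (coinLaw.prod volume) coinLaw := by
  have hm : Measurable
      (fun q : (ℕ → unitInterval) × unitInterval => Function.update q.1 k q.2) := by
    refine measurable_pi_lambda _ fun i => ?_
    by_cases h : i = k
    · subst h; simpa using measurable_snd
    · simp only [Function.update_of_ne h]; fun_prop
  refine ⟨hm, Measure.eq_infinitePi (μ := fun _ : ℕ => (volume : Measure unitInterval)) fun s t ht => ?_⟩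
  rw [Measure.map_apply hm (MeasurableSet.pi s.countable_toSet fun i _ => ht i)]
  have : (fun q : (ℕ → unitInterval) × unitInterval => Function.update q.1 k q.2) ⁻¹'
      Set.pi s t = (Set.pi (s.erase k : Finset ℕ) t) ×ˢ (if k ∈ s then t k else Set.univ) := by
    ext ⟨ω, u⟩
    simp only [Set.mem_preimage, Set.mem_pi, Set.mem_prod, Finset.mem_coe, Finset.mem_erase]
    constructor
    · intro h
      refine ⟨fun i hi => ?_, ?_⟩
      · simpa [Function.update_of_ne hi.1] using h i hi.2
      · split_ifs with hk
        · simpa using h k hk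
        · trivial
    · rintro ⟨h1, h2⟩ i hi
      by_cases hik : i = k
      · subst hik; simpa [hi] using h2
      · simpa [Function.update_of_ne hik] using h1 i ⟨hik, hi⟩
  rw [this, Measure.prod_prod, coinLaw, Measure.infinitePi_pi _ fun i _ => ht i]
  split_ifs with hk
  · rw [Finset.prod_erase_mul _ _ hk]
  · simp [Finset.erase_eq_of_notMem hk]

/-- Events that depend on disjoint finite sets of coins are independent. -/
lemma measure_inter_of_dependsOn {S S' : Finset ℕ} (hS : Disjoint S S')
    {A A' : Set (ℕ → unitInterval)} (hA : MeasurableSet A) (hA' : MeasurableSet A')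
    (h : ∀ ω ω' : ℕ → unitInterval, (∀ i ∈ S, ω i = ω' i) → ω ∈ A → ω' ∈ A)
    (h' : ∀ ω ω' : ℕ → unitInterval, (∀ i ∈ S', ω i = ω' i) → ω ∈ A' → ω' ∈ A') :
    coinLaw.real (A ∩ A') = coinLaw.real A * coinLaw.real A' := by
  have hind := (ProbabilityTheory.iIndepFun_infinitePi
    (P := fun _ : ℕ => (volume : Measure unitInterval)) (X := fun _ u => u)
    (fun _ => measurable_id)).indepFun_finset S S' hS (fun i => measurable_pi_apply i)
  have key : ∀ (R : Finset ℕ) (B : Set (ℕ → unitInterval)), MeasurableSet B →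
      (∀ ω ω' : ℕ → unitInterval, (∀ i ∈ R, ω i = ω' i) → ω ∈ B → ω' ∈ B) →
      ∃ C : Set (R → unitInterval), MeasurableSet C ∧
        B = (fun (ω : ℕ → unitInterval) (i : R) => ω i) ⁻¹' C := by
    intro R B hB hR
    -- Filling the coins outside `R` with zeros exhibits the event as the preimage of a measurable
    -- set under restriction to `R`.
    let ext : (R → unitInterval) → (ℕ → unitInterval) :=
      fun y i => if hi : i ∈ R then y ⟨i, hi⟩ else 0
    have hext : Measurable ext := by
      refine measurable_pi_lambda _ fun i => ?_
      by_cases hi : i ∈ R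
      · simpa [ext, hi] using measurable_pi_apply _
      · simp [ext, hi]
    refine ⟨ext ⁻¹' B, hext hB, ?_⟩
    ext ω
    refine ⟨hR _ _ fun i hi => by simp [ext, hi], hR _ _ fun i hi => by simp [ext, hi]⟩
  obtain ⟨C, hC, rfl⟩ := key S A hA h
  obtain ⟨C', hC', rfl⟩ := key S' A' hA' h'
  have := hind.measure_inter_preimage_eq_mul C C' hC hC'
  rw [measureReal_def, measureReal_def, measureReal_def, ← ENNReal.toReal_mul]
  exact congrArg _ this

end RealRAM

/-- The points of `A` below `d` cost at most `d`. Every other `v` in `A` is the image of `(v - d) /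
e`, which lies in `[0,1]` because `e ≥ 1`, and the affine map scales volume by `e`. -/
lemma volume_le_of_affine {e d : ℝ} (he : 1 ≤ e) (hd : 0 ≤ d) (A B : Set unitInterval)
    (h : ∀ u v : unitInterval, (v : ℝ) = e * u + d → v ∈ A → u ∈ B) :
    volume A ≤ ENNReal.ofReal d + ENNReal.ofReal e * volume B := by
  have he0 : 0 < e := by linarith
  rw [unitInterval.volume_apply, unitInterval.volume_apply]
  have hsub : (Subtype.val '' A : Set ℝ) ⊆
      Set.Ico 0 d ∪ (fun y => y + -d) ⁻¹' ((fun y => e⁻¹ * y) ⁻¹' (Subtype.val '' B)) := by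
    rintro _ ⟨v, hv, rfl⟩
    by_cases hvd : (v : ℝ) < d
    · exact Or.inl ⟨v.2.1, hvd⟩
    · refine Or.inr ?_
      push Not at hvd
      have h1 : (v : ℝ) ≤ 1 := v.2.2
      have h0 : 0 ≤ e⁻¹ * ((v : ℝ) + -d) := mul_nonneg (inv_nonneg.2 he0.le) (by linarith)
      have h2 : e⁻¹ * ((v : ℝ) + -d) ≤ 1 := by
        rw [inv_mul_le_iff₀ he0]; linarith
      refine ⟨⟨_, h0, h2⟩, h _ v ?_ hv, rfl⟩
      simp only
      rw [mul_inv_cancel_left₀ he0.ne']; ring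
  refine (measure_mono hsub).trans ((measure_union_le _ _).trans ?_)
  rw [measure_preimage_add_right, Real.volume_preimage_mul_left (inv_ne_zero he0.ne'), inv_inv,
    abs_of_pos he0, Real.volume_Ico, sub_zero]

/-! ## Measurability -/

/-- Needed because the index itself is random: the position in the coin stream, the leader, and the
starting time of an epoch. -/
lemma Measurable.apply_nat {Ω : Type*} [MeasurableSpace Ω] {E : Type*} [MeasurableSpace E]
    {f : Ω → ℕ → E} (hf : ∀ i, Measurable fun ω => f ω i) {g : Ω → ℕ} (hg : Measurable g) :
    Measurable fun ω => f ω (g ω) := by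
  have : Measurable fun q : Ω × ℕ => f q.1 q.2 := measurable_from_prod_countable_left hf
  exact this.comp (measurable_id.prodMk hg)

lemma Measurable.leader {Ω : Type*} [MeasurableSpace Ω] {f : Ω → ℕ → ℝ}
    (hf : ∀ i, Measurable fun ω => f ω i) (k : ℕ) : Measurable fun ω => leader (f ω) k := by
  induction k with
  | zero => exact measurable_const
  | succ k ih =>
    exact Measurable.ite (measurableSet_le (Measurable.apply_nat hf ih) (hf k)) ih measurable_const

lemma Measurable.ite_eq_nat {Ω : Type*} [MeasurableSpace Ω] {f g : Ω → ℕ} (hf : Measurable f)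
    (hg : Measurable g) : Measurable fun ω => if f ω = g ω then 0 else 1 :=
  Measurable.ite (measurableSet_eq_fun hf hg) measurable_const measurable_const

namespace FPLParams
variable (p : FPLParams) (x : ℕ → ℕ → ℝ)

lemma measurable_perturbation (c i : ℕ) : Measurable fun ω => p.perturbation ω c i := by
  unfold perturbation
  fun_prop

lemma measurable_epochScore (s c t i : ℕ) : Measurable fun ω => p.epochScore ω x s c t i :=
  (p.measurable_perturbation c i).add_const _

lemma measurable_epochLead (s c t : ℕ) : Measurable fun ω => p.epochLead ω x s c t :=
  Measurable.leader (p.measurable_epochScore x s c t) _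

lemma measurable_epochChanges (s c t : ℕ) : Measurable fun ω => p.epochChanges ω x s c t :=
  Finset.measurable_sum _ fun r _ =>
    (p.measurable_epochLead x s c (r + 1)).ite_eq_nat (p.measurable_epochLead x s c r)

lemma measurableSet_expired (s c t : ℕ) :
    MeasurableSet {ω | p.Expired (t - s) (p.epochChanges ω x s c t)} :=
  (p.measurable_epochChanges x s c t) (MeasurableSet.of_discrete (s := {m | p.Expired (t - s) m}))

variable {p}

lemma measurable_epochEnd (hr : 0 < p.rate) (s c : ℕ) :
    Measurable fun ω => p.epochEnd ω x s c := by
  refine measurable_to_countable' fun t => ?_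
  have : (fun ω => p.epochEnd ω x s c) ⁻¹' {t} =
      {ω | s < t} ∩ {ω | p.Expired (t - s) (p.epochChanges ω x s c t)} ∩
        ⋂ r ∈ Set.Ioo s t, {ω | p.Expired (r - s) (p.epochChanges ω x s c r)}ᶜ := by
    ext ω
    simp only [Set.mem_preimage, Set.mem_singleton_iff, Set.mem_inter_iff, Set.mem_ofPred_eq,
      Set.mem_iInter, Set.mem_compl_iff, Set.mem_Ioo]
    constructor
    · rintro rfl
      exact ⟨epochEnd_spec ω x hr s c, fun r h => not_expired_of_lt_epochEnd ω x h.1 h.2⟩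
    · rintro ⟨⟨h1, h2⟩, h3⟩
      exact epochEnd_eq ω x h1 h2 fun r a b => h3 r ⟨a, b⟩
  rw [this]
  exact (MeasurableSet.const _ |>.inter (p.measurableSet_expired x s c t)).inter
    (MeasurableSet.biInter (Set.to_countable _) fun r _ => (p.measurableSet_expired x s c r).compl)

lemma measurable_epochStart (hr : 0 < p.rate) (j : ℕ) :
    Measurable fun ω => p.epochStart ω x j := by
  induction j with
  | zero => exact measurable_const
  | succ j ih =>
    exact Measurable.apply_nat (f := fun ω s => p.epochEnd ω x s (j * p.n))
      (fun s => measurable_epochEnd x hr s _) ih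

/-! ## The coins that an epoch depends on -/

variable {x}

lemma epochLead_congr {ω ω' : ℕ → unitInterval} {c : ℕ} (h : ∀ i < p.n, ω (c + i) = ω' (c + i))
    (s t : ℕ) : p.epochLead ω x s c t = p.epochLead ω' x s c t :=
  leader_congr fun i hi => by simp [epochScore, perturbation, h i hi]

lemma epochEnd_congr {ω ω' : ℕ → unitInterval} {c : ℕ} (h : ∀ i < p.n, ω (c + i) = ω' (c + i))
    (s : ℕ) : p.epochEnd ω x s c = p.epochEnd ω' x s c := by
  simp only [epochEnd, epochChanges, epochLead_congr h]

/-- Epoch `j` reads exactly the coins from `j * p.n` up to `(j + 1) * p.n`, whatever happened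
before. This makes its start independent of its own perturbations. -/
lemma epochStart_congr {ω ω' : ℕ → unitInterval} {j : ℕ} (h : ∀ i < j * p.n, ω i = ω' i) :
    p.epochStart ω x j = p.epochStart ω' x j := by
  induction j with
  | zero => rfl
  | succ j ih =>
    have e : (j + 1) * p.n = j * p.n + p.n := by ring
    rw [epochStart, epochStart, ih fun i hi => h i (by omega)]
    exact epochEnd_congr (fun i hi => h _ (by omega)) _

end FPLParams

/-! ### Stability of the perturbed leader and the number of epochs -/

section
open RealRAM

namespace FPLParams
variable {p : FPLParams} {x : ℕ → ℕ → ℝ}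

/-- Moving the coin of action `i` so that its perturbation increases by one. -/
lemma perturbation_update (hn : 0 < p.n) (hs : 0 < p.scale) (ω : ℕ → unitInterval) (c i : ℕ)
    {u v : unitInterval}
    (hv : (v : ℝ) = Real.exp p.scale⁻¹ * u + (Real.exp p.scale⁻¹ - 1) / p.n) (j : ℕ) :
    p.perturbation (Function.update ω (c + i) v) c j =
      p.perturbation (Function.update ω (c + i) u) c j + if j = i then 1 else 0 := by
  unfold perturbation
  by_cases hj : j = i
  · subst hj
    have hn' : (0 : ℝ) < p.n := by exact_mod_cast hn
    have hu : (0 : ℝ) ≤ u := u.2.1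
    -- The reason for the form `log (1 + n * u)`: multiplying `1 + n * u` by `exp (1 / scale)`
    -- raises the perturbation by exactly 1.
    have : 1 + (p.n : ℝ) * v = Real.exp p.scale⁻¹ * (1 + p.n * u) := by
      rw [hv]; field_simp; ring
    simp only [Function.update_self, if_true, this]
    rw [Real.log_mul (Real.exp_ne_zero _) (by positivity), Real.log_exp]
    field_simp
    ring
  · simp [hj]

/-- With the coin `v` the score of `i` is larger by 1, and `i` leads nevertheless. With `u` it thus
leads by a margin of 1, which one round of losses in `[0,1]` cannot overturn. -/
lemma stay_of_lead (hn : 0 < p.n) (hs : 0 < p.scale) (hx : ∀ r, ∀ i < p.n, 0 ≤ x r i ∧ x r i ≤ 1)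
    {s c t i : ℕ} (ht : s ≤ t) (hi : i < p.n) (ω : ℕ → unitInterval) {u v : unitInterval}
    (hv : (v : ℝ) = Real.exp p.scale⁻¹ * u + (Real.exp p.scale⁻¹ - 1) / p.n)
    (h : p.epochLead (Function.update ω (c + i) v) x s c t = i) :
    p.epochLead (Function.update ω (c + i) u) x s c t = i ∧
      p.epochLead (Function.update ω (c + i) u) x s c (t + 1) = i := by
  unfold epochLead at h ⊢
  rw [leader_eq_iff _ hi] at h ⊢
  rw [leader_eq_iff _ hi]
  have e : ∀ j, p.epochScore (Function.update ω (c + i) v) x s c t j =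
      p.epochScore (Function.update ω (c + i) u) x s c t j + if j = i then 1 else 0 := by
    intro j
    unfold epochScore
    rw [perturbation_update hn hs ω c i hv j]
    ring
  have e' : ∀ j, p.epochScore (Function.update ω (c + i) u) x s c (t + 1) j =
      p.epochScore (Function.update ω (c + i) u) x s c t j + x t j := by
    intro j
    unfold epochScore
    rw [Finset.sum_Ico_succ_top ht]
    ring
  obtain ⟨h1, h2⟩ := h
  have h3 := hx t i hi
  refine ⟨⟨fun j hj => ?_, fun j hj => ?_⟩, ⟨fun j hj => ?_, fun j hj => ?_⟩⟩
  · by_cases hji : j = i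
    · rw [hji]
    · have := h1 j hj
      simp only [e, hji, if_true, if_false] at this
      linarith
  · have := h2 j hj
    simp only [e, hj.ne, if_true, if_false] at this
    linarith
  · by_cases hji : j = i
    · rw [hji]
    · have := h1 j hj
      have h4 := hx t j hj
      simp only [e, e', hji, if_true, if_false] at this ⊢
      linarith
  · have := h2 j hj
    have h4 := hx t j (hj.trans hi)
    simp only [e, e', hj.ne, if_true, if_false] at this ⊢
    linarith

/-- Condition on all coins but that of action `i` and change variables in this coin. The additive
term is the mass of coins too small to be raised ones. -/
lemma measure_lead_le (hn : 0 < p.n) (hs : 0 < p.scale)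
    (hx : ∀ r, ∀ i < p.n, 0 ≤ x r i ∧ x r i ≤ 1) {s c t i : ℕ} (ht : s ≤ t) (hi : i < p.n) :
    coinLaw {ω | p.epochLead ω x s c t = i} ≤ ENNReal.ofReal ((Real.exp p.scale⁻¹ - 1) / p.n) +
      ENNReal.ofReal (Real.exp p.scale⁻¹) *
        coinLaw {ω | p.epochLead ω x s c t = i ∧ p.epochLead ω x s c (t + 1) = i} := by
  have he : 1 ≤ Real.exp p.scale⁻¹ := Real.one_le_exp (inv_nonneg.2 hs.le)
  have hn' : (0 : ℝ) < p.n := by exact_mod_cast hn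
  have hd : 0 ≤ (Real.exp p.scale⁻¹ - 1) / p.n := div_nonneg (by linarith) hn'.le
  have hA : MeasurableSet {ω | p.epochLead ω x s c t = i} :=
    p.measurable_epochLead x s c t (measurableSet_singleton i)
  have hB : MeasurableSet {ω | p.epochLead ω x s c t = i ∧ p.epochLead ω x s c (t + 1) = i} :=
    hA.inter (p.measurable_epochLead x s c (t + 1) (measurableSet_singleton i))
  have key : ∀ E : Set (ℕ → unitInterval), MeasurableSet E → coinLaw E =
      ∫⁻ ω, volume {u : unitInterval | Function.update ω (c + i) u ∈ E} ∂coinLaw := by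
    intro E hE
    have h := measurePreserving_update (c + i)
    conv_lhs => rw [← h.map_eq]
    rw [Measure.map_apply h.measurable hE, Measure.prod_apply (h.measurable hE)]
    rfl
  rw [key _ hA, key _ hB, ← lintegral_const_mul', ← add_zero (∫⁻ _, _ * _ ∂_), add_zero]
  · calc _ ≤ ∫⁻ ω, (ENNReal.ofReal ((Real.exp p.scale⁻¹ - 1) / p.n) +
          ENNReal.ofReal (Real.exp p.scale⁻¹) * volume {u : unitInterval |
            Function.update ω (c + i) u ∈
              {ω | p.epochLead ω x s c t = i ∧ p.epochLead ω x s c (t + 1) = i}}) ∂coinLaw :=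
        lintegral_mono fun ω => volume_le_of_affine he hd _ _ fun u v huv hv =>
          stay_of_lead hn hs hx ht hi ω huv hv
      _ = _ := by
        rw [lintegral_add_left measurable_const, lintegral_const, measure_univ, mul_one]
  · exact ENNReal.ofReal_ne_top

/-- The leader is unlikely to change. -/
lemma measure_change_le (hn : 0 < p.n) (hs : 0 < p.scale)
    (hx : ∀ r, ∀ i < p.n, 0 ≤ x r i ∧ x r i ≤ 1) {s c t : ℕ} (ht : s ≤ t) :
    coinLaw.real {ω | p.epochLead ω x s c (t + 1) ≠ p.epochLead ω x s c t} ≤ 2 * p.scale⁻¹ := by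
  have hn' : (0 : ℝ) < p.n := by exact_mod_cast hn
  set η := p.scale⁻¹ with hη
  have hη0 : 0 ≤ η := inv_nonneg.2 hs.le
  have he : 1 ≤ Real.exp η := Real.one_le_exp hη0
  let A : ℕ → Set (ℕ → unitInterval) := fun i => {ω | p.epochLead ω x s c t = i}
  let B : ℕ → Set (ℕ → unitInterval) := fun i =>
    {ω | p.epochLead ω x s c t = i ∧ p.epochLead ω x s c (t + 1) = i}
  have hA : ∀ i, MeasurableSet (A i) := fun i =>
    p.measurable_epochLead x s c t (measurableSet_singleton i)
  have hB : ∀ i, MeasurableSet (B i) := fun i =>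
    (hA i).inter (p.measurable_epochLead x s c (t + 1) (measurableSet_singleton i))
  have h1 : ∀ i < p.n, coinLaw.real (A i) ≤ (Real.exp η - 1) / p.n +
      Real.exp η * coinLaw.real (B i) := by
    intro i hi
    have h := measure_lead_le (c := c) hn hs hx ht hi
    have := ENNReal.toReal_mono (by finiteness) h
    rwa [ENNReal.toReal_add (by finiteness) (by finiteness), ENNReal.toReal_mul,
      ENNReal.toReal_ofReal (div_nonneg (by linarith) hn'.le),
      ENNReal.toReal_ofReal (by linarith)] at this
  have hdA : (↑(Finset.range p.n) : Set ℕ).PairwiseDisjoint A := by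
    intro i _ j _ hij
    exact Set.disjoint_left.2 fun ω h h' => hij (h.symm.trans h')
  have hdB : (↑(Finset.range p.n) : Set ℕ).PairwiseDisjoint B := by
    intro i _ j _ hij
    exact Set.disjoint_left.2 fun ω h h' => hij (h.1.symm.trans h'.1)
  have hsA : ∑ i ∈ Finset.range p.n, coinLaw.real (A i) = 1 := by
    rw [← measureReal_biUnion_finset hdA fun i _ => hA i]
    have : (⋃ i ∈ Finset.range p.n, A i) = Set.univ := by
      ext ω
      simp only [Set.mem_iUnion, Set.mem_univ, iff_true, Finset.mem_range]
      exact ⟨_, leader_lt _ hn, rfl⟩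
    rw [this, probReal_univ]
  have hsB : ∑ i ∈ Finset.range p.n, coinLaw.real (B i) =
      1 - coinLaw.real {ω | p.epochLead ω x s c (t + 1) ≠ p.epochLead ω x s c t} := by
    rw [← measureReal_biUnion_finset hdB fun i _ => hB i,
      ← probReal_compl_eq_one_sub]
    · congr 1
      ext ω
      simp only [B, Set.mem_iUnion, Finset.mem_range, Set.mem_compl_iff, Set.mem_ofPred_eq, not_not]
      constructor
      · rintro ⟨i, -, h2, h3⟩; rw [h2, h3]
      · intro h; exact ⟨_, leader_lt _ hn, rfl, h⟩
    · exact (measurableSet_eq_fun (p.measurable_epochLead x s c (t + 1))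
        (p.measurable_epochLead x s c t)).compl
  have h2 := Finset.sum_le_sum fun i hi => h1 i (Finset.mem_range.1 hi)
  rw [hsA, Finset.sum_add_distrib, Finset.sum_const, Finset.card_range, nsmul_eq_mul,
    mul_div_cancel₀ _ hn'.ne', ← Finset.mul_sum, hsB] at h2
  have h3 : 1 - η ≤ Real.exp (-η) := Real.one_sub_le_exp_neg η
  have h4 : Real.exp (-η) * Real.exp η = 1 := by rw [← Real.exp_add]; simp
  set q := coinLaw.real {ω | p.epochLead ω x s c (t + 1) ≠ p.epochLead ω x s c t}
  -- Summing over the actions gives `1 ≤ (exp η - 1) + exp η * (1 - q)`: the `n` lost masses of size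
  -- `(exp η - 1) / n` add up to one term only.
  have h5 : Real.exp η * q ≤ Real.exp η * (2 * (1 - Real.exp (-η))) := by nlinarith
  have := le_of_mul_le_mul_left h5 (Real.exp_pos η)
  linarith

/-- Markov's inequality, since the expected number of changes in `m` rounds is at most `2 * m /
scale`. -/
lemma measure_changes_ge_le (hn : 0 < p.n) (hs : 0 < p.scale) (hthr : 0 < p.threshold)
    (hx : ∀ r, ∀ i < p.n, 0 ≤ x r i ∧ x r i ≤ 1) (s c m : ℕ) :
    coinLaw.real {ω | p.threshold ≤ p.epochChanges ω x s c (s + m)} ≤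
      2 * m / (p.scale * p.threshold) := by
  have hint : ∀ r ∈ Finset.Ico s (s + m), Integrable (fun ω =>
      ((if p.epochLead ω x s c (r + 1) = p.epochLead ω x s c r then 0 else 1 : ℕ) : ℝ)) coinLaw := by
    intro r _
    refine Integrable.of_bound (C := 1) ?_ (Filter.Eventually.of_forall fun ω => ?_)
    · exact (Measurable.comp (g := fun m : ℕ => (m : ℝ)) (by fun_prop)
        ((p.measurable_epochLead x s c (r + 1)).ite_eq_nat
          (p.measurable_epochLead x s c r))).aestronglyMeasurable
    · split_ifs <;> simp
  have hE : ∫ ω, (p.epochChanges ω x s c (s + m) : ℝ) ∂coinLaw ≤ m * (2 * p.scale⁻¹) := by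
    simp only [epochChanges, Nat.cast_sum]
    rw [integral_finsetSum _ hint]
    calc _ ≤ ∑ r ∈ Finset.Ico s (s + m), 2 * p.scale⁻¹ := by
          refine Finset.sum_le_sum fun r hr => ?_
          refine le_trans (le_of_eq ?_)
            (measure_change_le (c := c) hn hs hx (Finset.mem_Ico.1 hr).1)
          rw [← integral_indicator_one]
          · congr 1
            ext ω
            by_cases h : p.epochLead ω x s c (r + 1) = p.epochLead ω x s c r <;>
              simp [Set.indicator, h]
          · exact (measurableSet_eq_fun (p.measurable_epochLead x s c (r + 1))
              (p.measurable_epochLead x s c r)).compl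
      _ = _ := by simp
  have := mul_meas_ge_le_integral_of_nonneg (μ := coinLaw)
    (f := fun ω => (p.epochChanges ω x s c (s + m) : ℝ))
    (Filter.Eventually.of_forall fun ω => Nat.cast_nonneg _)
    (by
      simp only [epochChanges, Nat.cast_sum]
      exact integrable_finsetSum _ hint) p.threshold
  rw [le_div_iff₀ (by positivity)]
  have h2 := this.trans hE
  have h3 := mul_le_mul_of_nonneg_left h2 hs.le
  have h4 : p.scale * (m * (2 * p.scale⁻¹)) = 2 * m := by field_simp
  rw [h4] at h3
  linarith

/-- The weight of an epoch that starts at time `s`. -/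
noncomputable def weight (p : FPLParams) (s : ℕ) : ℝ :=
  Real.exp (Real.log 8 * (((p.horizon : ℝ) - s) * p.rate / p.horizon))

/-- A long epoch divides the weight by at least 8. A short one only keeps the weight from growing,
but it must have reached the threshold of changes, which has probability at most `1/8`. The two
contributions add up to `1/4`. Ends at or after the horizon are not counted. -/
lemma sum_weight_epochEnd_le (hn : 0 < p.n) (hs : 0 < p.scale) (hthr : 0 < p.threshold)
    (hr : 0 < p.rate) (hx : ∀ r, ∀ i < p.n, 0 ≤ x r i ∧ x r i ≤ 1)
    (hq : 16 * (p.horizon / p.rate + 1) ≤ p.scale * p.threshold) (s c : ℕ) :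
    ∑ s' ∈ Finset.range p.horizon, p.weight s' * coinLaw.real {ω | p.epochEnd ω x s c = s'} ≤
      p.weight s / 4 := by
  rcases Nat.eq_zero_or_pos p.horizon with h0 | hT
  · simp [h0, weight]
  have hT' : (0 : ℝ) < p.horizon := by exact_mod_cast hT
  set m := ⌈(p.horizon : ℝ) / p.rate⌉₊ with hm
  have hm1 : (m : ℝ) ≤ p.horizon / p.rate + 1 := (Nat.ceil_lt_add_one (by positivity)).le
  have hbad : coinLaw.real {ω | p.threshold ≤ p.epochChanges ω x s c (s + m)} ≤ 1 / 8 := by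
    refine (measure_changes_ge_le hn hs hthr hx s c m).trans ?_
    rw [div_le_iff₀ (by positivity)]
    linarith
  have hw : 0 < p.weight s := Real.exp_pos _
  have hmeas : ∀ s', MeasurableSet {ω | p.epochEnd ω x s c = s'} := fun s' =>
    measurable_epochEnd x hr s c (measurableSet_singleton s')
  have hdisj : ∀ S : Set ℕ, S.PairwiseDisjoint fun s' => {ω | p.epochEnd ω x s c = s'} := by
    intro S i _ j _ hij
    exact Set.disjoint_left.2 fun ω h h' => hij (h.symm.trans h')
  have hlog : 0 < Real.log 8 := Real.log_pos (by norm_num)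
  rw [← Finset.sum_filter_add_sum_filter_not _
    (fun s' : ℕ => (p.horizon : ℝ) ≤ ((s' : ℝ) - s) * p.rate)]
  have h1 : ∑ s' ∈ (Finset.range p.horizon).filter
      (fun s' : ℕ => (p.horizon : ℝ) ≤ ((s' : ℝ) - s) * p.rate),
      p.weight s' * coinLaw.real {ω | p.epochEnd ω x s c = s'} ≤ p.weight s / 8 := by
    calc _ ≤ ∑ s' ∈ (Finset.range p.horizon).filter
          (fun s' : ℕ => (p.horizon : ℝ) ≤ ((s' : ℝ) - s) * p.rate),
          p.weight s / 8 * coinLaw.real {ω | p.epochEnd ω x s c = s'} := by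
          refine Finset.sum_le_sum fun s' hs' => ?_
          refine mul_le_mul_of_nonneg_right ?_ measureReal_nonneg
          have h := (Finset.mem_filter.1 hs').2
          have e8 : p.weight s / 8 = Real.exp (Real.log 8 *
              (((p.horizon : ℝ) - s) * p.rate / p.horizon) - Real.log 8) := by
            rw [Real.exp_sub, Real.exp_log (by norm_num)]; rfl
          rw [e8, weight, Real.exp_le_exp]
          have h2 : 1 ≤ ((s' : ℝ) - s) * p.rate / p.horizon := by rwa [le_div_iff₀ hT', one_mul]
          have h3 : ((p.horizon : ℝ) - s') * p.rate / p.horizon =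
              ((p.horizon : ℝ) - s) * p.rate / p.horizon - ((s' : ℝ) - s) * p.rate / p.horizon := by
            ring
          rw [h3]; nlinarith
      _ = p.weight s / 8 * coinLaw.real (⋃ s' ∈ (Finset.range p.horizon).filter
          (fun s' : ℕ => (p.horizon : ℝ) ≤ ((s' : ℝ) - s) * p.rate),
            {ω | p.epochEnd ω x s c = s'}) := by
          rw [← Finset.mul_sum, measureReal_biUnion_finset (hdisj _) fun i _ => hmeas i]
      _ ≤ p.weight s / 8 * 1 := mul_le_mul_of_nonneg_left measureReal_le_one (by positivity)
      _ = _ := mul_one _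
  have h2 : ∑ s' ∈ (Finset.range p.horizon).filter
      (fun s' : ℕ => ¬ (p.horizon : ℝ) ≤ ((s' : ℝ) - s) * p.rate),
      p.weight s' * coinLaw.real {ω | p.epochEnd ω x s c = s'} ≤ p.weight s / 8 := by
    calc _ ≤ ∑ s' ∈ (Finset.range p.horizon).filter
          (fun s' : ℕ => ¬ (p.horizon : ℝ) ≤ ((s' : ℝ) - s) * p.rate),
          p.weight s * coinLaw.real ({ω | p.epochEnd ω x s c = s'} ∩
            {ω | p.threshold ≤ p.epochChanges ω x s c (s + m)}) := by
          refine Finset.sum_le_sum fun s' hs' => ?_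
          have h := (Finset.mem_filter.1 hs').2
          push Not at h
          by_cases hss : s < s'
          -- The epoch ended before its time limit, hence by the threshold; as the count is
          -- monotone, the threshold is also reached by time `s + m`.
          · have hss' : (s : ℝ) ≤ s' := by exact_mod_cast hss.le
            refine mul_le_mul ?_ (measureReal_mono ?_) measureReal_nonneg hw.le
            · rw [weight, weight, Real.exp_le_exp]
              gcongr
            · rintro ω rfl
              refine ⟨rfl, ?_⟩
              have hst := (epochEnd_spec ω x hr s c).2
              rw [Expired, Nat.cast_sub hss.le] at hst
              have h3 := hst.resolve_left (not_le.2 h)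
              refine h3.trans ?_
              have hle : p.epochEnd ω x s c ≤ s + m := by
                have h4 : ((p.epochEnd ω x s c : ℝ) - s) ≤ m := by
                  refine le_trans ?_ (Nat.le_ceil _)
                  rw [le_div_iff₀ hr]; exact h.le
                have : (p.epochEnd ω x s c : ℝ) ≤ (s + m : ℕ) := by push_cast; linarith
                exact_mod_cast this
              have : p.epochChanges ω x s c (p.epochEnd ω x s c) ≤
                  p.epochChanges ω x s c (s + m) :=
                Finset.sum_le_sum_of_subset (Finset.Ico_subset_Ico_right hle)
              exact_mod_cast this
          · have he : {ω | p.epochEnd ω x s c = s'} = ∅ := by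
              ext ω
              simp only [Set.mem_ofPred_eq, Set.mem_empty_iff_false, iff_false]
              rintro rfl
              exact hss (epochEnd_spec ω x hr s c).1
            simp [he]
      _ = p.weight s * coinLaw.real (⋃ s' ∈ (Finset.range p.horizon).filter
          (fun s' : ℕ => ¬ (p.horizon : ℝ) ≤ ((s' : ℝ) - s) * p.rate),
            ({ω | p.epochEnd ω x s c = s'} ∩
            {ω | p.threshold ≤ p.epochChanges ω x s c (s + m)})) := by
          rw [← Finset.mul_sum, measureReal_biUnion_finset]
          · intro i hi j hj hij
            exact (hdisj Set.univ trivial trivial hij).mono Set.inter_subset_left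
              Set.inter_subset_left
          · intro i _
            exact (hmeas i).inter (p.measurable_epochChanges x s c (s + m)
              (MeasurableSet.of_discrete (s := {k : ℕ | p.threshold ≤ k})))
      _ ≤ p.weight s * (1 / 8) := by
          refine mul_le_mul_of_nonneg_left ((measureReal_mono ?_).trans hbad) hw.le
          exact Set.iUnion₂_subset fun _ _ => Set.inter_subset_right
      _ = _ := by ring
  linarith

/-- It is unlikely that there are many epochs. -/
lemma measure_epochStart_lt_le (hn : 0 < p.n) (hs : 0 < p.scale) (hthr : 0 < p.threshold)
    (hr : 0 < p.rate) (hT : 0 < p.horizon) (hx : ∀ r, ∀ i < p.n, 0 ≤ x r i ∧ x r i ≤ 1)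
    (hq : 16 * (p.horizon / p.rate + 1) ≤ p.scale * p.threshold) (j : ℕ) :
    coinLaw.real {ω | p.epochStart ω x j < p.horizon} ≤
      Real.exp (Real.log 8 * p.rate) / 4 ^ j := by
  have hT' : (0 : ℝ) < p.horizon := by exact_mod_cast hT
  have hmeas : ∀ j s, MeasurableSet {ω | p.epochStart ω x j = s} := fun j s =>
    measurable_epochStart x hr j (measurableSet_singleton s)
  have key : ∑ s ∈ Finset.range p.horizon, p.weight s * coinLaw.real {ω | p.epochStart ω x j = s} ≤
      Real.exp (Real.log 8 * p.rate) / 4 ^ j := by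
    induction j with
    | zero =>
      have h0 : p.weight 0 = Real.exp (Real.log 8 * p.rate) := by
        rw [weight]; congr 2; push_cast; field_simp; ring
      rw [Finset.sum_eq_single_of_mem 0 (Finset.mem_range.2 hT)]
      · rw [h0, pow_zero, div_one]
        exact mul_le_of_le_one_right (Real.exp_pos _).le measureReal_le_one
      · intro s _ hs0
        have : {ω : ℕ → unitInterval | p.epochStart ω x 0 = s} = ∅ := by
          ext ω; simp [epochStart, hs0.symm]
        simp [this]
    | succ j ih =>
      -- The Markov property: the start of epoch `j` uses the coins below `j * p.n`, and its length
      -- from a fixed start uses the next `p.n` coins.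
      have hsplit : ∀ s' ∈ Finset.range p.horizon,
          coinLaw.real {ω | p.epochStart ω x (j + 1) = s'} ≤
          ∑ s ∈ Finset.range p.horizon, coinLaw.real {ω | p.epochStart ω x j = s} *
            coinLaw.real {ω | p.epochEnd ω x s (j * p.n) = s'} := by
        intro s' hs'
        have hsub : {ω | p.epochStart ω x (j + 1) = s'} ⊆ ⋃ s ∈ Finset.range p.horizon,
            ({ω | p.epochStart ω x j = s} ∩ {ω | p.epochEnd ω x s (j * p.n) = s'}) := by
          rintro ω rfl
          simp only [Set.mem_iUnion, Finset.mem_range]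
          exact ⟨_, (epochStart_lt_succ ω x hr j).trans (Finset.mem_range.1 hs'), rfl, rfl⟩
        refine (measureReal_mono hsub (measure_ne_top _ _)).trans ((measureReal_biUnion_finset_le _ _).trans ?_)
        refine Finset.sum_le_sum fun s _ => le_of_eq ?_
        refine measure_inter_of_dependsOn (S := Finset.range (j * p.n))
          (S' := Finset.Ico (j * p.n) (j * p.n + p.n)) ?_ (hmeas j s)
          (measurable_epochEnd x hr s _ (measurableSet_singleton s')) ?_ ?_
        · rw [Finset.disjoint_left]
          intro i hi hi'
          rw [Finset.mem_range] at hi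
          rw [Finset.mem_Ico] at hi'
          omega
        · intro ω ω' h hω
          exact (epochStart_congr fun i hi => (h i (Finset.mem_range.2 hi)).symm).trans hω
        · intro ω ω' h hω
          exact (epochEnd_congr (fun i hi => (h _ (Finset.mem_Ico.2 (by omega))).symm) s).trans hω
      calc _ ≤ ∑ s' ∈ Finset.range p.horizon, p.weight s' * ∑ s ∈ Finset.range p.horizon,
            coinLaw.real {ω | p.epochStart ω x j = s} *
              coinLaw.real {ω | p.epochEnd ω x s (j * p.n) = s'} :=
            Finset.sum_le_sum fun s' hs' =>
              mul_le_mul_of_nonneg_left (hsplit s' hs') (Real.exp_pos _).le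
        _ = ∑ s ∈ Finset.range p.horizon, coinLaw.real {ω | p.epochStart ω x j = s} *
              ∑ s' ∈ Finset.range p.horizon, p.weight s' *
              coinLaw.real {ω | p.epochEnd ω x s (j * p.n) = s'} := by
            simp only [Finset.mul_sum]
            rw [Finset.sum_comm]
            refine Finset.sum_congr rfl fun s _ => Finset.sum_congr rfl fun s' _ => by ring
        _ ≤ ∑ s ∈ Finset.range p.horizon, coinLaw.real {ω | p.epochStart ω x j = s} *
              (p.weight s / 4) :=
            Finset.sum_le_sum fun s _ => mul_le_mul_of_nonneg_left
              (sum_weight_epochEnd_le hn hs hthr hr hx hq s _) measureReal_nonneg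
        _ = (∑ s ∈ Finset.range p.horizon, p.weight s *
              coinLaw.real {ω | p.epochStart ω x j = s}) / 4 := by
            rw [Finset.sum_div]
            exact Finset.sum_congr rfl fun s _ => by ring
        _ ≤ (Real.exp (Real.log 8 * p.rate) / 4 ^ j) / 4 := by gcongr
        _ = _ := by rw [pow_succ]; field_simp
  -- Weights of starting times before the horizon are at least 1, so the weighted sum dominates the
  -- probability.
  refine le_trans ?_ key
  have hsub : {ω | p.epochStart ω x j < p.horizon} ⊆
      ⋃ s ∈ Finset.range p.horizon, {ω | p.epochStart ω x j = s} := by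
    intro ω hω
    simp only [Set.mem_iUnion, Finset.mem_range]
    exact ⟨_, hω, rfl⟩
  refine (measureReal_mono hsub (measure_ne_top _ _)).trans ((measureReal_biUnion_finset_le _ _).trans ?_)
  refine Finset.sum_le_sum fun s hs' => le_mul_of_one_le_left measureReal_nonneg ?_
  have h1 : (s : ℝ) ≤ p.horizon := by exact_mod_cast (Finset.mem_range.1 hs').le
  refine Real.one_le_exp (mul_nonneg (Real.log_nonneg (by norm_num)) ?_)
  exact div_nonneg (mul_nonneg (by linarith) hr.le) hT'.le

end FPLParams

/-! ## Regret of general algorithms -/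

section Regret
variable {n T : ℕ}

lemma PFEAlgorithm.measurable_play (A : PFEAlgorithm n T) (t : Fin T) :
    Measurable fun q : LossTable n T × A.Seed => A.play q.1 q.2 t := by
  refine (A.measurable_action t).comp (Measurable.prodMk ?_ measurable_snd)
  exact measurable_pi_lambda _ fun s => (measurable_pi_apply _).comp measurable_fst

lemma PFEAlgorithm.measurable_regret (A : PFEAlgorithm n T) :
    Measurable fun q : LossTable n T × A.Seed => regret q.1 (A.play q.1 q.2) := by
  unfold regret
  refine Measurable.sub ?_ ?_
  · refine Finset.measurable_sum _ fun t _ => measurable_subtype_coe.comp ?_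
    have : Measurable fun r : (LossTable n T) × Fin n => r.1 t r.2 :=
      measurable_from_prod_countable_left fun i =>
        (measurable_pi_apply i).comp (measurable_pi_apply t)
    exact this.comp (measurable_fst.prodMk (A.measurable_play t))
  · refine Measurable.iInf fun j => Finset.measurable_sum _ fun t _ => ?_
    fun_prop

lemma regret_le_card [NeZero n] (ℓ : LossTable n T) (i : Fin T → Fin n) : regret ℓ i ≤ T := by
  have h1 : ∑ t, (ℓ t (i t) : ℝ) ≤ T := by
    calc _ ≤ ∑ _t : Fin T, (1 : ℝ) := Finset.sum_le_sum fun t _ => (ℓ t (i t)).2.2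
      _ = T := by simp
  have h2 : 0 ≤ ⨅ j : Fin n, ∑ t, (ℓ t j : ℝ) :=
    le_ciInf fun j => Finset.sum_nonneg fun t _ => (ℓ t j).2.1
  unfold regret; linarith

lemma regret_ge (ℓ : LossTable n T) (i : Fin T → Fin n) (j : Fin n) :
    ∑ t, (ℓ t (i t) : ℝ) - ∑ t, (ℓ t j : ℝ) ≤ regret ℓ i := by
  have := ciInf_le (f := fun j : Fin n => ∑ t, (ℓ t j : ℝ)) (Finite.bddBelow_range _) j
  unfold regret; linarith

lemma neg_card_le_regret [NeZero n] (ℓ : LossTable n T) (i : Fin T → Fin n) : -(T : ℝ) ≤ regret ℓ i := by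
  refine le_trans ?_ (regret_ge ℓ i 0)
  have h1 : ∑ t, (ℓ t 0 : ℝ) ≤ T := by
    calc _ ≤ ∑ _t : Fin T, (1 : ℝ) := Finset.sum_le_sum fun t _ => (ℓ t 0).2.2
      _ = T := by simp
  have h2 : 0 ≤ ∑ t, (ℓ t (i t) : ℝ) := Finset.sum_nonneg fun t _ => (ℓ t (i t)).2.1
  linarith

lemma PFEAlgorithm.integrable_regret [NeZero n] (A : PFEAlgorithm n T)
    (adv : ProbabilityMeasure (LossTable n T)) :
    Integrable (fun q : LossTable n T × A.Seed => regret q.1 (A.play q.1 q.2)) (A.gameLaw adv) := by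
  unfold PFEAlgorithm.gameLaw
  refine Integrable.of_bound (C := T) A.measurable_regret.aestronglyMeasurable
    (Filter.Eventually.of_forall fun q => ?_)
  rw [Real.norm_eq_abs, abs_le]
  exact ⟨neg_card_le_regret _ _, regret_le_card _ _⟩

instance (A : PFEAlgorithm n T) (adv : ProbabilityMeasure (LossTable n T)) :
    IsProbabilityMeasure (A.gameLaw adv) := by
  unfold PFEAlgorithm.gameLaw; infer_instance

/-- A bound for all loss tables holds for all oblivious adversaries. -/
lemma PFEAlgorithm.gameLaw_lt_regret_le (A : PFEAlgorithm n T)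
    (adv : ProbabilityMeasure (LossTable n T)) {r δ : ℝ} (hδ : 0 ≤ δ)
    (h : ∀ ℓ : LossTable n T, A.seedLaw.real {ω | r < regret ℓ (A.play ℓ ω)} ≤ δ) :
    (A.gameLaw adv).real {q | r < regret q.1 (A.play q.1 q.2)} ≤ δ := by
  have hm : MeasurableSet {q : LossTable n T × A.Seed | r < regret q.1 (A.play q.1 q.2)} :=
    measurableSet_lt measurable_const A.measurable_regret
  refine ENNReal.toReal_le_of_le_ofReal hδ ?_
  rw [PFEAlgorithm.gameLaw, Measure.prod_apply hm]
  calc _ ≤ ∫⁻ _ : LossTable n T, ENNReal.ofReal δ ∂(adv : Measure (LossTable n T)) := by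
        refine lintegral_mono fun ℓ => ?_
        refine (ENNReal.le_ofReal_iff_toReal_le (measure_ne_top _ _) hδ).2 (h ℓ)
    _ = _ := by simp

end Regret

namespace FPLParams
variable (p : FPLParams)

lemma lead_lt (hn : 0 < p.n) (ω : ℕ → unitInterval) (x : ℕ → ℕ → ℝ) (t : ℕ) :
    (p.state ω x t).lead < p.n ∧ (p.state ω x t).out < p.n := by
  induction t with
  | zero => exact ⟨leader_lt _ hn, leader_lt _ hn⟩
  | succ t ih =>
    have h1 : (p.state ω x (t + 1)).lead < p.n := by
      rw [state_lead_succ, restart]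
      split_ifs <;> exact leader_lt _ hn
    refine ⟨h1, ?_⟩
    rw [state_lead_succ] at h1
    rw [state, step, commit]
    split_ifs
    · exact h1
    · rw [restart_out]; exact ih.2

/-! ### Measurability of the algorithm -/

/-- All components of the state are measurable. -/
structure MeasurableState {Ω : Type*} [MeasurableSpace Ω] (f : Ω → FPLState) : Prop where
  score : ∀ i, Measurable fun ω => (f ω).score i
  elapsed : Measurable fun ω => (f ω).elapsed
  changes : Measurable fun ω => (f ω).changes
  lead : Measurable fun ω => (f ω).lead
  out : Measurable fun ω => (f ω).out
  used : Measurable fun ω => (f ω).used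
  coins : Measurable fun ω => (f ω).coins

variable {p} {Ω : Type*} [MeasurableSpace Ω]

lemma MeasurableState.ite {f g : Ω → FPLState} (hf : MeasurableState f) (hg : MeasurableState g)
    {P : Ω → Prop} [DecidablePred P] (hP : MeasurableSet {ω | P ω}) :
    MeasurableState fun ω => if P ω then f ω else g ω := by
  refine ⟨fun i => ?_, ?_, ?_, ?_, ?_, ?_, ?_⟩
  · simpa only [apply_ite FPLState.score, ite_apply] using
      Measurable.ite hP (hf.score i) (hg.score i)
  · simpa only [apply_ite FPLState.elapsed] using Measurable.ite hP hf.elapsed hg.elapsed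
  · simpa only [apply_ite FPLState.changes] using Measurable.ite hP hf.changes hg.changes
  · simpa only [apply_ite FPLState.lead] using Measurable.ite hP hf.lead hg.lead
  · simpa only [apply_ite FPLState.out] using Measurable.ite hP hf.out hg.out
  · simpa only [apply_ite FPLState.used] using Measurable.ite hP hf.used hg.used
  · simpa only [apply_ite FPLState.coins] using Measurable.ite hP hf.coins hg.coins

lemma MeasurableState.redraw {f : Ω → FPLState} (hf : MeasurableState f)
    {w : Ω → ℕ → unitInterval} (hw : Measurable w) :
    MeasurableState fun ω => p.redraw (w ω) (f ω) := by
  have h : ∀ i, Measurable fun ω => p.perturbation (w ω) (f ω).coins i := by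
    intro i
    have : Measurable fun ω => w ω ((f ω).coins + i) :=
      Measurable.apply_nat (fun i => (measurable_pi_apply i).comp hw) (hf.coins.add_const i)
    exact (((measurable_subtype_coe.comp this).const_mul _).const_add 1).log.const_mul _
  exact ⟨h, measurable_const, measurable_const, Measurable.leader h _, hf.out, hf.used,
    hf.coins.add_const _⟩

lemma MeasurableState.advance {f : Ω → FPLState} (hf : MeasurableState f) {x : Ω → ℕ → ℝ}
    (hx : ∀ i, Measurable fun ω => x ω i) : MeasurableState fun ω => p.advance (x ω) (f ω) := by
  have h : ∀ i, Measurable fun ω => (f ω).score i + x ω i := fun i => (hf.score i).add (hx i)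
  exact ⟨h, hf.elapsed.add_const _, hf.changes.add ((Measurable.leader h _).ite_eq_nat hf.lead),
    Measurable.leader h _, hf.out, hf.used, hf.coins⟩

lemma MeasurableState.state {w : Ω → ℕ → unitInterval} (hw : Measurable w) {x : Ω → ℕ → ℕ → ℝ}
    (hx : ∀ r i, Measurable fun ω => x ω r i) (t : ℕ) :
    MeasurableState fun ω => p.state (w ω) (x ω) t := by
  classical
  induction t with
  | zero =>
    have h : MeasurableState fun _ : Ω => (⟨0, 0, 0, 0, 0, 0, 0⟩ : FPLState) :=
      ⟨fun _ => measurable_const, measurable_const, measurable_const, measurable_const,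
        measurable_const, measurable_const, measurable_const⟩
    obtain ⟨h1, h2, h3, h4, h5, h6, h7⟩ := h.redraw (p := p) hw
    exact ⟨h1, h2, h3, h4, h4, h6, h7⟩
  | succ t ih =>
    have h1 := ih.advance (p := p) (hx t)
    have h2 : MeasurableState fun ω => p.restart (w ω) (p.advance (x ω t) (p.state (w ω) (x ω) t)) := by
      refine (h1.redraw hw).ite h1 ?_
      have : Measurable fun ω => ((p.advance (x ω t) (p.state (w ω) (x ω) t)).elapsed,
        (p.advance (x ω t) (p.state (w ω) (x ω) t)).changes) := h1.elapsed.prodMk h1.changes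
      exact this (MeasurableSet.of_discrete (s := {q : ℕ × ℕ | p.Expired q.1 q.2}))
    have h3 : MeasurableState fun ω =>
        { p.restart (w ω) (p.advance (x ω t) (p.state (w ω) (x ω) t)) with
          out := (p.restart (w ω) (p.advance (x ω t) (p.state (w ω) (x ω) t))).lead
          used := (p.restart (w ω) (p.advance (x ω t) (p.state (w ω) (x ω) t))).used + 1 } :=
      ⟨h2.1, h2.2, h2.3, h2.4, h2.4, h2.6.add_const _, h2.7⟩
    exact h3.ite h2 ((measurableSet_eq_fun h2.4 h2.5).compl.inter
      (measurableSet_le (h2.6.add_const 1) measurable_const))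

end FPLParams

lemma lossFun_mem {n m : ℕ} (ℓ : Fin m → Fin n → unitInterval) (t i : ℕ) :
    0 ≤ lossFun ℓ t i ∧ lossFun ℓ t i ≤ 1 := by
  unfold lossFun
  split_ifs with h
  · exact ⟨(ℓ _ _).2.1, (ℓ _ _).2.2⟩
  · simp

/-- The algorithm as an algorithm for prediction from experts. -/
noncomputable def fplAlgorithm (p : FPLParams) (hn : 0 < p.n) : PFEAlgorithm p.n p.horizon where
  Seed := ℕ → unitInterval
  seedLaw := coinLaw
  action t past ω := ⟨(p.state ω (lossFun past) t).out, (p.lead_lt hn _ _ _).2⟩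
  measurable_action t := by
    have hx : ∀ r i, Measurable fun q : (Fin t → Fin p.n → unitInterval) × (ℕ → unitInterval) =>
        lossFun q.1 r i := by
      intro r i
      unfold lossFun
      split_ifs <;> fun_prop
    refine measurable_to_countable' fun i => ?_
    have h := (FPLParams.MeasurableState.state (p := p) measurable_snd hx t).out
      (measurableSet_singleton (i : ℕ))
    convert h using 1
    ext q
    simp [Fin.ext_iff]

/-- The algorithm sees only the past losses, padded with zeros; the state at time `t` does not read
the others. -/
lemma fplAlgorithm_play (p : FPLParams) (hn : 0 < p.n) (ℓ : LossTable p.n p.horizon)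
    (ω : ℕ → unitInterval) (t : Fin p.horizon) :
    ((fplAlgorithm p hn).play ℓ ω t : ℕ) = (p.state ω (lossFun ℓ) t).out := by
  change (p.state ω (lossFun fun s : Fin t => ℓ ⟨s, s.isLt.trans t.isLt⟩) t).out = _
  rw [p.state_congr ω (y := lossFun ℓ)]
  intro r hr
  funext i
  have : r < p.horizon := hr.trans t.isLt
  simp [lossFun, hr, this]

lemma fplAlgorithm_hasBudget (p : FPLParams) (hn : 0 < p.n) :
    (fplAlgorithm p hn).HasBudget p.budget := by
  intro ℓ ω
  refine le_trans ?_ (p.changeCount_out ω (lossFun ℓ) p.horizon).2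
  rw [← (p.changeCount_out ω (lossFun ℓ) p.horizon).1, switches, Finset.card_filter, changeCount,
    Finset.sum_range]
  -- The comparison is termwise only an inequality: `changeCount` has one more term, at the last
  -- iteration, which is never a switch.
  refine Finset.sum_le_sum fun t _ => ?_
  split_ifs with h1 h2
  · obtain ⟨h, h3⟩ := h1
    refine absurd (Fin.ext ?_) h3
    exact ((fplAlgorithm_play p hn ℓ ω _).trans h2).trans (fplAlgorithm_play p hn ℓ ω t).symm
  all_goals simp

lemma fplAlgorithm_implements (p : FPLParams) (hn : 0 < p.n) {θ : ℝ}
    {scale rate threshold : RealExp}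
    (hscale : scale.ConstOn ((inputStore p.n p.horizon p.budget θ).nat 0)
      ((inputStore p.n p.horizon p.budget θ).real 0) p.scale)
    (hrate : rate.ConstOn ((inputStore p.n p.horizon p.budget θ).nat 0)
      ((inputStore p.n p.horizon p.budget θ).real 0) p.rate)
    (hthr : threshold.ConstOn ((inputStore p.n p.horizon p.budget θ).nat 0)
      ((inputStore p.n p.horizon p.budget θ).real 0) p.threshold) {N : ℕ}
    (hN : ∀ (ℓ : LossTable p.n p.horizon) (coins : ℕ → unitInterval),
      ((fplProgram scale rate threshold).exec p.budget θ ℓ coins p.horizon).steps ≤ N) :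
    (fplProgram scale rate threshold).Implements p.budget θ (fplAlgorithm p hn) N := by
  refine ⟨⟨id, MeasurePreserving.id _, fun ℓ ω t => ?_⟩, hN⟩
  exact (fplAlgorithm_play p hn ℓ ω t).trans
    (fplProgram_exec p rfl hscale hrate hthr ℓ ω t t.isLt.le).out.symm

/-! ## The upper bounds -/

/-- The parameters for a failure probability of `exp (-r)`, in the regime of `c`. -/
noncomputable def highSwitchingParams (c r : ℝ) (n T S : ℕ) : FPLParams where
  n := n
  budget := S
  horizon := T
  scale := 384 * √((T : ℝ) * Real.log n) / (c * Real.log n)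
  rate := r
  threshold := c * √((T : ℝ) * Real.log n) / (12 * r)

lemma log_two_ge : (2 : ℝ) / 3 ≤ Real.log 2 := by
  have := Real.log_two_gt_d9; linarith

lemma two_thirds_le_log {n : ℕ} (hn : 2 ≤ n) : (2 : ℝ) / 3 ≤ Real.log n :=
  log_two_ge.trans (Real.log_le_log (by norm_num) (by exact_mod_cast hn))

/-- The algorithm for a failure probability of `exp (-r)`, in the regime of `c`. -/
noncomputable def highSwitchingAlgorithm (c r : ℝ) (n T S : ℕ) (hn : 0 < n) : PFEAlgorithm n T :=
  fplAlgorithm (highSwitchingParams c r n T S) hn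

/-- The parameters balance three needs. The product `scale * threshold` is `32 * T / r`, enough for
the Markov bound; `6 * r` epochs use half the allowance `c * √(T log n)` through the thresholds; and
the perturbations stay of order `√(T log n) / c`. -/
lemma measure_lt_regret_le {c r : ℝ} (hc : 0 < c) (hr : 2 / 3 ≤ r) {n T S : ℕ}
    (hS : HighSwitching c n T S) (hn : 0 < n) (ℓ : LossTable n T) :
    (highSwitchingAlgorithm c r n T S hn).seedLaw.real
      {ω | (4608 / c + 2 * c) * (√((T : ℝ) * Real.log n) * r) <
        regret ℓ ((highSwitchingAlgorithm c r n T S hn).play ℓ ω)} ≤ Real.exp (-r) := by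
  obtain ⟨hn2, hS1, hST, hcS⟩ := hS
  have : NeZero n := ⟨hn.ne'⟩
  have hL := two_thirds_le_log hn2
  have hT1 : (1 : ℝ) ≤ T := by exact_mod_cast hS1.trans hST
  have hST' : (S : ℝ) ≤ T := by exact_mod_cast hST
  set L := Real.log n with hLdef
  set H := √((T : ℝ) * L) with hH
  have hHsq : H * H = T * L := Real.mul_self_sqrt (by positivity)
  have hH0 : 0 < H := Real.sqrt_pos.2 (by positivity)
  have hr0 : 0 < r := by linarith
  -- For such large `r` the claimed bound exceeds `T`, so it is trivial. Otherwise `6 * r`, the `+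
  -- 1` terms of all epochs together, fits into the other half of the allowance.
  by_cases htriv : c * H < 12 * r
  · have hempty : {ω | (4608 / c + 2 * c) * (H * r) <
        regret ℓ ((highSwitchingAlgorithm c r n T S hn).play ℓ ω)} = ∅ := by
      ext ω
      simp only [Set.mem_ofPred_eq, Set.mem_empty_iff_false, iff_false, not_lt]
      refine (regret_le_card ℓ _).trans ?_
      have h1 : c * (T * (2 / 3)) ≤ 12 * (H * r) := by
        calc c * (T * (2 / 3)) ≤ c * (T * L) := by gcongr
          _ = H * (c * H) := by rw [← hHsq]; ring
          _ ≤ H * (12 * r) := by gcongr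
          _ = _ := by ring
      have h2 : (T : ℝ) ≤ 18 / c * (H * r) := by
        rw [div_mul_eq_mul_div, le_div_iff₀ hc]; linarith
      refine h2.trans ?_
      gcongr
      have : 18 / c ≤ 4608 / c := by gcongr; norm_num
      linarith
    rw [hempty]
    simp [(Real.exp_pos _).le]
  · push Not at htriv
    set p := highSwitchingParams c r n T S with hp
    have hs : 0 < p.scale := by
      simp only [hp, highSwitchingParams]; positivity
    have hthr : 0 < p.threshold := by
      simp only [hp, highSwitchingParams]; positivity
    have hq : 16 * ((p.horizon : ℝ) / p.rate + 1) ≤ p.scale * p.threshold := by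
      have e : p.scale * p.threshold = 32 * (T / r) := by
        simp only [hp, highSwitchingParams]
        rw [← hLdef, ← hH]
        field_simp
        nlinarith
      rw [e]
      have : 1 ≤ (T : ℝ) / r := by rw [le_div_iff₀ hr0]; nlinarith
      change 16 * ((T : ℝ) / r + 1) ≤ _
      linarith
    -- Then `8 ^ r / 4 ^ J ≤ 8 ^ (-r) ≤ exp (-r)`, and `r ≥ 2 / 3` gives `J + 1 ≤ 6 * r`.
    set J := ⌈3 * r⌉₊ with hJ
    have hJ1 : 3 * r ≤ J := Nat.le_ceil _
    have hJ2 : (J : ℝ) < 3 * r + 1 := Nat.ceil_lt_add_one (by positivity)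
    have hJ3 : (J : ℝ) + 1 ≤ 6 * r := by linarith
    have hx : ∀ t, ∀ i < p.n, 0 ≤ lossFun ℓ t i ∧ lossFun ℓ t i ≤ 1 := fun t i _ => lossFun_mem ℓ t i
    have hprob := FPLParams.measure_epochStart_lt_le (p := p) hn hs hthr hr0
      (show 0 < T by omega) hx hq J
    have hsub : {ω | (4608 / c + 2 * c) * (H * r) <
        regret ℓ ((highSwitchingAlgorithm c r n T S hn).play ℓ ω)} ⊆ {ω : ℕ → unitInterval | p.epochStart ω (lossFun ℓ) J < p.horizon} := by
      intro ω hω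
      change p.epochStart ω (lossFun ℓ) J < p.horizon
      change (4608 / c + 2 * c) * (H * r) < _ at hω
      by_contra! hJT
      refine absurd hω (not_lt.2 ?_)
      have hspread : p.spread ≤ 768 * H / c := by
        have h1 : Real.log (1 + n) ≤ 2 * L := by
          rw [hLdef, ← Real.log_rpow (by positivity)]
          refine Real.log_le_log (by positivity) ?_
          have : (2 : ℝ) ≤ n := by exact_mod_cast hn2
          norm_cast
          nlinarith
        calc p.spread = 384 * H / (c * L) * Real.log (1 + n) := rfl
          _ ≤ 384 * H / (c * L) * (2 * L) := by gcongr
          _ = _ := by field_simp; norm_num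
      have hthr' : p.threshold = c * H / (12 * r) := rfl
      have hthr6 : 6 * r * p.threshold = c * H / 2 := by rw [hthr']; field_simp; norm_num
      have hbudget : (J + 1 : ℝ) * (p.threshold + 1) ≤ p.budget := by
        calc (J + 1 : ℝ) * (p.threshold + 1) ≤ 6 * r * (p.threshold + 1) := by gcongr
          _ = c * H / 2 + 6 * r := by rw [mul_add, hthr6, mul_one]
          _ ≤ c * H := by linarith
          _ ≤ S := hcS
      have hsp0 : 0 ≤ p.spread := (FPLParams.perturbation_mem ω hs.le 0 0).1.trans
        (FPLParams.perturbation_mem ω hs.le 0 0).2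
      have hbound : (J + 1 : ℝ) * (p.spread + p.threshold + 1) ≤ (4608 / c + 2 * c) * (H * r) := by
        calc (J + 1 : ℝ) * (p.spread + p.threshold + 1)
            ≤ 6 * r * (768 * H / c + p.threshold + 1) := by gcongr
          _ = 4608 / c * (H * r) + c * H / 2 + 6 * r := by
            rw [mul_add, mul_add, hthr6]; ring
          _ ≤ 4608 / c * (H * r) + 2 * c * (H * r) := by
            have : c * H * (2 / 3) ≤ c * H * r := by gcongr
            nlinarith
          _ = _ := by ring
      have hloss := fun j : Fin n => FPLParams.loss_le (p := p) ω (lossFun ℓ) hn hs.le hr0 hthr hx hJT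
        hbudget (i := j) j.isLt
      have e1 : ∑ t : Fin T, (ℓ t ((highSwitchingAlgorithm c r n T S hn).play ℓ ω t) : ℝ) =
          ∑ t ∈ Finset.range T, lossFun ℓ t (p.state ω (lossFun ℓ) t).out := by
        rw [Finset.sum_range]
        refine Finset.sum_congr rfl fun t _ => ?_
        have h2 := (p.lead_lt hn ω (lossFun ℓ) t).2
        have h3 : (t : ℕ) < T ∧ (p.state ω (lossFun ℓ) t).out < n := ⟨t.isLt, h2⟩
        rw [lossFun, dif_pos h3]
        exact congrArg (fun i : Fin n => ((ℓ t i : unitInterval) : ℝ))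
          (Fin.ext (fplAlgorithm_play p hn ℓ ω t))
      have e2 : ∀ j : Fin n, ∑ t : Fin T, (ℓ t j : ℝ) = ∑ t ∈ Finset.range T, lossFun ℓ t j := by
        intro j
        rw [Finset.sum_range]
        refine Finset.sum_congr rfl fun t _ => ?_
        simp [lossFun]
      unfold regret
      rw [e1, sub_le_iff_le_add', ← sub_le_iff_le_add]
      refine le_ciInf fun j => ?_
      rw [e2 j]
      have h4 := hloss j
      change ∑ r ∈ Finset.range T, _ ≤ ∑ r ∈ Finset.range T, _ + _ at h4
      linarith
    refine (measureReal_mono (μ := coinLaw) hsub (measure_ne_top coinLaw _)).trans (hprob.trans ?_)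
    have h8 : Real.log 8 = 3 * Real.log 2 := by
      rw [show (8 : ℝ) = 2 ^ 3 by norm_num, Real.log_pow]; norm_num
    have h4 : (4 : ℝ) ^ J = Real.exp (J * (2 * Real.log 2)) := by
      rw [show 2 * Real.log 2 = Real.log 4 by
        rw [show (4 : ℝ) = 2 ^ 2 by norm_num, Real.log_pow]; norm_num]
      rw [mul_comm, Real.exp_mul, Real.exp_log (by norm_num), Real.rpow_natCast]
    rw [h4, ← Real.exp_sub, Real.exp_le_exp, h8]
    change 3 * Real.log 2 * r - J * (2 * Real.log 2) ≤ -r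
    have := log_two_ge
    nlinarith

/-! ### The programs -/

/-- The expression for `√(T log n)`. -/
def rootExp : RealExp :=
  .sqrt (.mul (.ofNat (.cell 0 (.lit 1))) (.log (.ofNat sizeExp)))

def highSwitchingProgram (q : ℚ) (rate : RealExp) : Program :=
  fplProgram (.div (.mul (.lit 384) rootExp) (.mul (.lit q) (.log (.ofNat sizeExp)))) rate
    (.div (.mul (.lit q) rootExp) (.mul (.lit 12) rate))

lemma highSwitchingProgram_implements (q : ℚ) {rate : RealExp} {r θ : ℝ} {n T S : ℕ} (hn : 0 < n)
    (hrate : rate.ConstOn ((inputStore n T S θ).nat 0) ((inputStore n T S θ).real 0) r) {N : ℕ}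
    (hN : ∀ (ℓ : LossTable n T) (coins : ℕ → unitInterval),
      ((highSwitchingProgram q rate).exec S θ ℓ coins T).steps ≤ N) :
    (highSwitchingProgram q rate).Implements S θ
      (highSwitchingAlgorithm q r n T S hn) N := by
  refine fplAlgorithm_implements (highSwitchingParams q r n T S) hn ?_ hrate ?_ hN
  · intro σ h1 h2
    simp [RealExp.eval, NatExp.eval, rootExp, h1, inputStore, highSwitchingParams]
  · intro σ h1 h2
    have h3 : rate.eval σ = r := hrate σ h1 h2
    simp [RealExp.eval, NatExp.eval, rootExp, h1, h3, inputStore, highSwitchingParams]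

lemma HighSwitching.mono {c c' : ℝ} (h : c' ≤ c) {n T S : ℕ} (hS : HighSwitching c n T S) :
    HighSwitching c' n T S :=
  ⟨hS.1, hS.2.1, hS.2.2.1,
    (mul_le_mul_of_nonneg_right h (Real.sqrt_nonneg _)).trans hS.2.2.2⟩

theorem upper_bound_probability (c : ℝ) (hc : 0 < c) :
    ∃ (C : ℝ) (k : ℕ) (P : RealRAM.Program), 0 < C ∧
      ∀ n T S : ℕ, HighSwitching c n T S → ∀ δ : ℝ, 0 < δ → δ < 1 / 2 →
        ∃ A : PFEAlgorithm n T, A.HasBudget S ∧ P.Implements S δ A (k * (n + T) ^ k) ∧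
          ∀ adv : ProbabilityMeasure (LossTable n T),
            1 - δ ≤ A.probRegretLE adv (C * (√((T : ℝ) * Real.log n) * Real.log (1 / δ))) := by
  -- Literals of programs are rational, so `c` is replaced by a smaller rational, which only weakens
  -- the assumption on the budget.
  obtain ⟨q, hq0, hqc⟩ := exists_rat_btwn hc
  let e : RealExp := .log (.div (.lit 1) (.cell 0 (.lit 0)))
  obtain ⟨ht1, ht2⟩ := fplProgram_tame
    (.div (.mul (.lit 384) rootExp) (.mul (.lit q) (.log (.ofNat sizeExp)))) e
    (.div (.mul (.lit q) rootExp) (.mul (.lit 12) e))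
  obtain ⟨k, hk⟩ := (highSwitchingProgram q e).exists_steps_le ht1 ht2
  refine ⟨4608 / q + 2 * q, k, highSwitchingProgram q e, by positivity, ?_⟩
  intro n T S hS δ hδ hδ2
  have hS' := hS.mono hqc.le
  have hn : 0 < n := by have := hS.1; omega
  have hlog : 2 / 3 ≤ Real.log (1 / δ) := by
    refine log_two_ge.trans (Real.log_le_log (by norm_num) ?_)
    rw [le_div_iff₀ hδ]; linarith
  refine ⟨highSwitchingAlgorithm q (Real.log (1 / δ)) n T S hn,
    fplAlgorithm_hasBudget _ _, highSwitchingProgram_implements q hn ?_ fun ℓ coins =>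
      hk n T S hn δ ℓ coins, fun adv => ?_⟩
  · intro σ h1 h2
    simp [e, RealExp.eval, NatExp.eval, h2, inputStore]
  · set A := highSwitchingAlgorithm q (Real.log (1 / δ)) n T S hn
    have h := A.gameLaw_lt_regret_le adv
      (r := (4608 / q + 2 * q) * (√((T : ℝ) * Real.log n) * Real.log (1 / δ))) hδ.le fun ℓ => by
        refine (measure_lt_regret_le (by exact_mod_cast hq0) hlog hS' hn ℓ).trans ?_
        rw [one_div, Real.log_inv, neg_neg, Real.exp_log hδ]
    have hm : MeasurableSet {p : LossTable n T × A.Seed | regret p.1 (A.play p.1 p.2) ≤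
        (4608 / q + 2 * q) * (√((T : ℝ) * Real.log n) * Real.log (1 / δ))} :=
      measurableSet_le A.measurable_regret measurable_const
    have h2 := probReal_compl_eq_one_sub (μ := A.gameLaw adv) hm
    have h3 : {p : LossTable n T × A.Seed | regret p.1 (A.play p.1 p.2) ≤
        (4608 / q + 2 * q) * (√((T : ℝ) * Real.log n) * Real.log (1 / δ))}ᶜ =
        {p | (4608 / q + 2 * q) * (√((T : ℝ) * Real.log n) * Real.log (1 / δ)) <
          regret p.1 (A.play p.1 p.2)} := by
      ext p; simp
    rw [h3] at h2
    unfold PFEAlgorithm.probRegretLE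
    linarith

/-- With failure probability `1 / T`, the failures contribute at most `T * (1 / T) = 1` to the
expectation; this is absorbed by the main term. -/
theorem upper_bound_expectation (c : ℝ) (hc : 0 < c) :
    ∃ (C : ℝ) (k : ℕ) (P : RealRAM.Program), 0 < C ∧
      ∀ n T S : ℕ, HighSwitching c n T S → 2 ≤ T →
        ∃ A : PFEAlgorithm n T, A.HasBudget S ∧ P.Implements S 0 A (k * (n + T) ^ k) ∧
          ∀ adv : ProbabilityMeasure (LossTable n T),
            A.expectedRegret adv ≤ C * (√((T : ℝ) * Real.log n) * Real.log T) := by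
  obtain ⟨q, hq0, hqc⟩ := exists_rat_btwn hc
  let e : RealExp := .log (.ofNat (.cell 0 (.lit 1)))
  obtain ⟨ht1, ht2⟩ := fplProgram_tame
    (.div (.mul (.lit 384) rootExp) (.mul (.lit q) (.log (.ofNat sizeExp)))) e
    (.div (.mul (.lit q) rootExp) (.mul (.lit 12) e))
  obtain ⟨k, hk⟩ := (highSwitchingProgram q e).exists_steps_le ht1 ht2
  refine ⟨4608 / q + 2 * q + 2, k, highSwitchingProgram q e, by positivity, ?_⟩
  intro n T S hS hT
  have hS' := hS.mono hqc.le
  have hn : 0 < n := by have := hS.1; omega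
  have : NeZero n := ⟨hn.ne'⟩
  have hlogT := two_thirds_le_log hT
  have hT0 : (2 : ℝ) ≤ T := by exact_mod_cast hT
  refine ⟨highSwitchingAlgorithm q (Real.log T) n T S hn,
    fplAlgorithm_hasBudget _ _, highSwitchingProgram_implements q hn ?_ fun ℓ coins =>
      hk n T S hn 0 ℓ coins, fun adv => ?_⟩
  · intro σ h1 h2
    simp [e, RealExp.eval, NatExp.eval, h1, inputStore]
  · set A := highSwitchingAlgorithm q (Real.log T) n T S hn
    set b := (4608 / q + 2 * q) * (√((T : ℝ) * Real.log n) * Real.log T) with hb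
    have hb0 : 0 ≤ b := by positivity
    have h := A.gameLaw_lt_regret_le adv (r := b) (δ := (T : ℝ)⁻¹) (by positivity) fun ℓ => by
        refine (measure_lt_regret_le (by exact_mod_cast hq0) hlogT hS' hn ℓ).trans ?_
        rw [Real.exp_neg, Real.exp_log (by linarith)]
    have hm : MeasurableSet {p : LossTable n T × A.Seed | b < regret p.1 (A.play p.1 p.2)} :=
      measurableSet_lt measurable_const A.measurable_regret
    have h1 : A.expectedRegret adv ≤ b + T * (A.gameLaw adv).real
        {p | b < regret p.1 (A.play p.1 p.2)} := by
      calc A.expectedRegret adv ≤ ∫ p, (b + Set.indicator {p : LossTable n T × A.Seed |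
            b < regret p.1 (A.play p.1 p.2)} (fun _ => (T : ℝ)) p) ∂(A.gameLaw adv) := by
            refine integral_mono (A.integrable_regret adv)
              ((integrable_const _).add ((integrable_const _).indicator hm)) fun p => ?_
            by_cases hp : b < regret p.1 (A.play p.1 p.2)
            · simp only [Set.indicator, Set.mem_ofPred_eq, hp, if_true]
              linarith [regret_le_card p.1 (A.play p.1 p.2)]
            · simp only [Set.indicator, Set.mem_ofPred_eq, hp, if_false]
              linarith
        _ = _ := by
            rw [integral_add (integrable_const _) ((integrable_const _).indicator hm),
              integral_indicator_const _ hm]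
            simp [mul_comm]
    have h2 : (T : ℝ) * (A.gameLaw adv).real {p | b < regret p.1 (A.play p.1 p.2)} ≤ 1 := by
      calc _ ≤ (T : ℝ) * (T : ℝ)⁻¹ := by gcongr
        _ = 1 := mul_inv_cancel₀ (by positivity)
    have h3 : 1 ≤ √((T : ℝ) * Real.log n) := by
      rw [Real.one_le_sqrt]
      nlinarith [two_thirds_le_log hS.1]
    have h4 : 1 ≤ 2 * (√((T : ℝ) * Real.log n) * Real.log T) := by nlinarith
    rw [add_mul]
    linarith

end

section
open scoped BigOperators

/-! ## Uniform distributions on finite types -/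

section Average
variable {Ω : Type*} [Fintype Ω]

open Classical in
/-- The probability of an event under the uniform distribution. -/
noncomputable def freq (p : Ω → Prop) : ℝ := 𝔼 ω, if p ω then (1 : ℝ) else 0

lemma freq_eq_expect (p : Ω → Prop) [DecidablePred p] :
    freq p = 𝔼 ω, if p ω then (1 : ℝ) else 0 := by
  unfold freq
  exact Finset.expect_congr rfl fun ω _ => by split_ifs <;> rfl

lemma freq_nonneg (p : Ω → Prop) : 0 ≤ freq p :=
  Finset.expect_nonneg fun ω _ => by split_ifs <;> simp

lemma freq_mono {p q : Ω → Prop} (h : ∀ ω, p ω → q ω) : freq p ≤ freq q := by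
  classical
  refine Finset.expect_le_expect fun ω _ => ?_
  by_cases hp : p ω
  · simp [hp, h ω hp]
  · simp only [hp, if_false]; split_ifs <;> simp

lemma freq_congr {p q : Ω → Prop} (h : ∀ ω, p ω ↔ q ω) : freq p = freq q :=
  congrArg freq (funext fun ω => propext (h ω))

lemma freq_or_le (p q : Ω → Prop) : freq (fun ω => p ω ∨ q ω) ≤ freq p + freq q := by
  classical
  unfold freq
  rw [← Finset.expect_add_distrib]
  refine Finset.expect_le_expect fun ω _ => ?_
  by_cases hp : p ω <;> by_cases hq : q ω <;> simp [hp, hq]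

lemma freq_le_one (p : Ω → Prop) : freq p ≤ 1 := by
  classical
  cases isEmpty_or_nonempty Ω
  · simp [freq]
  · calc freq p ≤ 𝔼 _ω : Ω, (1 : ℝ) := Finset.expect_le_expect fun ω _ => by split_ifs <;> simp
      _ = 1 := Fintype.expect_const _

lemma freq_not [Nonempty Ω] (p : Ω → Prop) : freq (fun ω => ¬ p ω) = 1 - freq p := by
  classical
  rw [eq_sub_iff_add_eq]
  unfold freq
  rw [← Finset.expect_add_distrib]
  calc _ = 𝔼 _ω : Ω, (1 : ℝ) := Finset.expect_congr rfl fun ω _ => by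
        by_cases hp : p ω <;> simp [hp]
    _ = 1 := Fintype.expect_const _

lemma freq_comp_equiv {Ω' : Type*} [Fintype Ω'] (e : Ω ≃ Ω') (p : Ω' → Prop) :
    freq (fun ω => p (e ω)) = freq p :=
  Fintype.expect_equiv e _ _ fun _ => rfl

lemma freq_or_of_disjoint {p q : Ω → Prop} (h : ∀ ω, p ω → ¬ q ω) :
    freq (fun ω => p ω ∨ q ω) = freq p + freq q := by
  classical
  unfold freq
  rw [← Finset.expect_add_distrib]
  refine Finset.expect_congr rfl fun ω _ => ?_
  by_cases hp : p ω
  · simp [hp, h ω hp]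
  · simp [hp]

lemma mul_freq_le_expect {f : Ω → ℝ} (hf : ∀ ω, 0 ≤ f ω) (a : ℝ) :
    a * freq (fun ω => a ≤ f ω) ≤ 𝔼 ω, f ω := by
  classical
  unfold freq
  rw [Finset.mul_expect]
  refine Finset.expect_le_expect fun ω _ => ?_
  split_ifs with h
  · simpa using h
  · simpa using hf ω

/-- Chebyshev's inequality. -/
lemma freq_abs_ge_le {f : Ω → ℝ} {a : ℝ} (ha : 0 < a) :
    freq (fun ω => a ≤ |f ω|) ≤ (𝔼 ω, f ω ^ 2) / a ^ 2 := by
  rw [le_div_iff₀ (by positivity), mul_comm]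
  refine le_trans (le_of_eq ?_) (mul_freq_le_expect (fun ω => sq_nonneg (f ω)) (a ^ 2))
  congr 1
  refine freq_congr fun ω => ?_
  rw [← sq_abs (f ω)]
  exact (pow_le_pow_iff_left₀ ha.le (abs_nonneg _) two_ne_zero).symm

end Average

section Resample
variable {ι G : Type*} [Fintype ι] [DecidableEq ι] [Fintype G]

/-- The coordinates in `s` and the other coordinates are independent. -/
lemma expect_resample [Nonempty G] (s : Finset ι) (F : (ι → G) → ℝ) :
    𝔼 ω, F ω = 𝔼 ω, 𝔼 ω', F (s.piecewise ω ω') := by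
  -- Exchanging the coordinates outside `s` between two independent copies is an involution, so it
  -- preserves the uniform law.
  let σ : (ι → G) × (ι → G) → (ι → G) × (ι → G) :=
    fun q => (s.piecewise q.1 q.2, s.piecewise q.2 q.1)
  have hσ : Function.Involutive σ := by
    rintro ⟨a, b⟩
    refine Prod.ext ?_ ?_ <;> funext i <;> by_cases hi : i ∈ s <;> simp [σ, hi]
  calc 𝔼 ω, F ω = 𝔼 q : (ι → G) × (ι → G), F q.1 := by
        rw [← Finset.univ_product_univ, Finset.expect_product]
        simp
    _ = 𝔼 q : (ι → G) × (ι → G), F (s.piecewise q.1 q.2) :=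
        (Fintype.expect_bijective σ hσ.bijective _ _ fun _ => rfl).symm
    _ = _ := by rw [← Finset.univ_product_univ, Finset.expect_product]

lemma expect_mul_of_dependsOn [Nonempty G] (s : Finset ι) {f g : (ι → G) → ℝ}
    (hf : ∀ ω ω', (∀ i ∈ s, ω i = ω' i) → f ω = f ω')
    (hg : ∀ ω ω', (∀ i, i ∉ s → ω i = ω' i) → g ω = g ω') :
    𝔼 ω, f ω * g ω = (𝔼 ω, f ω) * 𝔼 ω, g ω := by
  rw [expect_resample s, Fintype.expect_mul_expect]
  refine Finset.expect_congr rfl fun ω _ => Finset.expect_congr rfl fun ω' _ => ?_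
  rw [hf _ ω fun i hi => by simp [hi], hg _ ω' fun i hi => by simp [hi]]

/-- A coordinate is uniformly distributed. -/
lemma expect_apply [Nonempty G] (i : ι) (f : G → ℝ) : 𝔼 ω : ι → G, f (ω i) = 𝔼 g, f g := by
  calc 𝔼 ω : ι → G, f (ω i) = 𝔼 q : G × ({j // j ≠ i} → G), f q.1 :=
        Fintype.expect_equiv (Equiv.funSplitAt i G) _ _ fun _ => rfl
    _ = _ := by
      rw [← Finset.univ_product_univ, Finset.expect_product]
      simp

end Resample

/-- A relabeling of the outcomes that looks at earlier outcomes only is a bijection. -/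
lemma bijective_of_predictable {ι G : Type*} [Finite ι] [Finite G] (rank : ι → ℕ) (τ : (ι → G) → ι → Equiv.Perm G)
    (hτ : ∀ ω ω' i, (∀ j, rank j < rank i → ω j = ω' j) → τ ω i = τ ω' i) :
    Function.Bijective fun ω : ι → G => fun i => τ ω i (ω i) := by
  refine Finite.injective_iff_bijective.1 fun ω ω' h => ?_
  -- The coordinates can be recovered in the order of rank: once the earlier ones agree, the same
  -- permutation was applied to this one.
  have key : ∀ m i, rank i = m → ω i = ω' i := by
    intro m
    induction m using Nat.strong_induction_on with
    | _ m ih =>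
      intro i hi
      have h1 := congrFun h i
      rw [hτ ω ω' i fun j hj => ih _ (hi ▸ hj) j rfl] at h1
      exact (τ ω' i).injective h1
  exact funext fun i => key _ i rfl

/-! ## Adversaries that draw independent uniform outcomes -/

/-- In the iterations `round x`, an outcome `g` is drawn uniformly from `G` and the loss of the
expert `i` is `(1 + gain (relabel x i g)) / 2`; there are no losses in the other iterations. -/
structure OutcomeGame (n T : ℕ) (ι G : Type) where
  round : ι → Fin T
  round_injective : Function.Injective round
  gain : G → ℝ
  gain_mem : ∀ g, |gain g| ≤ 1
  relabel : ι → Fin n → Equiv.Perm G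

namespace OutcomeGame
variable {n T : ℕ} {ι G : Type} (𝒢 : OutcomeGame n T ι G)

noncomputable def table (ω : ι → G) : LossTable n T :=
  Function.extend 𝒢.round
    (fun x i => ⟨(1 + 𝒢.gain (𝒢.relabel x i (ω x))) / 2, by
      have := abs_le.1 (𝒢.gain_mem (𝒢.relabel x i (ω x)))
      constructor <;> linarith⟩)
    fun _ _ => 0

lemma table_round (ω : ι → G) (x : ι) (i : Fin n) :
    (𝒢.table ω (𝒢.round x) i : ℝ) = (1 + 𝒢.gain (𝒢.relabel x i (ω x))) / 2 := by
  rw [table, 𝒢.round_injective.extend_apply]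

lemma table_congr {ω ω' : ι → G} {t : Fin T} (h : ∀ x, 𝒢.round x = t → ω x = ω' x) :
    𝒢.table ω t = 𝒢.table ω' t := by
  by_cases ht : ∃ x, 𝒢.round x = t
  · obtain ⟨x, rfl⟩ := ht
    funext i
    refine Subtype.ext ?_
    rw [table_round, table_round, h x rfl]
  · rw [table, table, Function.extend_apply' _ _ _ ht, Function.extend_apply' _ _ _ ht]

variable [Fintype ι]

lemma sum_table (ω : ι → G) (a : Fin T → Fin n) :
    ∑ t, (𝒢.table ω t (a t) : ℝ) =
      ∑ x, (1 + 𝒢.gain (𝒢.relabel x (a (𝒢.round x)) (ω x))) / 2 := by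
  classical
  simp_rw [← table_round]
  rw [← Finset.sum_image (f := fun t => (𝒢.table ω t (a t) : ℝ)) (s := Finset.univ)
    𝒢.round_injective.injOn]
  refine (Finset.sum_subset (Finset.subset_univ _) fun t _ ht => ?_).symm
  have : ¬ ∃ x, 𝒢.round x = t := by simpa using ht
  rw [table, Function.extend_apply' _ _ _ this]
  rfl

lemma regret_table_ge (ω : ι → G) (a : Fin T → Fin n) (j : Fin n) :
    (∑ x, 𝒢.gain (𝒢.relabel x (a (𝒢.round x)) (ω x)) - ∑ x, 𝒢.gain (𝒢.relabel x j (ω x))) / 2 ≤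
      regret (𝒢.table ω) a := by
  refine le_trans (le_of_eq ?_) (regret_ge _ _ j)
  rw [sum_table, 𝒢.sum_table ω fun _ => j, ← Finset.sum_sub_distrib, ← Finset.sum_sub_distrib,
    Finset.sum_div]
  exact Finset.sum_congr rfl fun x _ => by ring

variable [Fintype G]

/-- Against every algorithm, the sum of the gains is distributed as for a fixed expert. -/
lemma exists_perm (A : PFEAlgorithm n T) (s : A.Seed) : ∃ Φ : Equiv.Perm (ι → G), ∀ ω j,
    (∑ x, 𝒢.gain (Φ ω x) - ∑ x, 𝒢.gain (𝒢.relabel x j (ω x))) / 2 ≤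
      regret (𝒢.table ω) (A.play (𝒢.table ω) s) := by
  classical
  -- The relabeling in a round is determined by the action played there, hence by the outcomes of
  -- earlier rounds.
  have h := bijective_of_predictable (fun x => (𝒢.round x : ℕ))
    (fun ω x => 𝒢.relabel x (A.play (𝒢.table ω) s (𝒢.round x))) (fun ω ω' x hx => by
      have : A.play (𝒢.table ω) s (𝒢.round x) = A.play (𝒢.table ω') s (𝒢.round x) := by
        unfold PFEAlgorithm.play
        congr 1
        funext r
        exact 𝒢.table_congr fun y hy => hx y (by rw [hy]; exact r.isLt)
      simp only [this])
  exact ⟨Equiv.ofBijective _ h, fun ω j => 𝒢.regret_table_ge ω _ j⟩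

variable [DecidableEq ι] [Nonempty G]

/-- The law of the loss table. -/
noncomputable def adversary : ProbabilityMeasure (LossTable n T) :=
  letI : MeasurableSpace (ι → G) := ⊤
  ⟨(PMF.uniformOfFintype (ι → G)).toMeasure.map 𝒢.table, by
    exact Measure.isProbabilityMeasure_map (measurable_from_top).aemeasurable⟩

lemma integral_adversary {h : LossTable n T → ℝ} (hh : Measurable h) :
    ∫ ℓ, h ℓ ∂(𝒢.adversary : Measure (LossTable n T)) = 𝔼 ω, h (𝒢.table ω) := by
  let : MeasurableSpace (ι → G) := ⊤
  change ∫ ℓ, h ℓ ∂((PMF.uniformOfFintype (ι → G)).toMeasure.map 𝒢.table) = _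
  rw [integral_map (measurable_from_top).aemeasurable hh.aestronglyMeasurable,
    PMF.integral_eq_sum, Fintype.expect_eq_sum_div_card, Finset.sum_div]
  refine Finset.sum_congr rfl fun ω _ => ?_
  simp [div_eq_inv_mul]

lemma integral_gameLaw (A : PFEAlgorithm n T) {h : LossTable n T × A.Seed → ℝ} (hm : Measurable h)
    (hh : Integrable h (A.gameLaw 𝒢.adversary)) :
    ∫ q, h q ∂(A.gameLaw 𝒢.adversary) = ∫ s, 𝔼 ω, h (𝒢.table ω, s) ∂A.seedLaw := by
  unfold PFEAlgorithm.gameLaw at hh ⊢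
  rw [integral_prod_symm _ hh]
  refine integral_congr_ae (Filter.Eventually.of_forall fun s => ?_)
  exact 𝒢.integral_adversary (hm.comp (measurable_id.prodMk measurable_const))

/-- With the seed integrated last, it suffices to treat each seed separately, that is, deterministic
strategies. -/
lemma le_integral_gameLaw (A : PFEAlgorithm n T) {h : LossTable n T × A.Seed → ℝ}
    (hm : Measurable h) (hh : Integrable h (A.gameLaw 𝒢.adversary)) {b : ℝ}
    (hb : ∀ s, b ≤ 𝔼 ω, h (𝒢.table ω, s)) : b ≤ ∫ q, h q ∂(A.gameLaw 𝒢.adversary) := by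
  rw [𝒢.integral_gameLaw A hm hh]
  have hi : Integrable (fun s => 𝔼 ω, h (𝒢.table ω, s)) A.seedLaw := by
    have := hh.integral_prod_right
    refine this.congr (Filter.Eventually.of_forall fun s => ?_)
    exact 𝒢.integral_adversary (hm.comp (measurable_id.prodMk measurable_const))
  calc b = ∫ _, b ∂A.seedLaw := by simp
    _ ≤ _ := integral_mono (integrable_const _) hi hb

theorem le_probRegretGE (A : PFEAlgorithm n T) {r δ : ℝ}
    (h : ∀ Φ : Equiv.Perm (ι → G), δ ≤ freq fun ω => ∃ j,
      2 * r ≤ ∑ x, 𝒢.gain (Φ ω x) - ∑ x, 𝒢.gain (𝒢.relabel x j (ω x))) :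
    δ ≤ A.probRegretGE 𝒢.adversary r := by
  classical
  have hE : MeasurableSet {q : LossTable n T × A.Seed | r ≤ regret q.1 (A.play q.1 q.2)} :=
    measurableSet_le measurable_const A.measurable_regret
  unfold PFEAlgorithm.probRegretGE
  rw [← integral_indicator_one hE]
  refine 𝒢.le_integral_gameLaw A (measurable_one.indicator hE)
    ((integrable_const (1 : ℝ)).indicator hE) fun s => ?_
  obtain ⟨Φ, hΦ⟩ := 𝒢.exists_perm A s
  have key := (h Φ).trans (freq_mono
    (q := fun ω => r ≤ regret (𝒢.table ω) (A.play (𝒢.table ω) s)) fun ω ⟨j, hj⟩ =>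
      le_trans (by linarith) (hΦ ω j))
  rw [freq_eq_expect] at key
  refine key.trans (le_of_eq (Finset.expect_congr rfl fun ω _ => ?_))
  simp [Set.indicator]

theorem le_expectedRegret [NeZero n] (A : PFEAlgorithm n T) {M : (ι → G) → ℝ}
    (hM : ∀ ω, ∃ j, M ω ≤ -∑ x, 𝒢.gain (𝒢.relabel x j (ω x))) :
    (𝔼 ω : ι → G, ∑ x, 𝒢.gain (ω x) + 𝔼 ω, M ω) / 2 ≤ A.expectedRegret 𝒢.adversary := by
  unfold PFEAlgorithm.expectedRegret
  refine 𝒢.le_integral_gameLaw A A.measurable_regret (A.integrable_regret _) fun s => ?_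
  obtain ⟨Φ, hΦ⟩ := 𝒢.exists_perm A s
  rw [← Fintype.expect_equiv Φ (fun ω => ∑ x, 𝒢.gain (Φ ω x)) _ fun _ => rfl,
    ← Finset.expect_add_distrib, Finset.expect_div]
  refine Finset.expect_le_expect fun ω _ => ?_
  obtain ⟨j, hj⟩ := hM ω
  refine le_trans ?_ (hΦ ω j)
  linarith

end OutcomeGame

/-! ## Sums of independent centered outcomes -/

section Moments
variable {ι G : Type*} [Fintype ι] [DecidableEq ι] [Fintype G] [Nonempty G] {φ : G → ℝ}

/-- Independence and centering make the cross terms vanish in the moment computations. -/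
lemma expect_apply_mul (hφ : 𝔼 g, φ g = 0) {s : Finset ι} {a : ι} (ha : a ∉ s)
    (F : ℝ → ℝ) : 𝔼 ω : ι → G, φ (ω a) * F (∑ i ∈ s, φ (ω i)) = 0 := by
  rw [expect_mul_of_dependsOn {a} (f := fun ω : ι → G => φ (ω a))
    (g := fun ω => F (∑ i ∈ s, φ (ω i))), expect_apply, hφ, zero_mul]
  · exact fun ω ω' h => by rw [h a (Finset.mem_singleton_self a)]
  · intro ω ω' h
    refine congrArg F (Finset.sum_congr rfl fun i hi => ?_)
    rw [h i fun hia => ha (Finset.mem_singleton.1 hia ▸ hi)]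

lemma expect_sum_apply (hφ : 𝔼 g, φ g = 0) (s : Finset ι) :
    𝔼 ω : ι → G, ∑ i ∈ s, φ (ω i) = 0 := by
  rw [Finset.expect_sum_comm]
  exact Finset.sum_eq_zero fun i _ => by rw [expect_apply, hφ]

lemma expect_sum_sq (hφ : 𝔼 g, φ g = 0) (s : Finset ι) :
    𝔼 ω : ι → G, (∑ i ∈ s, φ (ω i)) ^ 2 = s.card * 𝔼 g, φ g ^ 2 := by
  induction s using Finset.induction_on with
  | empty => simp
  | insert a s ha ih =>
    have h : ∀ ω : ι → G, (∑ i ∈ insert a s, φ (ω i)) ^ 2 =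
        φ (ω a) ^ 2 + 2 * (φ (ω a) * ∑ i ∈ s, φ (ω i)) + (∑ i ∈ s, φ (ω i)) ^ 2 := fun ω => by
      rw [Finset.sum_insert ha]; ring
    simp_rw [h]
    rw [Finset.expect_add_distrib, Finset.expect_add_distrib, ih, ← Finset.mul_expect,
      expect_apply_mul hφ ha fun x => x, expect_apply a fun g => φ g ^ 2,
      Finset.card_insert_of_notMem ha]
    push_cast; ring

/-- Chebyshev's inequality for a sum of independent outcomes. -/
lemma freq_abs_sum_ge_le (hφ : 𝔼 g, φ g = 0) (s : Finset ι) {a : ℝ} (ha : 0 < a) :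
    freq (fun ω : ι → G => a ≤ |∑ i ∈ s, φ (ω i)|) ≤ s.card * (𝔼 g, φ g ^ 2) / a ^ 2 :=
  (freq_abs_ge_le ha).trans (by rw [expect_sum_sq hφ])

end Moments

/-- The probability that independent outcomes all have a property. -/
lemma freq_forall {ι G : Type*} [Fintype ι] [DecidableEq ι] [Fintype G] (p : G → Prop) :
    freq (fun ω : ι → G => ∀ i, p (ω i)) = freq p ^ Fintype.card ι := by
  classical
  rw [freq_eq_expect, freq_eq_expect, Fintype.expect_eq_sum_div_card,
    Fintype.expect_eq_sum_div_card, div_pow, Fintype.card_fun]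
  push_cast
  congr 1
  rw [← Finset.card_univ (α := ι), ← Finset.prod_const, Finset.prod_univ_sum,
    Fintype.piFinset_univ]
  refine Finset.sum_congr rfl fun ω _ => ?_
  by_cases h : ∀ i, p (ω i)
  · simp [h]
  · simp only [h, if_false]
    push Not at h
    obtain ⟨i, hi⟩ := h
    exact (Finset.prod_eq_zero (Finset.mem_univ i) (by simp [hi])).symm

/-! ## Fair signs -/

/-- The signs `1` and `-1`. -/
noncomputable def sgn (b : Bool) : ℝ := if b then 1 else -1

lemma sgn_sq (b : Bool) : sgn b ^ 2 = 1 := by cases b <;> simp [sgn]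

lemma abs_sgn (b : Bool) : |sgn b| = 1 := by cases b <;> simp [sgn]

lemma sgn_not (b : Bool) : sgn (!b) = -sgn b := by cases b <;> simp [sgn]

lemma expect_sgn : 𝔼 b, sgn b = 0 := by
  rw [Fintype.expect_eq_sum_div_card]; simp [sgn]

section Signs
variable {ι : Type*} [Fintype ι] [DecidableEq ι]

lemma expect_sum_sgn_sq (s : Finset ι) :
    𝔼 ω : ι → Bool, (∑ i ∈ s, sgn (ω i)) ^ 2 = s.card := by
  rw [expect_sum_sq expect_sgn]; simp [sgn_sq]

/-- When a sign is added, its odd powers average out and its even powers are 1, so only `1 + 6 * S ^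
2 + S ^ 4` survives. -/
lemma expect_sum_sgn_pow_four (s : Finset ι) :
    𝔼 ω : ι → Bool, (∑ i ∈ s, sgn (ω i)) ^ 4 = 3 * (s.card : ℝ) ^ 2 - 2 * s.card := by
  induction s using Finset.induction_on with
  | empty => simp
  | insert a s ha ih =>
    have h : ∀ ω : ι → Bool, (∑ i ∈ insert a s, sgn (ω i)) ^ 4 =
        1 + 4 * (sgn (ω a) * ∑ i ∈ s, sgn (ω i)) + 6 * (∑ i ∈ s, sgn (ω i)) ^ 2 +
          4 * (sgn (ω a) * (∑ i ∈ s, sgn (ω i)) ^ 3) + (∑ i ∈ s, sgn (ω i)) ^ 4 := fun ω => by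
      rw [Finset.sum_insert ha]
      have h := sgn_sq (ω a)
      linear_combination (sgn (ω a) ^ 2 + 1 + 4 * sgn (ω a) * (∑ i ∈ s, sgn (ω i)) +
        6 * (∑ i ∈ s, sgn (ω i)) ^ 2) * h
    simp_rw [h]
    rw [Finset.expect_add_distrib, Finset.expect_add_distrib, Finset.expect_add_distrib,
      Finset.expect_add_distrib, ih, ← Finset.mul_expect, ← Finset.mul_expect, ← Finset.mul_expect,
      expect_apply_mul expect_sgn ha fun x => x, expect_apply_mul expect_sgn ha fun x => x ^ 3,
      expect_sum_sgn_sq, Finset.card_insert_of_notMem ha, Fintype.expect_const]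
    push_cast; ring

/-- Flipping the signs in `u`. -/
def flipSigns {ι : Type*} [DecidableEq ι] (u : Finset ι) : Equiv.Perm (ι → Bool) :=
  Function.Involutive.toPerm (fun ω i => if i ∈ u then !ω i else ω i) fun ω => by
    funext i; by_cases h : i ∈ u <;> simp [h]

lemma sgn_flipSigns {ι : Type*} [DecidableEq ι] (u : Finset ι) (ω : ι → Bool) (i : ι) :
    sgn (flipSigns u ω i) = if i ∈ u then -sgn (ω i) else sgn (ω i) := by
  have : flipSigns u ω i = if i ∈ u then !ω i else ω i := rfl
  rw [this]
  split_ifs <;> simp [sgn_not]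

lemma sum_flipSigns_univ (ω : ι → Bool) (s : Finset ι) :
    ∑ i ∈ s, sgn (flipSigns Finset.univ ω i) = -∑ i ∈ s, sgn (ω i) := by
  rw [← Finset.sum_neg_distrib]
  exact Finset.sum_congr rfl fun i _ => by simp [sgn_flipSigns]

/-- The sum of fair signs is symmetric. -/
lemma freq_sum_sgn_neg (s : Finset ι) (p : ℝ → Prop) :
    freq (fun ω : ι → Bool => p (-∑ i ∈ s, sgn (ω i))) =
      freq fun ω : ι → Bool => p (∑ i ∈ s, sgn (ω i)) := by
  rw [← freq_comp_equiv (flipSigns Finset.univ)]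
  exact freq_congr fun ω => by rw [sum_flipSigns_univ, neg_neg]

/-- The fourth-moment method: for `y ≥ 0` one has `y ≥ 3/4 * y ^ 2 - 1/12 * y ^ 4`. Apply this to `y
= |S| / √m`, whose second moment is 1 and whose fourth moment is at most 3. -/
lemma half_sqrt_le_expect_abs (s : Finset ι) :
    √(s.card : ℝ) / 2 ≤ 𝔼 ω : ι → Bool, |∑ i ∈ s, sgn (ω i)| := by
  rcases s.eq_empty_or_nonempty with rfl | hs
  · simp
  have hm : (0 : ℝ) < s.card := by exact_mod_cast hs.card_pos
  set m : ℝ := (s.card : ℝ) with hmdef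
  have hr : 0 < √m := Real.sqrt_pos.2 hm
  have hr2 : √m ^ 2 = m := Real.sq_sqrt hm.le
  have key : ∀ x : ℝ, √m * (3 / 4 * (x ^ 2 / m) - 1 / 12 * (x ^ 4 / m ^ 2)) ≤ |x| := by
    intro x
    obtain ⟨y, hy, hxy⟩ : ∃ y, 0 ≤ y ∧ |x| = √m * y :=
      ⟨|x| / √m, by positivity, by field_simp⟩
    have h2 : x ^ 2 = m * y ^ 2 := by rw [← sq_abs, hxy, mul_pow, hr2]
    have h4 : x ^ 4 = m ^ 2 * y ^ 4 := by
      rw [show x ^ 4 = (x ^ 2) ^ 2 by ring, h2]; ring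
    rw [hxy, h2, h4, mul_div_cancel_left₀ _ hm.ne', mul_div_cancel_left₀ _ (by positivity)]
    refine mul_le_mul_of_nonneg_left ?_ hr.le
    nlinarith [mul_nonneg hy (sq_nonneg (y - 2)), mul_nonneg hy (mul_nonneg hy (sq_nonneg (y - 2))),
      mul_nonneg hy (sq_nonneg (y - 1)), mul_nonneg hy (sq_nonneg (y ^ 2 - 4))]
  calc √m / 2 ≤ √m * (3 / 4 * (m / m) - 1 / 12 * ((3 * m ^ 2 - 2 * m) / m ^ 2)) := by
        rw [div_self hm.ne', div_eq_mul_inv]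
        refine mul_le_mul_of_nonneg_left ?_ hr.le
        have : (3 * m ^ 2 - 2 * m) / m ^ 2 ≤ 3 := by
          rw [div_le_iff₀ (by positivity)]; linarith
        norm_num
        linarith
    _ = 𝔼 ω : ι → Bool, √m * (3 / 4 * ((∑ i ∈ s, sgn (ω i)) ^ 2 / m) -
          1 / 12 * ((∑ i ∈ s, sgn (ω i)) ^ 4 / m ^ 2)) := by
        rw [← Finset.mul_expect, Finset.expect_sub_distrib, ← Finset.mul_expect,
          ← Finset.mul_expect, ← Finset.expect_div, ← Finset.expect_div, expect_sum_sgn_sq,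
          expect_sum_sgn_pow_four]
    _ ≤ _ := Finset.expect_le_expect fun ω _ => key _

/-- A quadratic minorant in `y = S ^ 2 / m` of the indicator of `y ≥ 1/4` has expectation at least
`3/16` by the same moments; the symmetry of `S` then halves the bound. -/
lemma three_div_le_freq_sum_sgn (s : Finset ι) :
    3 / 32 ≤ freq fun ω : ι → Bool => √(s.card : ℝ) / 2 ≤ ∑ i ∈ s, sgn (ω i) := by
  classical
  rcases s.eq_empty_or_nonempty with rfl | hs
  · simp [freq]; norm_num
  have hm : (0 : ℝ) < s.card := by exact_mod_cast hs.card_pos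
  set m : ℝ := (s.card : ℝ) with hmdef
  have hr : 0 < √m := Real.sqrt_pos.2 hm
  have hr2 : √m ^ 2 = m := Real.sq_sqrt hm.le
  have h1 : 3 / 16 ≤ freq fun ω : ι → Bool => √m / 2 ≤ |∑ i ∈ s, sgn (ω i)| := by
    have key : ∀ x : ℝ, 3 / 4 * (x ^ 2 / m) - 1 / 8 * (x ^ 4 / m ^ 2) - 3 / 16 ≤
        if √m / 2 ≤ |x| then (1 : ℝ) else 0 := by
      intro x
      obtain ⟨y, hxy⟩ : ∃ y, y = x ^ 2 / m := ⟨_, rfl⟩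
      have h4 : x ^ 4 / m ^ 2 = y ^ 2 := by rw [hxy]; ring
      have hy : 0 ≤ y := by rw [hxy]; positivity
      rw [h4, ← hxy]
      split_ifs with h
      · nlinarith [sq_nonneg (y - 3)]
      · have h2 : x ^ 2 < m / 4 := by
          push Not at h
          have := mul_self_lt_mul_self (abs_nonneg x) h
          rw [abs_mul_abs_self] at this
          nlinarith
        have : y < 1 / 4 := by rw [hxy, div_lt_iff₀ hm]; linarith
        nlinarith [sq_nonneg y]
    calc (3 : ℝ) / 16 ≤ 3 / 4 * (m / m) - 1 / 8 * ((3 * m ^ 2 - 2 * m) / m ^ 2) - 3 / 16 := by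
          rw [div_self hm.ne']
          have : (3 * m ^ 2 - 2 * m) / m ^ 2 ≤ 3 := by
            rw [div_le_iff₀ (by positivity)]; linarith
          linarith
      _ = 𝔼 ω : ι → Bool, (3 / 4 * ((∑ i ∈ s, sgn (ω i)) ^ 2 / m) -
          1 / 8 * ((∑ i ∈ s, sgn (ω i)) ^ 4 / m ^ 2) - 3 / 16) := by
        rw [Finset.expect_sub_distrib, Finset.expect_sub_distrib, ← Finset.mul_expect,
          ← Finset.mul_expect, ← Finset.expect_div, ← Finset.expect_div, expect_sum_sgn_sq,
          expect_sum_sgn_pow_four, Fintype.expect_const]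
      _ ≤ _ := by
        rw [freq_eq_expect]
        exact Finset.expect_le_expect fun ω _ => key _
  have h2 := freq_or_le (fun ω : ι → Bool => √m / 2 ≤ ∑ i ∈ s, sgn (ω i))
    (fun ω => √m / 2 ≤ -∑ i ∈ s, sgn (ω i))
  rw [freq_sum_sgn_neg s fun x => √m / 2 ≤ x] at h2
  have h3 : (freq fun ω : ι → Bool => √m / 2 ≤ |∑ i ∈ s, sgn (ω i)|) ≤ _ := freq_mono fun ω hω =>
    (le_abs.1 hω : _ ∨ _)
  linarith

end Signs

/-! ## Adversaries with blocks of signs -/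

section SignGame
variable {n T k B : ℕ}

/-- In each of the `k` blocks of length `B`, fair signs are drawn, and every expert gains them or
their negatives, as given by `s`. -/
noncomputable def signGame (h : k * B ≤ T) (s : Fin n → Fin k → Bool) :
    OutcomeGame n T (Fin k × Fin B) Bool where
  round x := Fin.castLE h (finProdFinEquiv x)
  round_injective := (Fin.castLE_injective h).comp finProdFinEquiv.injective
  gain := sgn
  gain_mem b := (abs_sgn b).le
  relabel x i := if s i x.1 then Equiv.refl _ else Equiv.boolNot

/-- The sum of the signs of a block. -/
noncomputable def blockSum (ω : Fin k × Fin B → Bool) (b : Fin k) : ℝ := ∑ j, sgn (ω (b, j))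

lemma sum_sgn_eq (ω : Fin k × Fin B → Bool) : ∑ x, sgn (ω x) = ∑ b, blockSum ω b := by
  rw [Fintype.sum_prod_type]; rfl

lemma signGame_sum (h : k * B ≤ T) (s : Fin n → Fin k → Bool) (ω : Fin k × Fin B → Bool)
    (j : Fin n) : ∑ x, (signGame h s).gain ((signGame h s).relabel x j (ω x)) =
      ∑ b, sgn (s j b) * blockSum ω b := by
  rw [Fintype.sum_prod_type]
  refine Finset.sum_congr rfl fun b _ => ?_
  rw [blockSum, Finset.mul_sum]
  refine Finset.sum_congr rfl fun x _ => ?_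
  cases hs : s j b
  · cases ω (b, x) <;> simp [signGame, hs, sgn]
  · cases ω (b, x) <;> simp [signGame, hs, sgn]

/-- The gain of the best expert, when all combinations of signs occur. -/
lemma exists_signGame_sum_eq (h : k * B ≤ T) {s : Fin n → Fin k → Bool}
    (hs : Function.Surjective s) (ω : Fin k × Fin B → Bool) :
    ∃ j, ∑ b, |blockSum ω b| =
      -∑ x, (signGame h s).gain ((signGame h s).relabel x j (ω x)) := by
  obtain ⟨j, hj⟩ := hs fun b => decide (blockSum ω b < 0)
  refine ⟨j, ?_⟩
  rw [signGame_sum, ← Finset.sum_neg_distrib]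
  refine Finset.sum_congr rfl fun b _ => ?_
  rw [hj]
  by_cases hb : blockSum ω b < 0
  · simp [hb, sgn, abs_of_neg]
  · simp [hb, sgn, abs_of_nonneg (not_lt.1 hb)]

/-- The gain of the better one of two opposite experts. -/
lemma exists_signGame_sum_nonneg (h : k * B ≤ T) {s : Fin n → Fin k → Bool} {i j : Fin n}
    (hs : ∀ b, s j b = !s i b) (ω : Fin k × Fin B → Bool) :
    ∃ j, 0 ≤ -∑ x, (signGame h s).gain ((signGame h s).relabel x j (ω x)) := by
  have h1 : ∑ b, sgn (s j b) * blockSum ω b = -∑ b, sgn (s i b) * blockSum ω b := by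
    rw [← Finset.sum_neg_distrib]
    exact Finset.sum_congr rfl fun b _ => by rw [hs b, sgn_not, neg_mul]
  rcases le_total 0 (∑ b, sgn (s i b) * blockSum ω b) with h2 | h2
  · exact ⟨j, by rw [signGame_sum]; linarith⟩
  · exact ⟨i, by rw [signGame_sum]; linarith⟩

lemma exists_surjective_signs (hn : 2 ^ k ≤ n) :
    ∃ s : Fin n → Fin k → Bool, Function.Surjective s := by
  obtain ⟨f⟩ : Nonempty ((Fin k → Bool) ↪ Fin n) :=
    Function.Embedding.nonempty_of_card_le (by simpa using hn)
  exact ⟨Function.invFun f, Function.invFun_surjective f.injective⟩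

lemma signGame_le_expectedRegret [NeZero n] (h : k * B ≤ T) {s : Fin n → Fin k → Bool}
    (hs : Function.Surjective s) (A : PFEAlgorithm n T) :
    k * √(B : ℝ) / 4 ≤ A.expectedRegret (signGame h s).adversary := by
  refine le_trans ?_ ((signGame h s).le_expectedRegret A (M := fun ω => ∑ b, |blockSum ω b|)
    fun ω => (exists_signGame_sum_eq h hs ω).imp fun j hj => hj.le)
  have h1 : 𝔼 ω : Fin k × Fin B → Bool, ∑ x, (signGame h s).gain (ω x) = 0 :=
    expect_sum_apply expect_sgn _
  have h2 : ∑ _b : Fin k, √(B : ℝ) / 2 ≤ 𝔼 ω : Fin k × Fin B → Bool, ∑ b, |blockSum ω b| := by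
    rw [Finset.expect_sum_comm]
    refine Finset.sum_le_sum fun b _ => ?_
    have := half_sqrt_le_expect_abs ({b} ×ˢ (Finset.univ : Finset (Fin B)))
    simpa [blockSum] using this
  rw [h1]
  simp only [Finset.sum_const, Finset.card_univ, Fintype.card_fin, nsmul_eq_mul] at h2
  linarith

/-- With a small probability, all blocks are unfavourable to the algorithm. -/
lemma signGame_le_probRegretGE (h : k * B ≤ T) {s : Fin n → Fin k → Bool} {i j : Fin n}
    (hs : ∀ b, s j b = !s i b) (A : PFEAlgorithm n T) :
    (3 / 32) ^ k ≤ A.probRegretGE (signGame h s).adversary (k * √(B : ℝ) / 4) := by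
  refine (signGame h s).le_probRegretGE A fun Φ => ?_
  have h1 : (3 / 32 : ℝ) ^ k ≤
      freq fun ω : Fin k × Fin B → Bool => ∀ b, √(B : ℝ) / 2 ≤ blockSum ω b := by
    have h2 := three_div_le_freq_sum_sgn (Finset.univ : Finset (Fin B))
    have h3 := freq_forall (ι := Fin k)
      (fun ω : Fin B → Bool => √(B : ℝ) / 2 ≤ ∑ j, sgn (ω j))
    rw [← freq_comp_equiv (Equiv.curry (Fin k) (Fin B) Bool)] at h3
    refine le_trans ?_ h3.ge
    rw [Fintype.card_fin]
    gcongr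
    simpa using h2
  rw [← freq_comp_equiv Φ] at h1
  refine h1.trans (freq_mono fun ω hω => ?_)
  -- The algorithm suffers in every block, while one of the two opposite experts has a nonpositive
  -- sum.
  obtain ⟨l, hl⟩ := exists_signGame_sum_nonneg h hs ω
  refine ⟨l, ?_⟩
  have h4 : ∑ _b : Fin k, √(B : ℝ) / 2 ≤ ∑ x, sgn (Φ ω x) := by
    rw [sum_sgn_eq]
    exact Finset.sum_le_sum fun b _ => hω b
  simp only [Finset.sum_const, Finset.card_univ, Fintype.card_fin, nsmul_eq_mul] at h4
  change _ ≤ ∑ x, sgn (Φ ω x) - _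
  linarith

/-- With many blocks, the gain of the best expert is concentrated. -/
lemma signGame_half_le_probRegretGE (h : k * B ≤ T) (hk : 256 ≤ k) (hB : 1 ≤ B)
    {s : Fin n → Fin k → Bool} (hs : Function.Surjective s) (A : PFEAlgorithm n T) :
    1 / 2 ≤ A.probRegretGE (signGame h s).adversary (k * √(B : ℝ) / 16) := by
  refine (signGame h s).le_probRegretGE A fun Φ => ?_
  have hk' : (256 : ℝ) ≤ k := by exact_mod_cast hk
  have hB' : (1 : ℝ) ≤ B := by exact_mod_cast hB
  set q := √(B : ℝ) with hq
  have hq0 : 0 < q := Real.sqrt_pos.2 (by linarith)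
  have hq2 : q ^ 2 = B := Real.sq_sqrt (by linarith)
  -- Chebyshev with variance `k * B`: the failure probability is at most `64 / k`, which is why 256
  -- blocks are required.
  have h1 : freq (fun ω : Fin k × Fin B → Bool => k * q / 8 ≤ |∑ x, sgn (Φ ω x)|) ≤ 1 / 4 := by
    rw [freq_comp_equiv Φ fun ω => k * q / 8 ≤ |∑ x, sgn (ω x)|]
    refine (freq_abs_sum_ge_le expect_sgn _ (by positivity)).trans ?_
    simp only [sgn_sq, Fintype.expect_const, mul_one, Finset.card_univ, Fintype.card_prod,
      Fintype.card_fin]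
    rw [div_le_iff₀ (by positivity)]
    push_cast
    rw [div_pow, mul_pow, hq2]
    nlinarith [mul_nonneg (sub_nonneg.2 hk') (mul_nonneg (by linarith : (0 : ℝ) ≤ k)
      (by linarith : (0 : ℝ) ≤ B))]
  -- Each absolute block sum has mean at least `q / 2` and variance at most `B`, so falling below
  -- half the mean bound is again a Chebyshev deviation.
  have h2 : freq (fun ω : Fin k × Fin B → Bool => ∑ b, |blockSum ω b| < k * q / 4) ≤ 1 / 4 := by
    obtain ⟨μ, hμ⟩ : ∃ μ, μ = 𝔼 ω : Fin B → Bool, |∑ j, sgn (ω j)| := ⟨_, rfl⟩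
    have hμ1 : q / 2 ≤ μ := by
      have := half_sqrt_le_expect_abs (Finset.univ : Finset (Fin B))
      simpa [hμ] using this
    let φ : (Fin B → Bool) → ℝ := fun ω => |∑ j, sgn (ω j)| - μ
    have hφ : 𝔼 ω, φ ω = 0 := by
      simp only [φ]
      rw [Finset.expect_sub_distrib, Fintype.expect_const, hμ, sub_self]
    have hφ2 : 𝔼 ω, φ ω ^ 2 ≤ B := by
      have h3 : ∀ ω, φ ω ^ 2 = (∑ j, sgn (ω j)) ^ 2 - 2 * μ * |∑ j, sgn (ω j)| + μ ^ 2 := fun ω => by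
        simp only [φ]; rw [sub_sq, sq_abs]; ring
      simp_rw [h3]
      rw [Finset.expect_add_distrib, Finset.expect_sub_distrib, ← Finset.mul_expect, ← hμ,
        Fintype.expect_const, expect_sum_sgn_sq]
      simp only [Finset.card_univ, Fintype.card_fin]
      nlinarith [sq_nonneg μ]
    have h4 := freq_abs_sum_ge_le (ι := Fin k) hφ Finset.univ (a := k * q / 4) (by positivity)
    rw [← freq_comp_equiv (Equiv.curry (Fin k) (Fin B) Bool)] at h4
    refine (freq_mono fun ω hω => ?_).trans (h4.trans ?_)
    · have h5 : ∑ b, φ (Equiv.curry (Fin k) (Fin B) Bool ω b) = ∑ b, |blockSum ω b| - k * μ := by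
        simp only [φ]
        rw [Finset.sum_sub_distrib]
        simp [blockSum]
      rw [h5, le_abs]
      right
      nlinarith
    · rw [div_le_iff₀ (by positivity), Finset.card_univ, Fintype.card_fin]
      calc (k : ℝ) * 𝔼 ω, φ ω ^ 2 ≤ k * B := by gcongr
        _ ≤ 1 / 4 * (k * q / 4) ^ 2 := by
          rw [div_pow, mul_pow, hq2]
          nlinarith [mul_nonneg (sub_nonneg.2 hk') (mul_nonneg (by linarith : (0 : ℝ) ≤ k)
            (by linarith : (0 : ℝ) ≤ B))]
  have h3 := freq_or_le (fun ω : Fin k × Fin B → Bool => k * q / 8 ≤ |∑ x, sgn (Φ ω x)|)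
    fun ω => ∑ b, |blockSum ω b| < k * q / 4
  have h4 := freq_not (fun ω : Fin k × Fin B → Bool => k * q / 8 ≤ |∑ x, sgn (Φ ω x)| ∨
    ∑ b, |blockSum ω b| < k * q / 4)
  refine le_trans (by linarith : (1 / 2 : ℝ) ≤ _) (h4.ge.trans (freq_mono fun ω hω => ?_))
  push Not at hω
  obtain ⟨l, hl⟩ := exists_signGame_sum_eq h hs ω
  refine ⟨l, ?_⟩
  have h5 := (abs_lt.1 hω.1).1
  change _ ≤ ∑ x, sgn (Φ ω x) - _
  linarith [hω.2]

/-- One iteration is enough for a regret of `1` with probability one half. -/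
lemma signGame_one_le_probRegretGE (h : 1 * 1 ≤ T) {s : Fin n → Fin 1 → Bool}
    (hs : Function.Surjective s) (A : PFEAlgorithm n T) :
    1 / 2 ≤ A.probRegretGE (signGame h s).adversary 1 := by
  refine (signGame h s).le_probRegretGE A fun Φ => ?_
  have h1 : freq (fun ω : Fin 1 × Fin 1 → Bool => Φ ω (0, 0) = true) = 1 / 2 := by
    rw [freq_comp_equiv Φ fun ω => ω (0, 0) = true, freq_eq_expect,
      expect_apply (0, 0) fun b => if b = true then (1 : ℝ) else 0, Fintype.expect_eq_sum_div_card]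
    simp
  refine h1.ge.trans (freq_mono fun ω hω => ?_)
  obtain ⟨l, hl⟩ := exists_signGame_sum_eq h hs ω
  refine ⟨l, ?_⟩
  have h2 : ∑ x, sgn (Φ ω x) = 1 := by
    rw [Fintype.sum_prod_type]; simp [hω, sgn]
  have h3 : ∑ b, |blockSum ω b| = 1 := by simp [blockSum, abs_sgn]
  change _ ≤ ∑ x, sgn (Φ ω x) - _
  linarith

end SignGame

/-! ### The number of blocks -/

/-- Rounding the block length down loses at most a factor 2, since `k ≤ T` makes `k * (T / k)` at
least `T / 2`. -/
lemma sqrt_le_blocks {k T : ℕ} (hk : 1 ≤ k) (hkT : k ≤ T) {x : ℝ} (hx : x ≤ k) :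
    √(T * x / 2) ≤ k * √((T / k : ℕ) : ℝ) := by
  have hk' : (1 : ℝ) ≤ k := by exact_mod_cast hk
  have h1 : (T : ℝ) / 2 ≤ k * (T / k : ℕ) := by
    have h2 := Nat.div_add_mod T k
    have h3 := Nat.mod_lt T (show k > 0 by omega)
    have h4 : k * 1 ≤ k * (T / k) := Nat.mul_le_mul_left k ((Nat.one_le_div_iff (by omega)).2 hkT)
    have h5 : T ≤ 2 * (k * (T / k)) := by omega
    have h6 : (T : ℝ) ≤ 2 * (k * (T / k : ℕ)) := by exact_mod_cast h5
    linarith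
  rw [Real.sqrt_le_left (by positivity), mul_pow, Real.sq_sqrt (by positivity)]
  nlinarith [mul_le_mul_of_nonneg_left hx (Nat.cast_nonneg (α := ℝ) T)]

lemma log_le_two_mul_log {n : ℕ} (hn : 2 ≤ n) : Real.log n ≤ 2 * Nat.log 2 n := by
  have h1 : 1 ≤ Nat.log 2 n := Nat.log_pos (by norm_num) hn
  have h2 : n ≤ 2 ^ (Nat.log 2 n + 1) := (Nat.lt_pow_succ_log_self (by norm_num) n).le
  have h3 : Real.log n ≤ (Nat.log 2 n + 1 : ℕ) * Real.log 2 := by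
    rw [← Real.log_pow]
    exact Real.log_le_log (by positivity) (by exact_mod_cast h2)
  have h4 : (1 : ℝ) ≤ Nat.log 2 n := by exact_mod_cast h1
  have h5 : Real.log 2 ≤ 1 := by have := Real.log_two_lt_d9; linarith
  push_cast at h3
  nlinarith

theorem lower_bound_expectation {n T : ℕ} (hn : 2 ≤ n) (hT : 1 ≤ T) :
    ∃ adv : ProbabilityMeasure (LossTable n T), ∀ A : PFEAlgorithm n T,
      1 / 8 * min (T : ℝ) (√((T : ℝ) * Real.log n)) ≤ A.expectedRegret adv := by
  have : NeZero n := ⟨by omega⟩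
  set k := min (Nat.log 2 n) T with hk
  have hk1 : 1 ≤ k := le_min (Nat.log_pos (by norm_num) hn) hT
  have hkT : k ≤ T := min_le_right _ _
  obtain ⟨s, hs⟩ := exists_surjective_signs (k := k) (n := n)
    ((Nat.pow_le_pow_right (by norm_num) (min_le_left _ _)).trans
      (Nat.pow_log_le_self 2 (by omega)))
  refine ⟨(signGame (Nat.mul_div_le T k) s).adversary, fun A => ?_⟩
  refine le_trans ?_ (signGame_le_expectedRegret (Nat.mul_div_le T k) hs A)
  -- Either `k` is the binary logarithm of `n`, at least half of `log n`, or `k = T` and the rate is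
  -- capped by `T`.
  suffices h : min (T : ℝ) (√((T : ℝ) * Real.log n)) ≤ 2 * √(T * k / 2) by
    linarith [sqrt_le_blocks hk1 hkT le_rfl]
  have h2 : (2 : ℝ) = √4 := by rw [show (4 : ℝ) = 2 ^ 2 by norm_num, Real.sqrt_sq (by norm_num)]
  rw [h2, ← Real.sqrt_mul (by norm_num)]
  rcases min_choice (Nat.log 2 n) T with h | h
  · refine (min_le_right _ _).trans (Real.sqrt_le_sqrt ?_)
    rw [hk, h]
    nlinarith [log_le_two_mul_log hn, Nat.cast_nonneg (α := ℝ) T]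
  · refine (min_le_left _ _).trans (Real.le_sqrt_of_sq_le ?_)
    rw [hk, h]
    nlinarith [Nat.cast_nonneg (α := ℝ) T]

/-! ## The law of a sum of fair signs -/

/-- The factor `2 * n + 1` is chosen so that the induction closes: it reduces to `(2 * n + 1) * (2 *
n + 3) ≤ 4 * (n + 1) ^ 2`. -/
lemma centralBinom_sq_mul_le (n : ℕ) : n.centralBinom ^ 2 * (2 * n + 1) ≤ 16 ^ n := by
  induction n with
  | zero => simp
  | succ n ih =>
    have h := Nat.succ_mul_centralBinom_succ n
    refine Nat.le_of_mul_le_mul_left (c := (n + 1) ^ 2) ?_ (by positivity)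
    calc (n + 1) ^ 2 * ((n + 1).centralBinom ^ 2 * (2 * (n + 1) + 1))
        = ((n + 1) * (n + 1).centralBinom) ^ 2 * (2 * n + 3) := by ring
      _ = n.centralBinom ^ 2 * (2 * n + 1) * (4 * ((2 * n + 1) * (2 * n + 3))) := by rw [h]; ring
      _ ≤ 16 ^ n * (16 * (n + 1) ^ 2) := Nat.mul_le_mul ih (by nlinarith)
      _ = (n + 1) ^ 2 * 16 ^ (n + 1) := by ring

/-- Even rows peak at a central binomial coefficient, and the peak of an odd row is half of the next
one. Consequently no atom of the binomial law exceeds `1 / √m`. -/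
lemma choose_sq_mul_le (m j : ℕ) : m.choose j ^ 2 * m ≤ 4 ^ m := by
  refine le_trans (Nat.mul_le_mul_right m (Nat.pow_le_pow_left (Nat.choose_le_middle j m) 2)) ?_
  rcases Nat.even_or_odd' m with ⟨n, rfl | rfl⟩
  · have := centralBinom_sq_mul_le n
    rw [Nat.centralBinom] at this
    rw [show 2 * n / 2 = n by omega, pow_mul]
    norm_num
    nlinarith [sq_nonneg ((2 * n).choose n)]
  · have h := centralBinom_sq_mul_le (n + 1)
    have h2 : (n + 1).centralBinom = 2 * (2 * n + 1).choose n := by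
      rw [Nat.centralBinom, show 2 * (n + 1) = 2 * n + 1 + 1 by ring, Nat.choose_succ_succ,
        Nat.choose_symm_half]
      ring
    rw [h2] at h
    have h3 : 16 ^ (n + 1) = 4 * 4 ^ (2 * n + 1) := by
      rw [← pow_succ', show 16 = 4 ^ 2 by norm_num, ← pow_mul]; ring_nf
    rw [show (2 * n + 1) / 2 = n by omega]
    rw [h3] at h
    nlinarith [sq_nonneg ((2 * n + 1).choose n)]

lemma choose_succ_le {m j : ℕ} (h : m ≤ 2 * j + 1) : m.choose (j + 1) ≤ m.choose j := by
  refine Nat.le_of_mul_le_mul_right (c := j + 1) ?_ (by omega)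
  rw [Nat.choose_succ_right_eq]
  exact Nat.mul_le_mul_left _ (by omega)

lemma sum_range_mul_le {a : ℕ → ℝ} (ha : Antitone a) (l k : ℕ) :
    ∑ i ∈ Finset.range (l * k), a i ≤ k * ∑ i ∈ Finset.range l, a i := by
  induction k with
  | zero => simp
  | succ k ih =>
    rw [Nat.mul_succ, Finset.sum_range_add]
    have : ∑ i ∈ Finset.range l, a (l * k + i) ≤ ∑ i ∈ Finset.range l, a i :=
      Finset.sum_le_sum fun i _ => ha (by omega)
    push_cast
    linarith

lemma card_le_of_sub_lt {s : Finset ℕ} {y : ℝ} (hy : 0 < y)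
    (h : ∀ i ∈ s, ∀ j ∈ s, (j : ℝ) - i < y) : (s.card : ℝ) ≤ y + 1 := by
  rcases s.eq_empty_or_nonempty with rfl | hs
  · simp; linarith
  have h1 : s ⊆ Finset.Icc (s.min' hs) (s.max' hs) := fun i hi =>
    Finset.mem_Icc.2 ⟨s.min'_le i hi, s.le_max' i hi⟩
  have h2 := Finset.card_le_card h1
  rw [Nat.card_Icc] at h2
  have h3 := h _ (s.min'_mem hs) _ (s.max'_mem hs)
  have h4 : s.min' hs ≤ s.max' hs := s.min'_le _ (s.max'_mem hs)
  have h5 : s.card + s.min' hs ≤ s.max' hs + 1 := by omega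
  have h6 : (s.card : ℝ) + s.min' hs ≤ s.max' hs + 1 := by exact_mod_cast h5
  linarith

section Law
variable {ι : Type*} [Fintype ι] [DecidableEq ι]

/-- The binomial law, by conditioning on one sign and Pascal's rule. -/
lemma expect_sum_sgn (s : Finset ι) (F : ℝ → ℝ) :
    2 ^ s.card * 𝔼 ω : ι → Bool, F (∑ i ∈ s, sgn (ω i)) =
      ∑ j ∈ Finset.range (s.card + 1), (s.card.choose j : ℝ) * F (2 * j - s.card) := by
  induction s using Finset.induction_on generalizing F with
  | empty => simp
  | insert a s ha ih =>
    have h1 : 𝔼 ω : ι → Bool, F (∑ i ∈ insert a s, sgn (ω i)) =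
        (𝔼 ω : ι → Bool, F (1 + ∑ i ∈ s, sgn (ω i)) +
          𝔼 ω : ι → Bool, F (-1 + ∑ i ∈ s, sgn (ω i))) / 2 := by
      rw [expect_resample {a}]
      have h2 : ∀ ω ω' : ι → Bool, F (∑ i ∈ insert a s, sgn (({a} : Finset ι).piecewise ω ω' i)) =
          F (sgn (ω a) + ∑ i ∈ s, sgn (ω' i)) := by
        intro ω ω'
        rw [Finset.sum_insert ha]
        congr 2
        · simp
        · refine Finset.sum_congr rfl fun i hi => ?_
          rw [Finset.piecewise_eq_of_notMem]
          exact fun h => ha (Finset.mem_singleton.1 h ▸ hi)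
      simp_rw [h2]
      rw [expect_apply a fun b => 𝔼 ω' : ι → Bool, F (sgn b + ∑ i ∈ s, sgn (ω' i)),
        Fintype.expect_eq_sum_div_card]
      simp [sgn]
    rw [h1, Finset.card_insert_of_notMem ha, pow_succ]
    have h3 := ih fun x => F (1 + x)
    have h4 := ih fun x => F (-1 + x)
    have h5 := Finset.sum_choose_succ_mul (R := ℝ)
      (fun i _ => F (2 * (i : ℝ) - ((s.card + 1 : ℕ) : ℝ))) s.card
    rw [h5]
    calc _ = 2 ^ s.card * 𝔼 ω : ι → Bool, F (1 + ∑ i ∈ s, sgn (ω i)) +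
          2 ^ s.card * 𝔼 ω : ι → Bool, F (-1 + ∑ i ∈ s, sgn (ω i)) := by ring
      _ = _ := by
        rw [h3, h4, add_comm]
        congr 1
        · refine Finset.sum_congr rfl fun i _ => ?_
          congr 2; push_cast; ring
        · refine Finset.sum_congr rfl fun i _ => ?_
          congr 2; push_cast; ring

lemma freq_sum_sgn (s : Finset ι) (p : ℝ → Prop) [DecidablePred p] :
    2 ^ s.card * freq (fun ω : ι → Bool => p (∑ i ∈ s, sgn (ω i))) =
      ∑ j ∈ (Finset.range (s.card + 1)).filter (fun j : ℕ => p (2 * (j : ℝ) - s.card)),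
        (s.card.choose j : ℝ) := by
  rw [freq_eq_expect, expect_sum_sgn s fun x => if p x then (1 : ℝ) else 0, Finset.sum_filter]
  exact Finset.sum_congr rfl fun j _ => by simp

/-- A sum of signs is not concentrated on short intervals. -/
lemma freq_abs_sum_sgn_sub_lt_le {s : Finset ι} (hs : s.Nonempty) (x : ℝ) {y : ℝ} (hy : 0 < y) :
    freq (fun ω : ι → Bool => |∑ i ∈ s, sgn (ω i) - x| < y) ≤ (y + 1) / √(s.card : ℝ) := by
  classical
  have hm : (0 : ℝ) < s.card := by exact_mod_cast hs.card_pos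
  set m := s.card
  have hr : 0 < √(m : ℝ) := Real.sqrt_pos.2 hm
  have h1 := freq_sum_sgn s fun z => |z - x| < y
  have h2 : ∀ j, (m.choose j : ℝ) ≤ 2 ^ m / √(m : ℝ) := by
    intro j
    rw [le_div_iff₀ hr]
    refine le_of_sq_le_sq ?_ (by positivity)
    rw [mul_pow, Real.sq_sqrt hm.le, ← pow_mul, mul_comm m 2, pow_mul]
    norm_num
    exact_mod_cast choose_sq_mul_le m j
  refine le_of_mul_le_mul_left ?_ (by positivity : (0 : ℝ) < 2 ^ m)
  rw [h1]
  refine (Finset.sum_le_sum fun j _ => h2 j).trans ?_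
  rw [Finset.sum_const, nsmul_eq_mul]
  refine (mul_le_mul_of_nonneg_right (card_le_of_sub_lt hy fun i hi j hj => ?_)
    (by positivity)).trans (le_of_eq (by ring))
  have h3 := abs_lt.1 (Finset.mem_filter.1 hi).2
  have h4 := abs_lt.1 (Finset.mem_filter.1 hj).2
  linarith [h3.1, h4.2]

/-- The sum lives on a lattice of spacing 2, so the interval contains `L` lattice points; `(m + 1) /
2` is the first index with a nonnegative value for either parity of `m`. -/
lemma freq_sum_sgn_mem_Ico (s : Finset ι) (L : ℕ) :
    2 ^ s.card * freq (fun ω : ι → Bool => 0 ≤ ∑ i ∈ s, sgn (ω i) ∧ ∑ i ∈ s, sgn (ω i) < 2 * L) =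
      ∑ i ∈ Finset.range L, (s.card.choose ((s.card + 1) / 2 + i) : ℝ) := by
  classical
  set m := s.card with hm
  rw [freq_sum_sgn s fun z => 0 ≤ z ∧ z < 2 * L, ← hm]
  have h1 := Finset.sum_Ico_eq_sum_range (fun j => (m.choose j : ℝ)) ((m + 1) / 2) ((m + 1) / 2 + L)
  rw [Nat.add_sub_cancel_left] at h1
  rw [← h1]
  have h2 : ∀ j : ℕ, (0 ≤ 2 * (j : ℝ) - m ∧ 2 * (j : ℝ) - m < 2 * L) ↔
      (m + 1) / 2 ≤ j ∧ j < (m + 1) / 2 + L := by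
    intro j
    have e1 : 0 ≤ 2 * (j : ℝ) - m ↔ m ≤ 2 * j := by
      rw [sub_nonneg]; exact_mod_cast Iff.rfl
    have e2 : 2 * (j : ℝ) - m < 2 * L ↔ 2 * j < 2 * L + m := by
      rw [sub_lt_iff_lt_add]; exact_mod_cast Iff.rfl
    rw [e1, e2]
    omega
  refine Finset.sum_subset (fun j hj => ?_) fun j hj hj' => ?_
  · exact Finset.mem_Ico.2 ((h2 j).1 (Finset.mem_filter.1 hj).2)
  · rw [Finset.mem_filter, not_and_or] at hj'
    rcases hj' with hj' | hj'
    · rw [Finset.mem_range] at hj'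
      rw [Nat.choose_eq_zero_of_lt (by omega), Nat.cast_zero]
    · exact absurd ((h2 j).2 (Finset.mem_Ico.1 hj)) hj'

/-- Shorter central intervals are not much less likely. -/
lemma freq_abs_sum_sgn_lt_le (s : Finset ι) (l k : ℕ) :
    freq (fun ω : ι → Bool => |∑ i ∈ s, sgn (ω i)| < 2 * (l * k)) ≤
      2 * k * freq fun ω : ι → Bool => 0 ≤ ∑ i ∈ s, sgn (ω i) ∧ ∑ i ∈ s, sgn (ω i) < 2 * l := by
  have h1 : freq (fun ω : ι → Bool => |∑ i ∈ s, sgn (ω i)| < 2 * (l * k)) ≤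
      2 * freq fun ω : ι → Bool => 0 ≤ ∑ i ∈ s, sgn (ω i) ∧
        ∑ i ∈ s, sgn (ω i) < 2 * (l * k : ℕ) := by
    refine (freq_mono fun ω hω => ?_).trans ((freq_or_le (fun ω : ι → Bool =>
      0 ≤ ∑ i ∈ s, sgn (ω i) ∧ ∑ i ∈ s, sgn (ω i) < 2 * (l * k : ℕ)) (fun ω =>
      0 ≤ -∑ i ∈ s, sgn (ω i) ∧ -∑ i ∈ s, sgn (ω i) < 2 * (l * k : ℕ))).trans ?_)
    · push_cast
      obtain ⟨h2, h3⟩ := abs_lt.1 hω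
      rcases le_total 0 (∑ i ∈ s, sgn (ω i)) with h | h
      · exact Or.inl ⟨h, h3⟩
      · exact Or.inr ⟨by linarith, by linarith⟩
    · rw [freq_sum_sgn_neg s fun x => 0 ≤ x ∧ x < 2 * (l * k : ℕ)]
      linarith
  have h2 : freq (fun ω : ι → Bool => 0 ≤ ∑ i ∈ s, sgn (ω i) ∧
      ∑ i ∈ s, sgn (ω i) < 2 * (l * k : ℕ)) ≤
      k * freq fun ω : ι → Bool => 0 ≤ ∑ i ∈ s, sgn (ω i) ∧ ∑ i ∈ s, sgn (ω i) < 2 * l := by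
    refine le_of_mul_le_mul_left ?_ (by positivity : (0 : ℝ) < 2 ^ s.card)
    rw [freq_sum_sgn_mem_Ico, mul_left_comm, freq_sum_sgn_mem_Ico]
    -- From the centre on, the binomial coefficients decrease, so the first of `k` consecutive
    -- stretches of length `l` is the heaviest.
    refine sum_range_mul_le (a := fun i => (s.card.choose ((s.card + 1) / 2 + i) : ℝ))
      (antitone_nat_of_succ_le fun i => ?_) l k
    have := choose_succ_le (m := s.card) (j := (s.card + 1) / 2 + i) (by omega)
    exact_mod_cast this
  linarith

end Law

/-! ## Three experts with gains that sum to zero -/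

/-- Condition on the coordinates outside `s`: they decide `p`, and whatever they are, `q` has
conditional probability at most `b`. -/
lemma freq_and_le {ι G : Type*} [Fintype ι] [DecidableEq ι] [Fintype G] [Nonempty G]
    (s : Finset ι) {p q : (ι → G) → Prop} (hp : ∀ ω ω', (∀ i, i ∉ s → ω i = ω' i) → (p ω ↔ p ω'))
    {b : ℝ} (hq : ∀ ω', freq (fun ω => q (s.piecewise ω ω')) ≤ b) :
    freq (fun ω => p ω ∧ q ω) ≤ freq p * b := by
  classical
  rw [freq_eq_expect, expect_resample s, Finset.expect_comm, freq_eq_expect, Finset.expect_mul]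
  refine Finset.expect_le_expect fun ω' _ => ?_
  have h : ∀ ω, p (s.piecewise ω ω') ↔ p ω' := fun ω => hp _ _ fun i hi => by simp [hi]
  by_cases hω : p ω'
  · have h1 := hq ω'
    rw [freq_eq_expect] at h1
    simpa [h, hω] using h1
  · simp [h, hω]

lemma freq_arrow_prod {ι G H : Type*} [Fintype ι] [DecidableEq ι] [Fintype G] [Fintype H]
    (p : (ι → G) → (ι → H) → Prop) :
    freq (fun ω : ι → G × H => p (fun i => (ω i).1) fun i => (ω i).2) = 𝔼 ρ, freq (p ρ) := by
  rw [← freq_comp_equiv (Equiv.arrowProdEquivProdArrow ι (fun _ => G) (fun _ => H)).symm]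
  unfold freq
  rw [← Finset.univ_product_univ, Finset.expect_product]
  rfl

section Cyclic
variable {ι : Type*} [Fintype ι] [DecidableEq ι]

/-- The sum of the signs at the places of the color `c`. -/
noncomputable def colorSum (ρ : ι → ZMod 3) (ε : ι → Bool) (c : ZMod 3) : ℝ :=
  ∑ x with ρ x = c, sgn (ε x)

/-- Flipping the signs at the places of color 1 preserves the law and turns the difference into a
plain sum over the places of nonzero color. -/
lemma freq_colorSum_sub (ρ : ι → ZMod 3) (p : ℝ → Prop) :
    freq (fun ε => p (colorSum ρ ε 2 - colorSum ρ ε 1)) =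
      freq fun ε : ι → Bool => p (∑ x with ρ x ≠ 0, sgn (ε x)) := by
  rw [← freq_comp_equiv (flipSigns (Finset.univ.filter fun x => ρ x = 1))]
  refine freq_congr fun ε => ?_
  have h : (Finset.univ.filter fun x => ρ x ≠ 0) =
      (Finset.univ.filter fun x => ρ x = 2) ∪ Finset.univ.filter fun x => ρ x = 1 := by
    ext x
    simp only [Finset.mem_filter, Finset.mem_univ, true_and, Finset.mem_union]
    generalize ρ x = c
    revert c; decide
  have hd : Disjoint (Finset.univ.filter fun x => ρ x = 2)
      (Finset.univ.filter fun x => ρ x = 1) := by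
    refine Finset.disjoint_filter.2 fun x _ h1 h2 => ?_
    rw [h1] at h2
    exact absurd h2 (by decide)
  rw [h, Finset.sum_union hd]
  have e2 : colorSum ρ (flipSigns (Finset.univ.filter fun x => ρ x = 1) ε) 2 =
      ∑ x with ρ x = 2, sgn (ε x) := by
    refine Finset.sum_congr rfl fun x hx => ?_
    rw [sgn_flipSigns, if_neg]
    exact fun h1 => Finset.disjoint_left.1 hd hx h1
  have e1 : colorSum ρ (flipSigns (Finset.univ.filter fun x => ρ x = 1) ε) 1 =
      -∑ x with ρ x = 1, sgn (ε x) := by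
    rw [← Finset.sum_neg_distrib]
    exact Finset.sum_congr rfl fun x hx => by rw [sgn_flipSigns, if_pos hx]
  rw [e1, e2, sub_neg_eq_add]

/-- The first difference ignores the signs at color 0. Given the other signs, the second event puts
the sum at color 0 into a fixed interval, where anticoncentration applies. -/
lemma freq_colorSum_sub_lt_and_lt_le (ρ : ι → ZMod 3)
    (hρ : (Finset.univ.filter fun x => ρ x = 0).Nonempty) {y : ℝ} (hy : 0 < y) :
    freq (fun ε => |colorSum ρ ε 2 - colorSum ρ ε 1| < y ∧ |colorSum ρ ε 0 - colorSum ρ ε 2| < y) ≤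
      freq (fun ε => |colorSum ρ ε 2 - colorSum ρ ε 1| < y) *
        ((y + 1) / √((Finset.univ.filter fun x => ρ x = 0).card : ℝ)) := by
  have hne : ∀ {c : ZMod 3}, c ≠ 0 → ∀ {ε ε' : ι → Bool},
      (∀ i, i ∉ (Finset.univ.filter fun x => ρ x = 0) → ε i = ε' i) →
      colorSum ρ ε c = colorSum ρ ε' c := by
    intro c hc ε ε' h
    refine Finset.sum_congr rfl fun x hx => ?_
    rw [h x fun h0 => hc (((Finset.mem_filter.1 hx).2).symm.trans (Finset.mem_filter.1 h0).2)]
  refine freq_and_le (Finset.univ.filter fun x => ρ x = 0) (fun ε ε' h => ?_) fun ε' => ?_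
  · rw [hne (by decide) h, hne (by decide) h]
  · refine le_trans (le_of_eq (freq_congr fun ε => ?_))
      (freq_abs_sum_sgn_sub_lt_le hρ (colorSum ρ ε' 2) hy)
    rw [hne (c := 2) (by decide) (ε' := ε') fun i hi => by simp only [Finset.piecewise_eq_of_notMem _ _ _ hi]]
    have : colorSum ρ ((Finset.univ.filter fun x => ρ x = 0).piecewise ε ε') 0 =
        ∑ x with ρ x = 0, sgn (ε x) :=
      Finset.sum_congr rfl fun x hx => by rw [Finset.piecewise_eq_of_mem _ _ _ hx]
    rw [this]

/-- Chebyshev for the centered indicator of color 0, whose variance is `2 / 9`: a deviation of `m /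
6` from the mean `m / 3` has probability at most `8 / m`. -/
lemma freq_card_color_le [Nonempty ι] :
    freq (fun ρ : ι → ZMod 3 =>
      ((Finset.univ.filter fun x => ρ x = 0).card : ℝ) ≤ Fintype.card ι / 6) ≤
        8 / Fintype.card ι := by
  have hm : (0 : ℝ) < Fintype.card ι := by exact_mod_cast Fintype.card_pos
  let φ : ZMod 3 → ℝ := fun c => (if c = 0 then 1 else 0) - 1 / 3
  have hcard : (Fintype.card (ZMod 3) : ℝ) = 3 := by simp [ZMod.card]
  have hsum : ∀ f : ZMod 3 → ℝ, ∑ c, f c = f 0 + f 1 + f 2 := fun f => Fin.sum_univ_three f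
  have v0 : φ 0 = 2 / 3 := by simp only [φ]; norm_num
  have v1 : φ 1 = -1 / 3 := by
    simp only [φ]; rw [if_neg (by decide)]; norm_num
  have v2 : φ 2 = -1 / 3 := by
    simp only [φ]; rw [if_neg (by decide)]; norm_num
  have h1 : 𝔼 c, φ c = 0 := by
    rw [Fintype.expect_eq_sum_div_card, hsum, v0, v1, v2]; norm_num
  have h2 : 𝔼 c, φ c ^ 2 = 2 / 9 := by
    rw [Fintype.expect_eq_sum_div_card, hsum, hcard, v0, v1, v2]; norm_num
  have h3 := freq_abs_sum_ge_le (ι := ι) h1 Finset.univ (a := Fintype.card ι / 6) (by positivity)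
  rw [h2, Finset.card_univ] at h3
  refine (freq_mono fun ρ hρ => ?_).trans (h3.trans (le_of_eq ?_))
  · have h4 : ∑ x, φ (ρ x) =
        ((Finset.univ.filter fun x => ρ x = 0).card : ℝ) - Fintype.card ι / 3 := by
      simp only [φ]
      rw [Finset.sum_sub_distrib, Finset.sum_boole]
      simp; ring
    rw [h4, le_abs]
    right; linarith
  · field_simp; norm_num

/-- Central intervals of width proportional to `√T` keep their share of the probability. -/
lemma le_freq_colorSum_sub (ρ : ι → ZMod 3) {g : ℝ} (hg : 8 ≤ g)
    (hT : g * 480 = √(Fintype.card ι : ℝ)) :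
    1 / 10240 ≤ freq fun ε : ι → Bool => |colorSum ρ ε 2 - colorSum ρ ε 1| ≤ g / 2 := by
  rw [freq_colorSum_sub ρ fun x => |x| ≤ g / 2]
  set s := Finset.univ.filter fun x => ρ x ≠ 0
  have hT2 : (g * 480) ^ 2 = Fintype.card ι := by rw [hT, Real.sq_sqrt (Nat.cast_nonneg _)]
  set l := ⌊g / 4⌋₊
  have hl1 : (l : ℝ) ≤ g / 4 := Nat.floor_le (by linarith)
  have hl2 : g / 4 < l + 1 := Nat.lt_floor_add_one _
  -- The sum is within `2 * √T`, which is `2 * (g * 480)`, with probability at least `3/4`. Since `l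
  -- ≥ g / 8`, this range is covered by 3840 stretches on each side.
  have h1 := freq_abs_sum_ge_le (ι := ι) expect_sgn s (a := 2 * (g * 480)) (by linarith)
  have h2 : (s.card : ℝ) * (𝔼 b, sgn b ^ 2) / (2 * (g * 480)) ^ 2 ≤ 1 / 4 := by
    have h3 : (s.card : ℝ) ≤ Fintype.card ι := by exact_mod_cast s.card_le_univ
    simp only [sgn_sq, Fintype.expect_const, mul_one]
    rw [mul_pow, hT2, div_le_iff₀ (by rw [← hT2]; positivity)]
    linarith
  have h4 := freq_not fun ω : ι → Bool => 2 * (g * 480) ≤ |∑ i ∈ s, sgn (ω i)|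
  have h5 := freq_abs_sum_sgn_lt_le s l 3840
  have h6 : freq (fun ω : ι → Bool => ¬2 * (g * 480) ≤ |∑ i ∈ s, sgn (ω i)|) ≤
      freq fun ω : ι → Bool => |∑ i ∈ s, sgn (ω i)| < 2 * (l * (3840 : ℕ)) :=
    freq_mono fun ω hω => (not_le.1 hω).trans_le (by push_cast; linarith)
  have h7 : freq (fun ω : ι → Bool => 0 ≤ ∑ i ∈ s, sgn (ω i) ∧ ∑ i ∈ s, sgn (ω i) < 2 * l) ≤
      freq fun ω : ι → Bool => |∑ i ∈ s, sgn (ω i)| ≤ g / 2 :=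
    freq_mono fun ω hω => abs_le.2 ⟨by linarith [hω.1], by linarith [hω.2]⟩
  push_cast at h5 h6
  linarith

lemma freq_colorSum_sub_lt_le (ρ : ι → ZMod 3) {g : ℝ} (hg : 8 ≤ g) :
    freq (fun ε : ι → Bool => |colorSum ρ ε 2 - colorSum ρ ε 1| < 2 * g) ≤
      16 * freq fun ε : ι → Bool => |colorSum ρ ε 2 - colorSum ρ ε 1| ≤ g / 2 := by
  rw [freq_colorSum_sub ρ fun x => |x| ≤ g / 2, freq_colorSum_sub ρ fun x => |x| < 2 * g]
  set s := Finset.univ.filter fun x => ρ x ≠ 0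
  set l := ⌊g / 4⌋₊
  have hl1 : (l : ℝ) ≤ g / 4 := Nat.floor_le (by linarith)
  have hl2 : g / 4 < l + 1 := Nat.lt_floor_add_one _
  have h5 := freq_abs_sum_sgn_lt_le s l 8
  have h6 : freq (fun ω : ι → Bool => |∑ i ∈ s, sgn (ω i)| < 2 * g) ≤
      freq fun ω : ι → Bool => |∑ i ∈ s, sgn (ω i)| < 2 * (l * (8 : ℕ)) :=
    freq_mono fun ω hω => hω.trans_le (by push_cast; linarith)
  have h7 : freq (fun ω : ι → Bool => 0 ≤ ∑ i ∈ s, sgn (ω i) ∧ ∑ i ∈ s, sgn (ω i) < 2 * l) ≤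
      freq fun ω : ι → Bool => |∑ i ∈ s, sgn (ω i)| ≤ g / 2 :=
    freq_mono fun ω hω => abs_le.2 ⟨by linarith [hω.1], by linarith [hω.2]⟩
  push_cast at h5 h6
  linarith

/-- The event that no expert has a substantial gain. -/
def NoGain (g : ℝ) (ρ : ι → ZMod 3) (ε : ι → Bool) : Prop :=
  colorSum ρ ε 1 - colorSum ρ ε 2 < g ∧ colorSum ρ ε 2 - colorSum ρ ε 0 < g ∧
    colorSum ρ ε 0 - colorSum ρ ε 1 < g

/-- The three differences sum to zero, so upper bounds `g` on all of them force each to be at most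
`2 * g` in absolute value. Confining two of them costs a factor `1/64` beyond confining one, and
widening `g / 2` to `2 * g` costs at most 16. -/
lemma freq_noGain_le (ρ : ι → ZMod 3) {g : ℝ} (hg : 8 ≤ g)
    (hT : g * 480 = √(Fintype.card ι : ℝ))
    (hρ : (Fintype.card ι / 6 : ℝ) < (Finset.univ.filter fun x => ρ x = 0).card) :
    freq (NoGain g ρ) ≤
      1 / 4 * freq fun ε : ι → Bool => |colorSum ρ ε 2 - colorSum ρ ε 1| ≤ g / 2 := by
  have hT2 : (g * 480) ^ 2 = Fintype.card ι := by rw [hT, Real.sq_sqrt (Nat.cast_nonneg _)]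
  set s := Finset.univ.filter fun x => ρ x = 0 with hs
  have hs0 : s.Nonempty := by
    rw [← Finset.card_pos]
    have : (0 : ℝ) < s.card := lt_of_le_of_lt (by positivity) hρ
    exact_mod_cast this
  have h1 := freq_colorSum_sub_lt_and_lt_le ρ hs0 (y := 2 * g) (by linarith)
  have h2 : freq (NoGain g ρ) ≤ freq fun ε => |colorSum ρ ε 2 - colorSum ρ ε 1| < 2 * g ∧
      |colorSum ρ ε 0 - colorSum ρ ε 2| < 2 * g := by
    refine freq_mono fun ε ⟨a, b, c⟩ => ⟨abs_lt.2 ⟨?_, ?_⟩, abs_lt.2 ⟨?_, ?_⟩⟩ <;> linarith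
  have h3 : (2 * g + 1) / √(s.card : ℝ) ≤ 1 / 64 := by
    have h4 : 192 * g ≤ √(s.card : ℝ) := Real.le_sqrt_of_sq_le (by nlinarith)
    rw [div_le_iff₀ (by linarith)]
    linarith
  calc freq (NoGain g ρ) ≤ _ := h2.trans h1
    _ ≤ (16 * freq fun ε : ι → Bool => |colorSum ρ ε 2 - colorSum ρ ε 1| ≤ g / 2) * (1 / 64) := by
      exact mul_le_mul (freq_colorSum_sub_lt_le ρ hg) h3 (by positivity)
        (mul_nonneg (by norm_num) (freq_nonneg _))
    _ = _ := by ring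

/-- With probability at least one half, the gain of a fixed expert is not very negative, and some
expert has a substantial gain. -/
lemma freq_lt_add_expect_noGain_le {g : ℝ} (hg : 8 ≤ g)
    (hT : g * 480 = √(Fintype.card ι : ℝ)) :
    𝔼 ρ : ι → ZMod 3, freq (fun ε : ι → Bool => colorSum ρ ε 2 - colorSum ρ ε 1 < -(g / 2)) +
      𝔼 ρ : ι → ZMod 3, freq (NoGain g ρ) ≤ 1 / 2 := by
  classical
  have hT2 : (g * 480) ^ 2 = Fintype.card ι := by rw [hT, Real.sq_sqrt (Nat.cast_nonneg _)]
  have hm : (0 : ℝ) < Fintype.card ι := by rw [← hT2]; positivity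
  have : Nonempty ι := Fintype.card_pos_iff.1 (by exact_mod_cast hm)
  let G : (ι → ZMod 3) → ℝ := fun ρ =>
    freq fun ε : ι → Bool => |colorSum ρ ε 2 - colorSum ρ ε 1| ≤ g / 2
  -- By symmetry, half of the mass outside the central interval lies below it.
  have h1 : ∀ ρ : ι → ZMod 3,
      freq (fun ε : ι → Bool => colorSum ρ ε 2 - colorSum ρ ε 1 < -(g / 2)) ≤ (1 - G ρ) / 2 := by
    intro ρ
    have h2 := freq_not fun ε : ι → Bool => |colorSum ρ ε 2 - colorSum ρ ε 1| ≤ g / 2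
    have h3 := freq_or_of_disjoint
      (p := fun ε : ι → Bool => colorSum ρ ε 2 - colorSum ρ ε 1 < -(g / 2))
      (q := fun ε : ι → Bool => -(colorSum ρ ε 2 - colorSum ρ ε 1) < -(g / 2))
      fun ε h h' => by linarith
    have h4 : freq (fun ε : ι → Bool => -(colorSum ρ ε 2 - colorSum ρ ε 1) < -(g / 2)) =
        freq fun ε : ι → Bool => colorSum ρ ε 2 - colorSum ρ ε 1 < -(g / 2) := by
      rw [freq_colorSum_sub ρ fun x => -x < -(g / 2), freq_colorSum_sub ρ fun x => x < -(g / 2)]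
      exact freq_sum_sgn_neg _ fun x => x < -(g / 2)
    have h5 : freq (fun ε : ι → Bool => colorSum ρ ε 2 - colorSum ρ ε 1 < -(g / 2) ∨
        -(colorSum ρ ε 2 - colorSum ρ ε 1) < -(g / 2)) ≤
        freq fun ε : ι → Bool => ¬|colorSum ρ ε 2 - colorSum ρ ε 1| ≤ g / 2 := by
      refine freq_mono fun ε h h' => ?_
      obtain ⟨h6, h7⟩ := abs_le.1 h'
      rcases h with h | h <;> linarith
    rw [h3, h4, h2] at h5
    simp only [G]
    linarith
  have h2 : ∀ ρ : ι → ZMod 3, freq (NoGain g ρ) ≤ 1 / 4 * G ρ +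
      if ((Finset.univ.filter fun x => ρ x = 0).card : ℝ) ≤ Fintype.card ι / 6 then 1 else 0 := by
    intro ρ
    split_ifs with h
    · have : 0 ≤ G ρ := freq_nonneg _
      linarith [freq_le_one (NoGain g ρ)]
    · rw [add_zero]
      exact freq_noGain_le ρ hg hT (not_le.1 h)
  have h3 : freq (fun ρ : ι → ZMod 3 =>
      ((Finset.univ.filter fun x => ρ x = 0).card : ℝ) ≤ Fintype.card ι / 6) ≤ 1 / 40960 := by
    refine freq_card_color_le.trans ?_
    rw [div_le_iff₀ hm, ← hT2]
    nlinarith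
  rw [freq_eq_expect] at h3
  -- The balance: `(1 - G) / 2 + G / 4 + 1 / 40960` is at most `1/2` once the average `G` is at
  -- least `1 / 10240`.
  have h4 : 1 / 10240 ≤ 𝔼 ρ, G ρ :=
    (Fintype.expect_const (ι := ι → ZMod 3) (1 / 10240 : ℝ)).ge.trans
      (Finset.expect_le_expect fun ρ _ => le_freq_colorSum_sub ρ hg hT)
  have h5 : 𝔼 ρ : ι → ZMod 3,
      freq (fun ε : ι → Bool => colorSum ρ ε 2 - colorSum ρ ε 1 < -(g / 2)) ≤ (1 - 𝔼 ρ, G ρ) / 2 := by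
    refine (Finset.expect_le_expect fun ρ _ => h1 ρ).trans (le_of_eq ?_)
    rw [← Finset.expect_div, Finset.expect_sub_distrib, Fintype.expect_const]
  have h6 := Finset.expect_le_expect fun ρ (_ : ρ ∈ Finset.univ) => h2 ρ
  rw [Finset.expect_add_distrib, ← Finset.mul_expect] at h6
  linarith

end Cyclic

/-- In each iteration, one of three experts has no gain, and the others have opposite gains; the
remaining experts copy these experts. -/
noncomputable def cyclicGame (n T : ℕ) : OutcomeGame n T (Fin T) (ZMod 3 × Bool) where
  round := id
  round_injective := Function.injective_id
  gain c := if c.1 = 2 then sgn c.2 else if c.1 = 1 then -sgn c.2 else 0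
  gain_mem c := by
    split_ifs
    · exact (abs_sgn _).le
    · rw [abs_neg]; exact (abs_sgn _).le
    · simp
  relabel _ i := Equiv.prodCongr (Equiv.subRight ((i : ℕ) : ZMod 3)) (Equiv.refl _)

/-- Expert `c` is charged the difference of two consecutive colors, so the sums of the three experts
add up to zero. -/
lemma cyclicGame_sum {n T : ℕ} (ω : Fin T → ZMod 3 × Bool) (c : ZMod 3) :
    ∑ x, (cyclicGame n T).gain ((ω x).1 - c, (ω x).2) =
      colorSum (fun x => (ω x).1) (fun x => (ω x).2) (2 + c) -
        colorSum (fun x => (ω x).1) (fun x => (ω x).2) (1 + c) := by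
  unfold colorSum
  rw [Finset.sum_filter, Finset.sum_filter, ← Finset.sum_sub_distrib]
  refine Finset.sum_congr rfl fun x _ => ?_
  simp only [cyclicGame, sub_eq_iff_eq_add]
  have h : (2 : ZMod 3) ≠ 1 := by decide
  by_cases h2 : (ω x).1 = 2 + c
  · simp [h2, h]
  · by_cases h1 : (ω x).1 = 1 + c
    · simp [h1, h.symm]
    · simp [h1, h2]

/-- With `g = √T / 480`, the algorithm's sum is at least `-g / 2` and some expert's sum is at most
`-g`, except with probability `1/2`. Halving the difference leaves a regret of `g / 4`. -/
theorem cyclicGame_le_probRegretGE {n T : ℕ} (hn : 3 ≤ n) (hT : 3840 ≤ √(T : ℝ))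
    (A : PFEAlgorithm n T) :
    1 / 2 ≤ A.probRegretGE (cyclicGame n T).adversary (√(T : ℝ) / 1920) := by
  refine (cyclicGame n T).le_probRegretGE A fun Φ => ?_
  obtain ⟨g, hg⟩ : ∃ g, g = √(T : ℝ) / 480 := ⟨_, rfl⟩
  have hg8 : 8 ≤ g := by rw [hg]; linarith
  have key := freq_lt_add_expect_noGain_le (ι := Fin T) hg8 (by rw [hg, Fintype.card_fin]; ring)
  rw [← freq_arrow_prod, ← freq_arrow_prod, ← freq_comp_equiv Φ] at key
  have h1 := freq_or_le (fun ω : Fin T → ZMod 3 × Bool =>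
      colorSum (fun x => (Φ ω x).1) (fun x => (Φ ω x).2) 2 -
        colorSum (fun x => (Φ ω x).1) (fun x => (Φ ω x).2) 1 < -(g / 2))
    fun ω => NoGain g (fun x => (ω x).1) fun x => (ω x).2
  have h2 := freq_not (fun ω : Fin T → ZMod 3 × Bool =>
      colorSum (fun x => (Φ ω x).1) (fun x => (Φ ω x).2) 2 -
        colorSum (fun x => (Φ ω x).1) (fun x => (Φ ω x).2) 1 < -(g / 2) ∨
    NoGain g (fun x => (ω x).1) fun x => (ω x).2)
  refine le_trans (by linarith : (1 / 2 : ℝ) ≤ _) (h2.ge.trans (freq_mono fun ω hω => ?_))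
  rw [not_or, not_lt] at hω
  obtain ⟨hY, hM⟩ := hω
  have h3 : ∑ x, (cyclicGame n T).gain (Φ ω x) =
      colorSum (fun x => (Φ ω x).1) (fun x => (Φ ω x).2) 2 -
        colorSum (fun x => (Φ ω x).1) (fun x => (Φ ω x).2) 1 := by
    have := cyclicGame_sum (n := n) (Φ ω) 0
    simpa using this
  have h4 : ∃ c : ℕ, c < 3 ∧ g ≤ -(colorSum (fun x => (ω x).1) (fun x => (ω x).2) (2 + (c : ZMod 3)) -
        colorSum (fun x => (ω x).1) (fun x => (ω x).2) (1 + (c : ZMod 3))) := by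
    unfold NoGain at hM
    by_contra! hcon
    refine hM ⟨?_, ?_, ?_⟩
    · have := hcon 0 (by norm_num)
      simp only [Nat.cast_zero, add_zero] at this
      linarith
    · have := hcon 1 (by norm_num)
      rw [show 2 + ((1 : ℕ) : ZMod 3) = 0 by decide, show 1 + ((1 : ℕ) : ZMod 3) = 2 by decide] at this
      linarith
    · have := hcon 2 (by norm_num)
      rw [show 2 + ((2 : ℕ) : ZMod 3) = 1 by decide, show 1 + ((2 : ℕ) : ZMod 3) = 0 by decide] at this
      linarith
  obtain ⟨c, hc, hgc⟩ := h4
  refine ⟨⟨c, by omega⟩, ?_⟩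
  rw [h3]
  change _ ≤ _ - ∑ x, (cyclicGame n T).gain ((ω x).1 - ((c : ℕ) : ZMod 3), (ω x).2)
  rw [cyclicGame_sum]
  have : 2 * (√(T : ℝ) / 1920) = g / 2 := by rw [hg]; ring
  linarith

/-! ## The lower bound with high probability -/

section HighProbability
variable {n T : ℕ}

/-- By anticoncentration the sum leaves `(-2 * r, 2 * r)` most of the time, and half of that is on
the side unfavourable to the algorithm. The probability can only approach `1/2`. -/
lemma signGame_two_le_probRegretGE (h : 1 * T ≤ T) (hT : 1 ≤ T) {s : Fin n → Fin 1 → Bool}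
    {i j : Fin n} (hs : ∀ b, s j b = !s i b) {r : ℝ} (hr : 0 < r) (A : PFEAlgorithm n T) :
    (1 - (2 * r + 1) / √(T : ℝ)) / 2 ≤ A.probRegretGE (signGame h s).adversary r := by
  refine (signGame h s).le_probRegretGE A fun Φ => ?_
  have : NeZero T := ⟨by omega⟩
  have h1 := freq_abs_sum_sgn_sub_lt_le (ι := Fin 1 × Fin T) Finset.univ_nonempty 0
    (y := 2 * r) (by linarith)
  simp only [Finset.card_univ, Fintype.card_prod, Fintype.card_fin, one_mul, sub_zero] at h1
  have h2 := freq_not fun ω : Fin 1 × Fin T → Bool => |∑ x, sgn (ω x)| < 2 * r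
  have h3 := freq_or_le (fun ω : Fin 1 × Fin T → Bool => 2 * r ≤ ∑ x, sgn (ω x))
    fun ω => 2 * r ≤ -∑ x, sgn (ω x)
  rw [freq_sum_sgn_neg Finset.univ fun x => 2 * r ≤ x] at h3
  have h4 : freq (fun ω : Fin 1 × Fin T → Bool => ¬|∑ x, sgn (ω x)| < 2 * r) ≤ _ :=
    freq_mono fun ω hω => (le_abs.1 (not_lt.1 hω) : _ ∨ _)
  have h5 : (1 - (2 * r + 1) / √(T : ℝ)) / 2 ≤
      freq fun ω : Fin 1 × Fin T → Bool => 2 * r ≤ ∑ x, sgn (ω x) := by linarith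
  rw [← freq_comp_equiv Φ] at h5
  refine h5.trans (freq_mono fun ω hω => ?_)
  obtain ⟨l, hl⟩ := exists_signGame_sum_nonneg h hs ω
  refine ⟨l, ?_⟩
  change _ ≤ ∑ x, sgn (Φ ω x) - _
  linarith

lemma PFEAlgorithm.probRegretGE_anti (A : PFEAlgorithm n T)
    (adv : ProbabilityMeasure (LossTable n T)) {r r' : ℝ} (h : r ≤ r') :
    A.probRegretGE adv r' ≤ A.probRegretGE adv r :=
  measureReal_mono fun _ hq => h.trans hq

/-- The blocks yield a multiple of the optimal rate. -/
lemma min_le_blocks {k : ℕ} (hk : 1 ≤ k) (hkT : k ≤ T) {L m : ℝ} (hm : 0 < m)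
    (h : min (T : ℝ) L / m ≤ k) :
    min (T : ℝ) (√((T : ℝ) * L)) ≤ √(2 * m) * (k * √((T / k : ℕ) : ℝ)) := by
  refine le_trans ?_ (mul_le_mul_of_nonneg_left (sqrt_le_blocks hk hkT h) (Real.sqrt_nonneg _))
  rw [← Real.sqrt_mul (by positivity),
    show 2 * m * (T * (min (T : ℝ) L / m) / 2) = T * min (T : ℝ) L by field_simp]
  rcases min_choice (T : ℝ) L with h1 | h1
  · rw [h1, Real.sqrt_mul_self (Nat.cast_nonneg _)]; exact min_le_left _ _
  · rw [h1]; exact min_le_right _ _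

/-- Here `log (n / δ) ≤ 2 * log (1 / δ)`, so the probability and not the number of experts sets the
scale. At most `log (1 / δ) / 3` blocks, each bad with probability at least `3/32 ≥ exp (-3)`, leave
probability at least `δ`. -/
theorem lower_bound_small_probability (hn : 2 ≤ n) (hT : 1 ≤ T) {δ : ℝ} (hδ : 0 < δ)
    (hδ32 : δ ≤ 1 / 32) (hδn : δ ≤ 1 / n) :
    ∃ adv : ProbabilityMeasure (LossTable n T), ∀ A : PFEAlgorithm n T,
      δ ≤ A.probRegretGE adv (1 / 20 * min (T : ℝ) (√((T : ℝ) * Real.log (n / δ)))) := by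
  have hn0 : (2 : ℝ) ≤ n := by exact_mod_cast hn
  set x := Real.log (1 / δ) with hx
  have hxe : Real.exp (-x) = δ := by
    rw [hx, one_div, Real.log_inv, neg_neg, Real.exp_log hδ]
  have he3 : 20 ≤ Real.exp 3 := by
    have h1 := Real.exp_one_gt_d9
    rw [show (3 : ℝ) = (3 : ℕ) * 1 by norm_num, Real.exp_nat_mul]
    calc (20 : ℝ) ≤ (2.7182818283 : ℝ) ^ 3 := by norm_num
      _ ≤ _ := by gcongr
  have he3' : Real.exp 3 ≤ 32 := by
    have h1 := Real.exp_one_lt_d9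
    rw [show (3 : ℝ) = (3 : ℕ) * 1 by norm_num, Real.exp_nat_mul]
    calc Real.exp 1 ^ 3 ≤ (2.7182818286 : ℝ) ^ 3 := by gcongr
      _ ≤ _ := by norm_num
  have hx3 : 3 ≤ x := by
    rw [hx, Real.le_log_iff_exp_le (by positivity), le_div_iff₀ hδ]
    nlinarith [Real.exp_pos 3]
  have hL : Real.log (n / δ) ≤ 2 * x := by
    rw [show (n : ℝ) / δ = n * (1 / δ) by ring, Real.log_mul (by positivity) (by positivity), ← hx]
    have : Real.log n ≤ x := by
      refine Real.log_le_log (by positivity) ?_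
      rw [le_div_iff₀ hδ, mul_comm]
      rwa [le_div_iff₀ (by positivity)] at hδn
    linarith
  set k := min ⌊x / 3⌋₊ T with hk
  have hk1 : 1 ≤ k := le_min (Nat.le_floor (by push_cast; linarith)) hT
  have hkx : (k : ℝ) ≤ x / 3 :=
    (Nat.cast_le.2 (min_le_left _ _)).trans (Nat.floor_le (by linarith))
  have hkL : min (T : ℝ) (Real.log (n / δ)) / 12 ≤ k := by
    have h1 := Nat.lt_floor_add_one (x / 3)
    have hT0 := Nat.cast_nonneg (α := ℝ) T
    have h2 : (1 : ℝ) ≤ ⌊x / 3⌋₊ := by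
      exact_mod_cast Nat.le_floor (show ((1 : ℕ) : ℝ) ≤ x / 3 by push_cast; linarith)
    rw [hk, Nat.cast_min]
    refine le_min ?_ ?_
    · linarith [min_le_right (T : ℝ) (Real.log (n / δ))]
    · linarith [min_le_left (T : ℝ) (Real.log (n / δ))]
  let s : Fin n → Fin k → Bool := fun i _ => decide ((i : ℕ) = 0)
  refine ⟨(signGame (Nat.mul_div_le T k) s).adversary, fun A => ?_⟩
  have h1 := signGame_le_probRegretGE (Nat.mul_div_le T k) (s := s) (i := ⟨0, by omega⟩)
    (j := ⟨1, by omega⟩) (fun b => by simp [s]) A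
  refine le_trans ?_ (h1.trans (A.probRegretGE_anti _ ?_))
  · calc δ = Real.exp (-x) := hxe.symm
      _ ≤ Real.exp (k * -3) := Real.exp_le_exp.2 (by linarith)
      _ = Real.exp (-3) ^ k := Real.exp_nat_mul _ _
      _ ≤ _ := by
        gcongr
        rw [Real.exp_neg]
        refine (inv_anti₀ (by norm_num) he3).trans (by norm_num)
  · have h2 := min_le_blocks hk1 (min_le_right _ _) (by norm_num : (0 : ℝ) < 12) hkL
    have h3 : √(2 * 12 : ℝ) ≤ 5 := Real.sqrt_le_iff.2 ⟨by norm_num, by norm_num⟩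
    have h4 : √(2 * 12 : ℝ) * (k * √((T / k : ℕ) : ℝ)) ≤ 5 * (k * √((T / k : ℕ) : ℝ)) := by gcongr
    linarith

/-- Here `log (n / δ) ≤ 2 * log n`, so the experts set the scale, and the concentration of the best
gain already gives probability one half. -/
theorem lower_bound_many_experts (hn : 2 ^ 256 ≤ n) (hT : 256 ≤ T) {δ : ℝ} (hδ : 0 < δ)
    (hδn : 1 / n ≤ δ) :
    ∃ adv : ProbabilityMeasure (LossTable n T), ∀ A : PFEAlgorithm n T,
      1 / 2 ≤ A.probRegretGE adv (1 / 48 * min (T : ℝ) (√((T : ℝ) * Real.log (n / δ)))) := by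
  have hn2 : 2 ≤ n := le_trans (by norm_num) hn
  have hn0 : (2 : ℝ) ≤ n := by exact_mod_cast hn2
  have hL : Real.log (n / δ) ≤ 2 * Real.log n := by
    rw [← Real.log_rpow (by positivity)]
    refine Real.log_le_log (by positivity) ?_
    rw [div_le_iff₀ hδ]
    rw [div_le_iff₀ (by positivity)] at hδn
    norm_cast
    push_cast
    nlinarith
  set k := min (Nat.log 2 n) T with hk
  have hk256 : 256 ≤ k := le_min (Nat.le_log_of_pow_le (by norm_num) hn) hT
  have hkT : k ≤ T := min_le_right _ _
  have hkL : min (T : ℝ) (Real.log (n / δ)) / 4 ≤ k := by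
    have hT0 := Nat.cast_nonneg (α := ℝ) T
    rw [hk, Nat.cast_min]
    refine le_min ?_ ?_
    · linarith [min_le_right (T : ℝ) (Real.log (n / δ)), log_le_two_mul_log hn2]
    · linarith [min_le_left (T : ℝ) (Real.log (n / δ))]
  obtain ⟨s, hs⟩ := exists_surjective_signs (k := k) (n := n)
    ((Nat.pow_le_pow_right (by norm_num) (min_le_left _ _)).trans
      (Nat.pow_log_le_self 2 (by omega)))
  refine ⟨(signGame (Nat.mul_div_le T k) s).adversary, fun A => ?_⟩
  refine (signGame_half_le_probRegretGE (Nat.mul_div_le T k) hk256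
    ((Nat.one_le_div_iff (by omega)).2 hkT) hs A).trans (A.probRegretGE_anti _ ?_)
  have h2 := min_le_blocks (by omega) hkT (by norm_num : (0 : ℝ) < 4) hkL
  have h3 : √(2 * 4 : ℝ) ≤ 3 := Real.sqrt_le_iff.2 ⟨by norm_num, by norm_num⟩
  have h4 : √(2 * 4 : ℝ) * (k * √((T / k : ℕ) : ℝ)) ≤ 3 * (k * √((T / k : ℕ) : ℝ)) := by gcongr
  linarith

theorem lower_bound_few_rounds (hn : 2 ≤ n) (hT : 1 ≤ T) :
    ∃ adv : ProbabilityMeasure (LossTable n T), ∀ A : PFEAlgorithm n T,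
      1 / 2 ≤ A.probRegretGE adv 1 := by
  obtain ⟨s, hs⟩ := exists_surjective_signs (k := 1) (n := n) (by simpa using hn)
  exact ⟨_, signGame_one_le_probRegretGE (by simpa using hT) hs⟩

lemma log_div_le_of_lt (hn : 2 ≤ n) (hn256 : n < 2 ^ 256) {δ : ℝ} (hδ : 0 < δ)
    (h : 1 / 32 < δ ∨ 1 / n < δ) : Real.log (n / δ) ≤ 529 := by
  have hn0 : (2 : ℝ) ≤ n := by exact_mod_cast hn
  have hl2 : Real.log 2 ≤ 1 := by have := Real.log_two_lt_d9; linarith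
  have h1 : Real.log n ≤ 256 := by
    calc Real.log n ≤ Real.log (2 ^ 256) := Real.log_le_log (by positivity) (by exact_mod_cast hn256.le)
      _ = 256 * Real.log 2 := by rw [Real.log_pow]; norm_num
      _ ≤ 256 := by linarith
  have h2 : Real.log (1 / δ) ≤ 256 := by
    rcases h with h | h
    · calc Real.log (1 / δ) ≤ Real.log (2 ^ 5) := by
            refine Real.log_le_log (by positivity) ?_
            rw [div_le_iff₀ hδ]; linarith
        _ = 5 * Real.log 2 := by rw [Real.log_pow]; norm_num
        _ ≤ 256 := by linarith
    · refine le_trans (Real.log_le_log (by positivity) ?_) h1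
      rw [div_lt_iff₀ (by positivity)] at h
      rw [div_le_iff₀ hδ]; linarith
  rw [show (n : ℝ) / δ = n * (1 / δ) by ring, Real.log_mul (by positivity) (by positivity)]
  linarith

theorem lower_bound_probability {δ₁ : ℝ} (hδ₁ : 0 < δ₁) (hδ₁' : δ₁ < 1 / 2) :
    ∃ a : ℝ, 0 < a ∧ ∀ n T : ℕ, 2 ≤ n → 1 ≤ T → ∀ δ : ℝ, 0 < δ → δ < 1 / 2 → (n = 2 → δ ≤ δ₁) →
      ∃ adv : ProbabilityMeasure (LossTable n T), ∀ A : PFEAlgorithm n T,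
        δ ≤ A.probRegretGE adv (a * min (T : ℝ) (√((T : ℝ) * Real.log ((n : ℝ) / δ)))) := by
  obtain ⟨η, hη⟩ : ∃ η, η = 1 - 2 * δ₁ := ⟨_, rfl⟩
  have hη0 : 0 < η := by linarith
  have hη1 : η < 1 := by linarith
  -- Below `√T = w` one round is enough, thanks to `a ≤ 1 / w ^ 2`. Above it, 3840 serves the
  -- three-expert game, and `2 / η` absorbs the rounding term `1 / √T` of the two-expert game.
  obtain ⟨w, hw1, hw2⟩ : ∃ w : ℝ, 3840 ≤ w ∧ 2 / η ≤ w :=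
    ⟨max 3840 (2 / η), le_max_left _ _, le_max_right _ _⟩
  -- `44160` is `1920 * 23`, from the three-expert game and `D ≤ 23 * √T`. The bound `η / 92` makes
  -- `2 * a * 23 ≤ η / 2` for two experts.
  obtain ⟨a, ha0, ha1, ha2, ha3⟩ : ∃ a : ℝ, 0 < a ∧ a ≤ 1 / w ^ 2 ∧ a ≤ 1 / 44160 ∧ a ≤ η / 92 :=
    ⟨min (1 / w ^ 2) (min (1 / 44160) (η / 92)), by positivity, min_le_left _ _,
      (min_le_right _ _).trans (min_le_left _ _), (min_le_right _ _).trans (min_le_right _ _)⟩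
  refine ⟨a, ha0, fun n T hn hT δ hδ hδ2 hδn => ?_⟩
  have hT0 : (1 : ℝ) ≤ T := by exact_mod_cast hT
  set D := min (T : ℝ) (√((T : ℝ) * Real.log ((n : ℝ) / δ))) with hD
  have hD0 : 0 ≤ D := le_min (by positivity) (Real.sqrt_nonneg _)
  have hn0 : (2 : ℝ) ≤ n := by exact_mod_cast hn
  by_cases hTw : √(T : ℝ) < w
  · obtain ⟨adv, h⟩ := lower_bound_few_rounds hn hT
    refine ⟨adv, fun A => hδ2.le.trans ((h A).trans (A.probRegretGE_anti _ ?_))⟩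
    calc a * D ≤ 1 / w ^ 2 * w ^ 2 := by
          refine mul_le_mul ha1 ((min_le_left _ _).trans ?_) hD0 (by positivity)
          exact (Real.sqrt_le_left (by linarith)).1 hTw.le
      _ = 1 := by field_simp
  push Not at hTw
  by_cases h1 : δ ≤ 1 / 32 ∧ δ ≤ 1 / n
  · obtain ⟨adv, h⟩ := lower_bound_small_probability hn hT hδ h1.1 h1.2
    refine ⟨adv, fun A => (h A).trans (A.probRegretGE_anti _ ?_)⟩
    gcongr
    linarith
  rw [not_and_or, not_le, not_le] at h1
  by_cases h2 : 2 ^ 256 ≤ n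
  · have h3 : 1 / n ≤ δ := by
      rcases h1 with h1 | h1
      · have : (2 : ℝ) ^ 256 ≤ n := by exact_mod_cast h2
        refine le_trans ?_ h1.le
        gcongr
        exact le_trans (by norm_num) this
      · exact h1.le
    have h4 : 256 ≤ T := by
      have : (3840 : ℝ) ^ 2 ≤ T := (Real.le_sqrt (by norm_num) (by positivity)).1 (hw1.trans hTw)
      have h5 : (256 : ℝ) ≤ T := by linarith
      exact_mod_cast h5
    obtain ⟨adv, h⟩ := lower_bound_many_experts h2 h4 hδ h3
    refine ⟨adv, fun A => hδ2.le.trans ((h A).trans (A.probRegretGE_anti _ ?_))⟩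
    gcongr
    linarith
  push Not at h2
  -- Now both `n` and `1 / δ` are bounded; 529, the square of 23, bounds `log (n / δ)`.
  have hD23 : D ≤ 23 * √(T : ℝ) := by
    refine (min_le_right _ _).trans ?_
    rw [show (23 : ℝ) = √529 by rw [show (529 : ℝ) = 23 ^ 2 by norm_num, Real.sqrt_sq (by norm_num)],
      ← Real.sqrt_mul (by norm_num), mul_comm (529 : ℝ)]
    refine Real.sqrt_le_sqrt ?_
    gcongr
    exact log_div_le_of_lt hn h2 hδ h1
  rcases hn.eq_or_lt with rfl | hn3
  · let s : Fin 2 → Fin 1 → Bool := fun i _ => decide ((i : ℕ) = 0)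
    have hr : 0 < a * (23 * √(T : ℝ)) := by positivity
    have hsT : 0 < √(T : ℝ) := by positivity
    refine ⟨(signGame (one_mul T).le s).adversary, fun A => (hδn rfl).trans ?_⟩
    have h3 := signGame_two_le_probRegretGE (one_mul T).le hT (s := s) (i := 0) (j := 1)
      (fun b => by simp [s]) hr A
    refine le_trans ?_ (h3.trans (A.probRegretGE_anti _ (by gcongr)))
    -- With `η = 1 - 2 * δ₁`, this leaves the probability `(1 - η) / 2 = δ₁`.
    have h4 : (2 * (a * (23 * √(T : ℝ))) + 1) / √(T : ℝ) ≤ η := by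
      rw [div_le_iff₀ hsT]
      have h5 : 1 ≤ η / 2 * √(T : ℝ) := by
        have := hw2.trans hTw
        rw [div_le_iff₀ hη0] at this
        linarith
      nlinarith
    linarith
  · refine ⟨(cyclicGame n T).adversary, fun A => hδ2.le.trans
      ((cyclicGame_le_probRegretGE hn3 (hw1.trans hTw) A).trans (A.probRegretGE_anti _ ?_))⟩
    calc a * D ≤ 1 / 44160 * (23 * √(T : ℝ)) := by gcongr
      _ = √(T : ℝ) / 1920 := by ring

end HighProbability

/-! ## The optimal rate -/

lemma PFEAlgorithm.expectedRegret_le_card {n T : ℕ} [NeZero n] (A : PFEAlgorithm n T)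
    (adv : ProbabilityMeasure (LossTable n T)) : A.expectedRegret adv ≤ T := by
  calc A.expectedRegret adv ≤ ∫ _, (T : ℝ) ∂(A.gameLaw adv) :=
        integral_mono (A.integrable_regret adv) (integrable_const _) fun q => regret_le_card _ _
    _ = T := by simp

/-- Bounds for an algorithm and against an adversary bound the minimax regret. -/
lemma minimaxRegret_mem_Icc {n T S : ℕ} [NeZero n] {a b : ℝ} {A : PFEAlgorithm n T}
    (hA : A.HasBudget S) (hb : ∀ adv, A.expectedRegret adv ≤ b)
    {adv : ProbabilityMeasure (LossTable n T)} (ha : ∀ A : PFEAlgorithm n T, a ≤ A.expectedRegret adv) :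
    minimaxRegret n T S ∈ Set.Icc a (min (T : ℝ) b) := by
  have : Nonempty {A : PFEAlgorithm n T // A.HasBudget S} := ⟨⟨A, hA⟩⟩
  have : Nonempty (ProbabilityMeasure (LossTable n T)) := ⟨adv⟩
  have hsup : ∀ A : PFEAlgorithm n T, a ≤ ⨆ adv, A.expectedRegret adv := fun A =>
    (ha A).trans (le_ciSup (f := fun adv => A.expectedRegret adv)
      ⟨T, by rintro _ ⟨adv, rfl⟩; exact A.expectedRegret_le_card adv⟩ adv)
  refine ⟨le_ciInf fun A => hsup A.1, ?_⟩
  refine (ciInf_le (f := fun A : {A : PFEAlgorithm n T // A.HasBudget S} =>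
    ⨆ adv, A.1.expectedRegret adv) ⟨a, by rintro _ ⟨A, rfl⟩; exact hsup A.1⟩ ⟨A, hA⟩).trans ?_
  exact ciSup_le fun adv => le_min (A.expectedRegret_le_card adv) (hb adv)

end

theorem mainTheorem4 :
    -- the optimal rate
    (∃ a : ℝ, 0 < a ∧ ∀ c : ℝ, 0 < c → ∃ C : ℝ, 0 < C ∧
      ∀ n T S : ℕ, HighSwitching c n T S → 2 ≤ T →
        a * min (T : ℝ) (√((T : ℝ) * Real.log n)) ≤ minimaxRegret n T S ∧
        minimaxRegret n T S ≤ min (T : ℝ) (C * (√((T : ℝ) * Real.log n) * Real.log T))) ∧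
    -- upper bound in expectation
    (∀ c : ℝ, 0 < c → ∃ (C : ℝ) (k : ℕ) (P : RealRAM.Program), 0 < C ∧
      ∀ n T S : ℕ, HighSwitching c n T S → 2 ≤ T →
        ∃ A : PFEAlgorithm n T, A.HasBudget S ∧ P.Implements S 0 A (k * (n + T) ^ k) ∧
          ∀ adv : ProbabilityMeasure (LossTable n T),
            A.expectedRegret adv ≤ C * (√((T : ℝ) * Real.log n) * Real.log T)) ∧
    -- upper bound with high probability
    (∀ c : ℝ, 0 < c → ∃ (C : ℝ) (k : ℕ) (P : RealRAM.Program), 0 < C ∧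
      ∀ n T S : ℕ, HighSwitching c n T S → ∀ δ : ℝ, 0 < δ → δ < 1 / 2 →
        ∃ A : PFEAlgorithm n T, A.HasBudget S ∧ P.Implements S δ A (k * (n + T) ^ k) ∧
          ∀ adv : ProbabilityMeasure (LossTable n T),
            1 - δ ≤ A.probRegretLE adv (C * (√((T : ℝ) * Real.log n) * Real.log (1 / δ)))) ∧
    -- lower bound in expectation
    (∃ a : ℝ, 0 < a ∧ ∀ c : ℝ, 0 < c →
      ∀ n T S : ℕ, HighSwitching c n T S →
        ∃ adv : ProbabilityMeasure (LossTable n T),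
          ∀ A : PFEAlgorithm n T, A.HasBudget S →
            a * min (T : ℝ) (√((T : ℝ) * Real.log n)) ≤ A.expectedRegret adv) ∧
    -- lower bound with high probability
    (∀ δ₁ : ℝ, 0 < δ₁ → δ₁ < 1 / 2 → ∃ a : ℝ, 0 < a ∧ ∀ c : ℝ, 0 < c →
      ∀ n T S : ℕ, HighSwitching c n T S →
        ∀ δ : ℝ, 0 < δ → δ < 1 / 2 → (n = 2 → δ ≤ δ₁) →
          ∃ adv : ProbabilityMeasure (LossTable n T),
            ∀ A : PFEAlgorithm n T, A.HasBudget S →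
              δ ≤ A.probRegretGE adv
                (a * min (T : ℝ) (√((T : ℝ) * Real.log ((n : ℝ) / δ))))) := by
  refine ⟨⟨1 / 8, by norm_num, fun c hc => ?_⟩, upper_bound_expectation, upper_bound_probability,
    ⟨1 / 8, by norm_num, fun c _ n T S hS => ?_⟩, fun δ₁ hδ₁ hδ₁' => ?_⟩
  · obtain ⟨C, k, P, hC, h⟩ := upper_bound_expectation c hc
    refine ⟨C, hC, fun n T S hS hT => ?_⟩
    obtain ⟨A, hA, -, hA2⟩ := h n T S hS hT
    have : NeZero n := ⟨by have := hS.1; omega⟩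
    obtain ⟨adv, hadv⟩ := lower_bound_expectation (n := n) (T := T) hS.1 (by omega)
    exact minimaxRegret_mem_Icc hA hA2 hadv
  · obtain ⟨adv, hadv⟩ := lower_bound_expectation (n := n) (T := T) hS.1 (hS.2.1.trans hS.2.2.1)
    exact ⟨adv, fun A _ => hadv A⟩
  · obtain ⟨a, ha, h⟩ := lower_bound_probability hδ₁ hδ₁'
    refine ⟨a, ha, fun c _ n T S hS δ hδ hδ2 hδn => ?_⟩
    obtain ⟨adv, hadv⟩ := h n T hS.1 (hS.2.1.trans hS.2.2.1) δ hδ hδ2 hδn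
    exact ⟨adv, fun A _ => hadv A⟩
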